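/- Let $n,k$ be integers with $1\le k\le n-2$ and let $\sigma\ge 0$. Let $W^n_\infty[-1,1]$ be the space of functions $f$ on $[-1,1]$ that are $n-1$ times continuously differentiable, with $f^{(n-1)}$ absolutely continuous and $f^{(n)}\in L_\infty[-1,1]$, and let $$W^n_\infty(\sigma)=\{f\in W^n_\infty[-1,1]:\ \|f\|\le 1,\ \|f^{(n)}\|\le\sigma\},\qquad \|\cdot\|=\|\cdot\|_{L_\infty[-1,1]}.$$ For $x_0\in[-1,1]$ put $$m_k^*(x_0,\sigma)=\sup\{|f^{(k)}(x_0)|:\ f\in W^n_\infty(\sigma),\ f^{(k+1)}(x_0)=0\}.$$ Let $T_n$ be the Chebyshev polynomial of degree $n$ on $[-1,1]$ and let $\omega_k$ be the rightmost zero of $T_n^{(k+1)}$. For real $\theta$, let $Z_n(\cdot,\theta)$ denote a Zolotarev polynomial with parameter $\theta$, that is, a polynomial $Z(x)=\frac{\theta}{n!}x^n+\sum_{i=0}^{n-1}a_ix^i$ with real coefficients for which there are points $-1\le\tau_1<\dots<\tau_n\le1$ with $(-1)^{n-i}Z(\tau_i)=\|Z\|=1$ for $i=1,\dots,n$. Let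 $\theta_k$ be such that $Z_n^{(k+1)}(1,\theta_k)=0$, where $Z_n^{(j)}(\cdot,\theta_k)$ is the $j$-th derivative with respect to $x$. Then, for every $x_0\in[\omega_k,1]$, $$m_k^*(x_0,\sigma)\ \le\ \max\Bigl\{1,\frac{\sigma}{|\theta_k|}\Bigr\}^{k/n}\,\max\bigl\{|T_n^{(k)}(\omega_k)|,\ |Z_n^{(k)}(1,\theta_k)|\bigr\}.$$ -/

import Mathlib

open Set MeasureTheory Polynomial
open scoped Nat ENNReal

noncomputable section

namespace LandauKolmogorov

/-- The interval `[-1, 1]`. -/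
def I : Set ℝ := Icc (-1) 1

/-- The Sobolev space `W^n_∞[-1,1]` for `n ≥ 1`: functions with `n - 1` continuous derivatives on
`[-1,1]` (one-sided at the end points), such that the derivative of order `n - 1` is absolutely
continuous and its derivative, which exists almost everywhere, belongs to `L_∞[-1,1]`.
Only the values of `f` on `[-1,1]` matter. -/
def sobolev (n : ℕ) : Set (ℝ → ℝ) :=
  {f | ContDiffOn ℝ ((n - 1 : ℕ) : WithTop ℕ∞) f I ∧
    AbsolutelyContinuousOnInterval (iteratedDerivWithin (n - 1) f I) (-1) 1 ∧
    MemLp (iteratedDerivWithin n f I) ∞ (volume.restrict I)}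

/-- The class `W^n_∞(σ)`: all `f ∈ W^n_∞[-1,1]` with `‖f‖ ≤ 1` and `‖f^{(n)}‖_∞ ≤ σ`. -/
def sobolevClass (n : ℕ) (σ : ℝ) : Set (ℝ → ℝ) :=
  {f | f ∈ sobolev n ∧ (∀ x ∈ I, |f x| ≤ 1) ∧
    ∀ᵐ x ∂(volume.restrict I), |iteratedDerivWithin n f I x| ≤ σ}

/-- `m_k^*(x₀, σ)`: the supremum of `|f^{(k)}(x₀)|` over all `f ∈ W^n_∞(σ)` with
`f^{(k+1)}(x₀) = 0`, taken in the extended reals. -/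
def mStar (n k : ℕ) (x₀ σ : ℝ) : EReal :=
  sSup {y : EReal | ∃ f ∈ sobolevClass n σ, iteratedDerivWithin (k + 1) f I x₀ = 0 ∧
    y = ((|iteratedDerivWithin k f I x₀| : ℝ) : EReal)}

/-- The value at `x` of the `j`-th derivative of the polynomial `p`. -/
def derivAt (p : ℝ[X]) (j : ℕ) (x : ℝ) : ℝ := (derivative^[j] p).eval x

/-- `Z = Z_n(·, θ)` is a Zolotarev polynomial of parameter `θ`: its degree is at most `n`, its
coefficient at `x^n` is `θ / n!` (so `θ` is the constant value of its `n`-th derivative), its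
max-norm on `[-1,1]` is one, and there are points `-1 ≤ τ_1 < ⋯ < τ_n ≤ 1` with
`(-1)^(n-i) Z(τ_i) = 1`. The points are indexed from zero here. -/
def IsZolotarev (n : ℕ) (θ : ℝ) (Z : ℝ[X]) : Prop :=
  Z.natDegree ≤ n ∧ Z.coeff n = θ / (n ! : ℝ) ∧ (∀ x ∈ I, |Z.eval x| ≤ 1) ∧
    ∃ τ : Fin n → ℝ, StrictMono τ ∧ (∀ i, τ i ∈ I) ∧
      ∀ i : Fin n, (-1 : ℝ) ^ (n - (i.val + 1)) * Z.eval (τ i) = 1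

end LandauKolmogorov

end

namespace LandauKolmogorov

/-! ### Real-rooted polynomials and their derivatives -/

/-! For a polynomial q put W(F) = q^(k+1) F^(k) - q^(k) F^(k+1). The engine is a comparison
principle, `IsJet.comparison`. Let P have degree at most n, satisfy (-1)^(n-i) P(τ_i) ≥ 1 at n nodes
and have n-th derivative at most -σ; let q be the monic polynomial vanishing at all nodes but the
first. Then W(F) ≤ W(P) on [-1,1] for every F of the class. At a point where F^(k+1) = 0, q^(k+1) >
0 and q^(k) P^(k+1) ≥ 0 this reads F^(k) ≤ P^(k); absolute values come from using -F as well. The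
principle rests on Laguerre's inequality p p'' ≤ p'^2 for real-rooted p and on counting zeros by
Rolle.

If Z^(k+1)(1) = 0, then both end points are nodes of Z, θ < 0, and Z' has one zero β > 1 besides the
interior nodes. A contraction towards x₀ reduces σ > |θ| to σ = |θ| and produces the factor
(σ/|θ|)^(k/n). So take σ = |θ|, let y be the largest zero of q^(k) for the nodes of Z, and put a' =
1 - 9/(4n²). Three ranges of x₀ in [ω,1] occur.

Near ω, when a'(1+x₀) ≤ 1+ω: take for P the negative of T_n dilated about -1 so that ω goes to x₀.
There q^(k) vanishes, and the bound is |T_n^(k)(ω)| (`jet_le_T`). This needs |θ| to be at most the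
n-th derivative of the dilated polynomial (`abs_theta_le`).

For x₀ ≥ y: take P = Z. Since Z^(k) increases on [y,1], the bound is Z^(k)(1) (`jet_le`,
`monotoneOn`).

In between: contract F about -1 so that x₀ moves to y. This loses at most t^k with t = a' n/(n-1),
because 1+y ≤ n/(n-1) (1+ω). That localization (`rootsLE_tail`) compares the nodes of Z with the
extremal points of T_(n-1), and those with the dilated interior extremal points of T_n. The loss is
compensated by the growth of Z^(k) from y to 1: Z^(k)(y) ≤ (1+2V)/(1+V)^2 Z^(k)(1) whenever V ≥ 1
and V(ρ-y) ≤ 1-y, where ρ ≤ 1 bounds the zeros of q^(k-1) (`growth`).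

What remains is t^k (1+2V) ≤ (1+V)^2. If t^k ≤ 4/3 then V = 1 works. Otherwise V comes from
estimates of the largest zeros of consecutive derivatives of T_n: certified rational bounds computed
for n < 100, and bounds from the differential equation for n ≥ 100. -/

theorem iterate_derivative_succ_X_sub_C_mul (b : ℝ) (g : ℝ[X]) (k : ℕ) :
    derivative^[k + 1] ((X - C b) * g) =
      (X - C b) * derivative^[k + 1] g + (k + 1 : ℝ[X]) * derivative^[k] g := by
  induction k with
  | zero => simp; ring
  | succ k ih =>
    rw [Function.iterate_succ_apply', ih, Function.iterate_succ_apply' _ (k + 1),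
      Function.iterate_succ_apply' _ k]
    have : derivative ((k : ℝ[X]) + 1) = 0 := by simp
    simp only [derivative_add, derivative_mul, derivative_sub, derivative_X, derivative_C, this]
    push_cast
    ring

theorem eval_iterate_derivative_succ_X_sub_C_mul (b : ℝ) (g : ℝ[X]) (k : ℕ) (x : ℝ) :
    (derivative^[k + 1] ((X - C b) * g)).eval x =
      (x - b) * (derivative^[k + 1] g).eval x + (k + 1) * (derivative^[k] g).eval x := by
  rw [iterate_derivative_succ_X_sub_C_mul]
  simp

theorem splits_derivative {p : ℝ[X]} (hp : p.Splits) : (derivative p).Splits := by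
  rw [splits_iff_card_roots] at hp ⊢
  rcases Nat.eq_zero_or_pos p.natDegree with h0 | h0
  · have : derivative p = 0 := by
      rw [eq_C_of_natDegree_eq_zero h0]; simp
    simp [this]
  · have h1 := card_roots_le_derivative p
    have h2 := card_roots' (derivative p)
    have h3 := natDegree_derivative_lt (p := p) h0.ne'
    omega

theorem splits_iterate_derivative {p : ℝ[X]} (hp : p.Splits) (k : ℕ) :
    (derivative^[k] p).Splits := by
  induction k with
  | zero => exact hp
  | succ k ih => rw [Function.iterate_succ_apply']; exact splits_derivative ih

/-- Passing from P to (X - a)P turns P'^2 - P P'' into (x-a)^2 (P'^2 - P P'') + P^2, so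
nonnegativity is inherited root by root. -/
theorem laguerre {p : ℝ[X]} (hp : p.Splits) (x : ℝ) :
    p.eval x * (derivative (derivative p)).eval x ≤ (derivative p).eval x ^ 2 := by
  have key : ∀ s : Multiset ℝ, ((s.map fun a => X - C a).prod).eval x *
      (derivative (derivative (s.map fun a => X - C a).prod)).eval x ≤
      (derivative (s.map fun a => X - C a).prod).eval x ^ 2 := by
    intro s
    induction s using Multiset.induction_on with
    | empty => simp
    | cons a s ih =>
      simp only [Multiset.map_cons, Multiset.prod_cons, derivative_mul, derivative_sub,
        derivative_X, derivative_C, derivative_add, eval_add, eval_mul, eval_sub, eval_X, eval_C,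
        sub_zero, one_mul]
      set P := (s.map fun a => X - C a).prod
      nlinarith [mul_le_mul_of_nonneg_left ih (sq_nonneg (x - a)), sq_nonneg (P.eval x)]
  rw [hp.eq_prod_roots]
  simp only [derivative_mul, derivative_C, zero_mul, zero_add, eval_mul, eval_C]
  nlinarith [mul_le_mul_of_nonneg_left (key p.roots) (sq_nonneg p.leadingCoeff)]

theorem natDegree_iterate_derivative_eq (p : ℝ[X]) (k : ℕ) :
    (derivative^[k] p).natDegree = p.natDegree - k := by
  induction k with
  | zero => rfl
  | succ k ih =>
    rw [Function.iterate_succ_apply', natDegree_derivative, ih]; omega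

theorem leadingCoeff_iterate_derivative_pos {p : ℝ[X]} (hp : 0 < p.leadingCoeff) {k : ℕ}
    (hk : k ≤ p.natDegree) : 0 < (derivative^[k] p).leadingCoeff := by
  rw [leadingCoeff, natDegree_iterate_derivative_eq, coeff_iterate_derivative,
    Nat.sub_add_cancel hk, nsmul_eq_mul]
  have := Nat.descFactorial_pos.2 hk
  positivity

theorem eval_pos_of_roots_lt {p : ℝ[X]} (hp : p.Splits) (hl : 0 < p.leadingCoeff) {x : ℝ}
    (h : ∀ r ∈ p.roots, r < x) : 0 < p.eval x := by
  rw [hp.eval_eq_prod_roots]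
  refine mul_pos hl (Multiset.prod_pos ?_)
  intro a ha
  obtain ⟨r, hr, rfl⟩ := Multiset.mem_map.1 ha
  exact sub_pos.2 (h r hr)

theorem eval_derivative_pos_of_roots_lt {p : ℝ[X]} (hp : p.Splits) (hl : 0 < p.leadingCoeff)
    (hd : 0 < p.natDegree) {x : ℝ} (h : ∀ r ∈ p.roots, r < x) : 0 < (derivative p).eval x := by
  have h0 := eval_pos_of_roots_lt hp hl h
  rw [hp.eval_derivative_eq_eval_mul_sum h0.ne']
  refine mul_pos h0 ?_
  have hne : p.roots ≠ 0 := hp.roots_ne_zero hd.ne'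
  obtain ⟨r, hr⟩ := Multiset.exists_mem_of_ne_zero hne
  obtain ⟨t, ht⟩ := Multiset.exists_cons_of_mem hr
  rw [ht, Multiset.map_cons, Multiset.sum_cons]
  refine add_pos_of_pos_of_nonneg (one_div_pos.2 (sub_pos.2 (h r hr))) (Multiset.sum_nonneg ?_)
  intro a ha
  obtain ⟨b, hb, rfl⟩ := Multiset.mem_map.1 ha
  exact (one_div_pos.2 (sub_pos.2 (h b (by rw [ht]; exact Multiset.mem_cons_of_mem hb)))).le

theorem exists_max_root {p : ℝ[X]} (hp : p.Splits) (hl : 0 < p.leadingCoeff)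
    (hd : 0 < p.natDegree) : ∃ y, p.eval y = 0 ∧ ∀ z, y < z → 0 < p.eval z := by
  have h0 : p ≠ 0 := by rintro rfl; simp at hl
  have hne : p.roots.toFinset.Nonempty := by
    rw [Multiset.toFinset_nonempty]; exact hp.roots_ne_zero hd.ne'
  refine ⟨p.roots.toFinset.max' hne, ?_, fun z hz => eval_pos_of_roots_lt hp hl fun r hr => ?_⟩
  · have := p.roots.toFinset.max'_mem hne
    rw [Multiset.mem_toFinset, mem_roots h0] at this
    exact this
  · exact (Finset.le_max' _ _ (Multiset.mem_toFinset.2 hr)).trans_lt hz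

/-- At the largest critical point, a real-rooted polynomial takes a nonpositive value. -/
theorem eval_nonpos_of_max_critical {p : ℝ[X]} (hp : p.Splits) (hl : 0 < p.leadingCoeff) {y : ℝ}
    (hy : (derivative p).eval y = 0) (hy' : ∀ z, y < z → 0 < (derivative p).eval z) :
    p.eval y ≤ 0 := by
  by_contra! h
  have hd : 0 < p.natDegree := by
    by_contra! h0
    have := hy' (y + 1) (by linarith)
    rw [eq_C_of_natDegree_le_zero h0] at this
    simp at this
  have hmono : StrictMonoOn (fun z => p.eval z) (Ici y) := by
    refine strictMonoOn_of_deriv_pos (convex_Ici y) p.continuous.continuousOn ?_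
    intro z hz
    rw [interior_Ici] at hz
    rw [Polynomial.deriv]
    exact hy' z hz
  have hp0 : p ≠ 0 := by rintro rfl; simp at hl
  refine hy.not_gt (eval_derivative_pos_of_roots_lt hp hl hd fun r hr => ?_)
  by_contra! hyr
  have h1 := hmono.monotoneOn (self_mem_Ici) (mem_Ici.2 hyr) hyr
  have h2 : p.eval r = 0 := (mem_roots hp0).1 hr
  simp only [h2] at h1
  linarith

/-- All roots of the `k`-th derivative of `p` (of positive leading coefficient) are at most `x`. -/
def RootsLE (k : ℕ) (p : ℝ[X]) (x : ℝ) : Prop := ∀ z, x < z → 0 < (derivative^[k] p).eval z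

/-- At the largest zero y of g^(k), the k-th derivative of (X - b)g equals k g^(k-1)(y). This is at
most 0, because y is the largest critical point of g^(k-1). So y cannot exceed x. -/
theorem RootsLE.of_mul {k : ℕ} {g : ℝ[X]} (hg : g.Splits) (hl : 0 < g.leadingCoeff)
    (hk : k ≤ g.natDegree) {b x : ℝ} (h : RootsLE k ((X - C b) * g) x) : RootsLE k g x := by
  intro z hz
  have hs := splits_iterate_derivative hg k
  have hlc := leadingCoeff_iterate_derivative_pos hl hk
  rcases hk.eq_or_lt with rfl | hlt
  · have h0 : (derivative^[g.natDegree] g).natDegree = 0 := by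
      rw [natDegree_iterate_derivative_eq]; omega
    rw [eq_C_of_natDegree_eq_zero h0, eval_C]
    rwa [leadingCoeff, h0] at hlc
  · obtain ⟨y, hy, hy'⟩ := exists_max_root hs hlc
      (by rw [natDegree_iterate_derivative_eq]; omega)
    refine hy' z (lt_of_le_of_lt ?_ hz)
    by_contra! hxy
    have h1 := h y hxy
    rcases k with _ | k
    · simp only [Function.iterate_zero, id_eq, eval_mul] at h1 hy
      rw [hy, mul_zero] at h1
      exact h1.false
    · rw [eval_iterate_derivative_succ_X_sub_C_mul, hy, mul_zero, zero_add] at h1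
      rw [Function.iterate_succ_apply'] at hy
      have h2 := eval_nonpos_of_max_critical (splits_iterate_derivative hg k)
        (leadingCoeff_iterate_derivative_pos hl (by omega)) hy
        (fun z hz => by rw [← Function.iterate_succ_apply' derivative]; exact hy' z hz)
      nlinarith

/-- Moving a root to the left moves the largest root of each derivative to the left. -/
theorem RootsLE.move {k : ℕ} {g : ℝ[X]} (hg : g.Splits) (hl : 0 < g.leadingCoeff)
    (hk : k ≤ g.natDegree) {a b x : ℝ} (hab : a ≤ b) (h : RootsLE k ((X - C b) * g) x) :
    RootsLE k ((X - C a) * g) x := by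
  intro z hz
  have h1 := h z hz
  have h2 := h.of_mul hg hl hk z hz
  have : (X - C a) * g = (X - C b) * g + C (b - a) * g := by
    rw [C_sub]; ring
  rw [this, iterate_map_add, iterate_derivative_C_mul, eval_add, eval_mul, eval_C]
  nlinarith [mul_nonneg (sub_nonneg.2 hab) h2.le]

/-- Moving two roots towards each other, keeping their sum, moves the largest root of each
derivative to the left. -/
theorem RootsLE.pinch {k : ℕ} {g : ℝ[X]} (hg : g.Splits) (hl : 0 < g.leadingCoeff)
    (hk : k ≤ g.natDegree + 1) {u v e x : ℝ} (he : 0 ≤ e) (hev : v + e ≤ u)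
    (h : RootsLE k ((X - C u) * ((X - C v) * g)) x) :
    RootsLE k ((X - C (u - e)) * ((X - C (v + e)) * g)) x := by
  intro z hz
  have h1 := h z hz
  have h2 : 0 ≤ (derivative^[k] g).eval z := by
    rcases hk.eq_or_lt with rfl | hk
    · rw [iterate_derivative_eq_zero (Nat.lt_succ_self _)]; simp
    have hg' : ((X - C v) * g).Splits := (Splits.X_sub_C v).mul hg
    have hl' : 0 < ((X - C v) * g).leadingCoeff := by simpa using hl
    have hg0 : g ≠ 0 := by rintro rfl; simp at hl
    have hk' : k ≤ ((X - C v) * g).natDegree := by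
      rw [natDegree_mul (X_sub_C_ne_zero v) hg0]; omega
    exact ((h.of_mul hg' hl' hk').of_mul hg hl (by omega) z hz).le
  -- With the sum of the two roots fixed, only their product changes, so the difference is a
  -- nonnegative multiple of g, whose k-th derivative is nonnegative beyond x.
  have : (X - C (u - e)) * ((X - C (v + e)) * g) =
      (X - C u) * ((X - C v) * g) + C (e * (u - v - e)) * g := by
    simp only [C_sub, C_add, C_mul]; ring
  rw [this, iterate_map_add, iterate_derivative_C_mul, eval_add, eval_mul, eval_C]
  nlinarith [mul_nonneg (mul_nonneg he (by linarith : 0 ≤ u - v - e)) h2]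

theorem splits_prod_X_sub_C {ι : Type*} (s : Finset ι) (α : ι → ℝ) :
    (∏ i ∈ s, (X - C (α i))).Splits := by
  classical
  induction s using Finset.induction_on with
  | empty => simp
  | insert a s ha ih => rw [Finset.prod_insert ha]; exact (Splits.X_sub_C _).mul ih

theorem monic_prod_X_sub_C' {ι : Type*} (s : Finset ι) (α : ι → ℝ) :
    (∏ i ∈ s, (X - C (α i))).Monic := monic_prod_of_monic _ _ fun _ _ => monic_X_sub_C _

theorem natDegree_prod_X_sub_C {ι : Type*} (s : Finset ι) (α : ι → ℝ) :
    (∏ i ∈ s, (X - C (α i))).natDegree = s.card := by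
  rw [natDegree_prod_of_monic _ _ fun i _ => monic_X_sub_C _]
  simp

theorem RootsLE.mono_of_le {ι : Type*} {k : ℕ} {α β : ι → ℝ} {x : ℝ} (s : Finset ι)
    (hk : k < s.card) (hβ : ∀ i ∈ s, β i ≤ α i)
    (h : RootsLE k (∏ i ∈ s, (X - C (α i))) x) : RootsLE k (∏ i ∈ s, (X - C (β i))) x := by
  classical
  have key : ∀ t : Finset ι, (∀ i ∈ t, β i ≤ α i) → ∀ g : ℝ[X], g.Splits → g.Monic →
      k < t.card + g.natDegree → RootsLE k ((∏ i ∈ t, (X - C (α i))) * g) x →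
      RootsLE k ((∏ i ∈ t, (X - C (β i))) * g) x := by
    intro t
    induction t using Finset.induction_on with
    | empty => intro _ g _ _ _ h; simpa using h
    | insert a t ha ih =>
      intro hβ g hg hm hd h
      rw [Finset.prod_insert ha, mul_assoc] at h ⊢
      rw [Finset.card_insert_of_notMem ha] at hd
      have h1 := h.move ((splits_prod_X_sub_C t α).mul hg)
        (by rw [((monic_prod_X_sub_C' t α).mul hm).leadingCoeff]; exact one_pos)
        (by rw [(monic_prod_X_sub_C' t α).natDegree_mul hm, natDegree_prod_X_sub_C]; omega)
        (hβ a (Finset.mem_insert_self a t))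
      rw [mul_left_comm] at h1 ⊢
      refine ih (fun i hi => hβ i (Finset.mem_insert_of_mem hi)) _
        ((Splits.X_sub_C _).mul hg) ((monic_X_sub_C _).mul hm) ?_ h1
      rw [(monic_X_sub_C _).natDegree_mul hm, natDegree_X_sub_C]; omega
  have := key s hβ 1 Splits.one monic_one (by simpa using hk) (by simpa using h)
  simpa using this

/-- If the roots `β` are majorized by the roots `α` with a single crossing, then the largest root
of each derivative for `β` is at most that for `α`. -/
theorem RootsLE.of_crossing {ι : Type*} {k : ℕ} {β : ι → ℝ} {x : ℝ} (s : Finset ι)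
    (hk : k + 1 ≤ s.card) (α : ι → ℝ) (hsum : ∑ i ∈ s, α i = ∑ i ∈ s, β i)
    (hcross : ∀ i ∈ s, ∀ j ∈ s, β i < α i → α j < β j → β j ≤ β i)
    (h : RootsLE k (∏ i ∈ s, (X - C (α i))) x) : RootsLE k (∏ i ∈ s, (X - C (β i))) x := by
  classical
  induction hN : (s.filter fun i => α i ≠ β i).card using Nat.strong_induction_on
    generalizing α with
  | _ N ih =>
  by_cases hall : ∀ i ∈ s, α i = β i
  · rw [Finset.prod_congr rfl fun i hi => by rw [← hall i hi]]
    exact h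
  push Not at hall
  obtain ⟨l, hl, hne⟩ := hall
  obtain ⟨i, hi, hβi⟩ : ∃ i ∈ s, β i < α i := by
    by_contra! hcon
    exact (Finset.sum_lt_sum hcon ⟨l, hl, lt_of_le_of_ne (hcon l hl) hne⟩).ne hsum
  obtain ⟨j, hj, hβj⟩ : ∃ j ∈ s, α j < β j := by
    by_contra! hcon
    exact (Finset.sum_lt_sum hcon ⟨l, hl, lt_of_le_of_ne (hcon l hl) hne.symm⟩).ne' hsum
  have hij : j ≠ i := by rintro rfl; linarith
  have hji := hcross i hi j hj hβi hβj
  -- The largest transfer from α i to α j that overshoots neither target. It makes at least one of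
  -- the two coordinates equal to its target, so the number of mismatches drops.
  set e := min (α i - β i) (β j - α j) with he
  have he0 : 0 < e := lt_min (by linarith) (by linarith)
  have he1 : e ≤ α i - β i := min_le_left _ _
  have he2 : e ≤ β j - α j := min_le_right _ _
  set γ : ι → ℝ := fun l => if l = i then α i - e else if l = j then α j + e else α l with hγ
  have hγi : γ i = α i - e := by simp [hγ]
  have hγj : γ j = α j + e := by simp [hγ, hij]
  have hγl : ∀ l, l ≠ i → l ≠ j → γ l = α l := fun l h1 h2 => by simp [hγ, h1, h2]
  have hjs : j ∈ s.erase i := Finset.mem_erase.2 ⟨hij, hj⟩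
  have hrest : ∀ l ∈ (s.erase i).erase j, γ l = α l := fun l hl => by
    rw [Finset.mem_erase, Finset.mem_erase] at hl
    exact hγl l hl.2.1 hl.1
  have hcard : ((s.erase i).erase j).card = s.card - 2 := by
    rw [Finset.card_erase_of_mem hjs, Finset.card_erase_of_mem hi]; omega
  refine ih _ ?_ γ ?_ ?_ ?_ rfl
  · rw [← hN]
    refine Finset.card_lt_card ⟨fun l hl => ?_, fun hsub => ?_⟩
    · rw [Finset.mem_filter] at hl ⊢
      refine ⟨hl.1, ?_⟩
      by_cases h1 : l = i
      · rw [h1]; exact hβi.ne'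
      by_cases h2 : l = j
      · rw [h2]; exact hβj.ne
      · rw [← hγl l h1 h2]; exact hl.2
    · rcases min_choice (α i - β i) (β j - α j) with hc | hc
      · have := (Finset.mem_filter.1 (hsub (Finset.mem_filter.2 ⟨hi, hβi.ne'⟩))).2
        rw [hγi, he, hc] at this
        exact this (by ring)
      · have := (Finset.mem_filter.1 (hsub (Finset.mem_filter.2 ⟨hj, hβj.ne⟩))).2
        rw [hγj, he, hc] at this
        exact this (by ring)
  · rw [← hsum, ← Finset.add_sum_erase s γ hi, ← Finset.add_sum_erase s α hi,
      ← Finset.add_sum_erase _ γ hjs, ← Finset.add_sum_erase _ α hjs,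
      Finset.sum_congr rfl hrest, hγi, hγj]
    ring
  · have hup : ∀ l, β l < γ l → β l < α l := by
      intro l hl
      by_cases h1 : l = i
      · rw [h1]; exact hβi
      by_cases h2 : l = j
      · rw [h2, hγj] at hl; linarith
      · rwa [hγl l h1 h2] at hl
    have hdown : ∀ l, γ l < β l → α l < β l := by
      intro l hl
      by_cases h1 : l = i
      · rw [h1, hγi] at hl; linarith
      by_cases h2 : l = j
      · rw [h2]; exact hβj
      · rwa [hγl l h1 h2] at hl
    exact fun a ha b hb h1 h2 => hcross a ha b hb (hup a h1) (hdown b h2)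
  · rw [← Finset.mul_prod_erase s _ hi, ← Finset.mul_prod_erase _ _ hjs] at h ⊢
    rw [Finset.prod_congr rfl fun l hl => by rw [hrest l hl], hγi, hγj]
    refine h.pinch (splits_prod_X_sub_C _ _)
      (by rw [(monic_prod_X_sub_C' _ _).leadingCoeff]; exact one_pos) ?_ he0.le (by linarith)
    rw [natDegree_prod_X_sub_C, hcard]; omega

end LandauKolmogorov

namespace LandauKolmogorov

/-! ### Jets and Rolle's theorem -/

/-- `F 0, …, F N` are the successive derivatives of `F 0` on `[-1, 1]`. -/
def IsJet (N : ℕ) (F : ℕ → ℝ → ℝ) : Prop :=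
  ∀ j < N, ∀ x ∈ I, HasDerivWithinAt (F j) (F (j + 1) x) I x

/-- The jet of a polynomial. -/
noncomputable def polyJet (p : ℝ[X]) : ℕ → ℝ → ℝ := fun j x => (derivative^[j] p).eval x

theorem isJet_polyJet (N : ℕ) (p : ℝ[X]) : IsJet N (polyJet p) := by
  intro j _ x _
  have := ((derivative^[j] p).hasDerivAt x).hasDerivWithinAt (s := I)
  rwa [← Function.iterate_succ_apply' derivative] at this

theorem IsJet.sub {N : ℕ} {F G : ℕ → ℝ → ℝ} (hF : IsJet N F) (hG : IsJet N G) :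
    IsJet N (fun j x => F j x - G j x) :=
  fun j hj x hx => (hF j hj x hx).sub (hG j hj x hx)

theorem IsJet.continuousOn {N : ℕ} {F : ℕ → ℝ → ℝ} (hF : IsJet N F) {j : ℕ} (hj : j < N) :
    ContinuousOn (F j) I := fun x hx => (hF j hj x hx).continuousWithinAt

theorem IsJet.hasDerivAt {N : ℕ} {F : ℕ → ℝ → ℝ} (hF : IsJet N F) {j : ℕ} (hj : j < N) {x : ℝ}
    (hx : x ∈ Ioo (-1 : ℝ) 1) : HasDerivAt (F j) (F (j + 1) x) x :=
  (hF j hj x (Ioo_subset_Icc_self hx)).hasDerivAt (Icc_mem_nhds hx.1 hx.2)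

/-- The counting form of Rolle's theorem, with a free predicate `Q` so that the chosen zeros can
also be required to avoid a given point. -/
theorem exists_finset_between (Q : ℝ → Prop) (S : Finset ℝ) (hS : S.Nonempty)
    (h : ∀ a ∈ S, ∀ b ∈ S, a < b → ∃ c ∈ Ioo a b, Q c) :
    ∃ S' : Finset ℝ, S'.card + 1 = S.card ∧
      ∀ c ∈ S', Q c ∧ c ∉ S ∧ ∃ a ∈ S, ∃ b ∈ S, c ∈ Ioo a b := by
  induction S using Finset.induction_on_max with
  | empty => simp at hS
  | insert M S hM ih =>
    have hMS : M ∉ S := fun hc => (hM M hc).false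
    rcases S.eq_empty_or_nonempty with rfl | hne
    · exact ⟨∅, by simp, by simp⟩
    obtain ⟨S', hc, hS'⟩ := ih hne fun a ha b hb => h a (Finset.mem_insert_of_mem ha) b
      (Finset.mem_insert_of_mem hb)
    have hmax := S.max'_mem hne
    obtain ⟨c, hc', hQ⟩ := h _ (Finset.mem_insert_of_mem hmax) M (Finset.mem_insert_self _ _)
      (hM _ hmax)
    have hcS' : c ∉ S' := fun hcc => by
      obtain ⟨-, -, a, -, b, hb, hcb⟩ := hS' c hcc
      exact (hcb.2.trans_le ((S.le_max' b hb).trans hc'.1.le)).false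
    refine ⟨insert c S', ?_, ?_⟩
    · rw [Finset.card_insert_of_notMem hcS', Finset.card_insert_of_notMem hMS, hc]
    · intro d hd
      rcases Finset.mem_insert.1 hd with rfl | hd
      · refine ⟨hQ, fun hcc => ?_, _, Finset.mem_insert_of_mem hmax, M,
          Finset.mem_insert_self _ _, hc'⟩
        rcases Finset.mem_insert.1 hcc with rfl | hcc
        · exact hc'.2.false
        · exact ((S.le_max' _ hcc).trans_lt hc'.1).false
      · obtain ⟨h1, h2, a, ha, b, hb, hab⟩ := hS' d hd
        refine ⟨h1, fun hcc => ?_, a, Finset.mem_insert_of_mem ha, b,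
          Finset.mem_insert_of_mem hb, hab⟩
        rcases Finset.mem_insert.1 hcc with rfl | hcc
        · exact (hab.2.trans (hM b hb)).false
        · exact h2 hcc

/-- Besides the zero of the derivative, the extremum itself is recorded: it later excludes a
prescribed point as the Rolle point. -/
theorem IsJet.exists_extr {N : ℕ} {F : ℕ → ℝ → ℝ} (hF : IsJet N F) {j : ℕ} (hj : j < N) {a b : ℝ}
    (ha : a ∈ I) (hb : b ∈ I) (hab : a < b) (h0 : F j a = 0) (h1 : F j b = 0) :
    ∃ c ∈ Ioo a b, F (j + 1) c = 0 ∧ IsLocalExtr (F j) c := by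
  have hsub : Icc a b ⊆ I := Icc_subset_Icc ha.1 hb.2
  obtain ⟨c, hc, he⟩ := exists_Ioo_extr_on_Icc hab ((hF.continuousOn hj).mono hsub)
    (h0.trans h1.symm)
  have hl := he.isLocalExtr (Icc_mem_nhds hc.1 hc.2)
  exact ⟨c, hc, hl.hasDerivAt_eq_zero
    (hF.hasDerivAt hj ⟨ha.1.trans_lt hc.1, hc.2.trans_le hb.2⟩), hl⟩

theorem mem_I_of_mem_Ioo {S : Finset ℝ} (hS : ↑S ⊆ I) {c : ℝ}
    (h : ∃ a ∈ S, ∃ b ∈ S, c ∈ Ioo a b) : c ∈ I := by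
  obtain ⟨a, ha, b, hb, hc⟩ := h
  exact ⟨(hS ha).1.trans hc.1.le, hc.2.le.trans (hS hb).2⟩

theorem IsJet.rolle {N : ℕ} {F : ℕ → ℝ → ℝ} (hF : IsJet N F) {j : ℕ} (hj : j < N) {S : Finset ℝ}
    (hS : ↑S ⊆ I) (h0 : ∀ x ∈ S, F j x = 0) (hne : S.Nonempty) :
    ∃ S' : Finset ℝ, ↑S' ⊆ I ∧ S'.card + 1 = S.card ∧ (∀ x ∈ S', F (j + 1) x = 0) ∧
      ∀ x ∈ S', x ∉ S := by
  obtain ⟨S', hc, h⟩ := exists_finset_between (fun c => F (j + 1) c = 0) S hne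
    fun a ha b hb hab => by
      obtain ⟨c, hc, h, -⟩ := hF.exists_extr hj (hS ha) (hS hb) hab (h0 a ha) (h0 b hb)
      exact ⟨c, hc, h⟩
  exact ⟨S', fun c hc => mem_I_of_mem_Ioo hS (h c hc).2.2, hc, fun c hc => (h c hc).1,
    fun c hc => (h c hc).2.1⟩

theorem IsJet.rolle_iterate {N : ℕ} {F : ℕ → ℝ → ℝ} (hF : IsJet N F) {j i : ℕ} (hj : j + i ≤ N)
    {S : Finset ℝ} (hS : ↑S ⊆ I) (h0 : ∀ x ∈ S, F j x = 0) (hc : i ≤ S.card) :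
    ∃ S' : Finset ℝ, ↑S' ⊆ I ∧ S'.card + i = S.card ∧ ∀ x ∈ S', F (j + i) x = 0 := by
  induction i with
  | zero => exact ⟨S, hS, rfl, h0⟩
  | succ i ih =>
    obtain ⟨S', hS', hc', h'⟩ := ih (by omega) (by omega)
    obtain ⟨S'', h1, h2, h3, -⟩ := hF.rolle (j := j + i) (by omega) hS' h'
      (Finset.card_pos.1 (by omega))
    exact ⟨S'', h1, by omega, h3⟩

/-- A strictly monotone F^(N) has at most one zero, so by Rolle F^(j) has at most N - j + 1. -/
theorem IsJet.false_of_zeros {N : ℕ} {F : ℕ → ℝ → ℝ} (hF : IsJet N F)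
    (hanti : StrictAntiOn (F N) I) {j : ℕ} (hj : j ≤ N) {S : Finset ℝ} (hS : ↑S ⊆ I)
    (h0 : ∀ x ∈ S, F j x = 0) (hc : N + 2 ≤ S.card + j) : False := by
  obtain ⟨S', h1, h2, h3⟩ := hF.rolle_iterate (j := j) (i := N - j) (by omega) hS h0 (by omega)
  obtain ⟨a, ha, b, hb, hab⟩ := Finset.one_lt_card.1 (by omega : 1 < S'.card)
  rw [Nat.add_sub_cancel' hj] at h3
  exact hab (hanti.injOn (h1 ha) (h1 hb) ((h3 a ha).trans (h3 b hb).symm))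

/-- A function whose first two derivatives vanish at `c`, the second one with a change of sign,
has no local extremum at `c`. -/
theorem not_isLocalExtr_of_sign_change {f f' f'' : ℝ → ℝ} {c : ℝ} {U : Set ℝ} (hU : U ∈ nhds c)
    (hf : ∀ x ∈ U, HasDerivAt f (f' x) x) (hf' : ∀ x ∈ U, HasDerivAt f' (f'' x) x)
    (h1 : f' c = 0) (hl : ∀ x ∈ U, x < c → 0 < f'' x) (hr : ∀ x ∈ U, c < x → f'' x < 0) :
    ¬ IsLocalExtr f c := by
  obtain ⟨ε, hε, hball⟩ := Metric.mem_nhds_iff.1 hU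
  rw [Real.ball_eq_Ioo] at hball
  have hneg : ∀ x ∈ Ioo (c - ε) (c + ε), x ≠ c → f' x < 0 := by
    intro x hx hxc
    rcases lt_or_gt_of_ne hxc with h | h
    · have hm : StrictMonoOn f' (Icc x c) := by
        refine strictMonoOn_of_deriv_pos (convex_Icc x c) (fun y hy => ?_) fun y hy => ?_
        · exact (hf' y (hball ⟨hx.1.trans_le hy.1, by linarith [hy.2]⟩)).continuousAt.continuousWithinAt
        · rw [interior_Icc] at hy
          have hyU := hball ⟨hx.1.trans hy.1, by linarith [hy.2]⟩
          rw [(hf' y hyU).deriv]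
          exact hl y hyU hy.2
      rw [← h1]
      exact hm (left_mem_Icc.2 h.le) (right_mem_Icc.2 h.le) h
    · have hm : StrictAntiOn f' (Icc c x) := by
        refine strictAntiOn_of_deriv_neg (convex_Icc c x) (fun y hy => ?_) fun y hy => ?_
        · exact (hf' y (hball ⟨by linarith [hy.1], hy.2.trans_lt hx.2⟩)).continuousAt.continuousWithinAt
        · rw [interior_Icc] at hy
          have hyU := hball ⟨by linarith [hy.1], hy.2.trans hx.2⟩
          rw [(hf' y hyU).deriv]
          exact hr y hyU hy.1
      rw [← h1]
      exact hm (left_mem_Icc.2 h.le) (right_mem_Icc.2 h.le) h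
  have hcont : ∀ y ∈ Ioo (c - ε) (c + ε), ContinuousAt f y := fun y hy => (hf y (hball hy)).continuousAt
  have hL : ∀ x ∈ Ioo (c - ε) c, f c < f x := by
    intro x hx
    have hm : StrictAntiOn f (Icc x c) := by
      refine strictAntiOn_of_deriv_neg (convex_Icc x c) (fun y hy => ?_) fun y hy => ?_
      · exact (hcont y ⟨hx.1.trans_le hy.1, by linarith [hy.2]⟩).continuousWithinAt
      · rw [interior_Icc] at hy
        have hy' : y ∈ Ioo (c - ε) (c + ε) := ⟨hx.1.trans hy.1, by linarith [hy.2]⟩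
        rw [(hf y (hball hy')).deriv]
        exact hneg y hy' hy.2.ne
    exact hm (left_mem_Icc.2 hx.2.le) (right_mem_Icc.2 hx.2.le) hx.2
  have hR : ∀ x ∈ Ioo c (c + ε), f x < f c := by
    intro x hx
    have hm : StrictAntiOn f (Icc c x) := by
      refine strictAntiOn_of_deriv_neg (convex_Icc c x) (fun y hy => ?_) fun y hy => ?_
      · exact (hcont y ⟨by linarith [hy.1], hy.2.trans_lt hx.2⟩).continuousWithinAt
      · rw [interior_Icc] at hy
        have hy' : y ∈ Ioo (c - ε) (c + ε) := ⟨by linarith [hy.1], hy.2.trans hx.2⟩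
        rw [(hf y (hball hy')).deriv]
        exact hneg y hy' hy.1.ne'
    exact hm (left_mem_Icc.2 hx.1.le) (right_mem_Icc.2 hx.1.le) hx.1
  rintro (hmin | hmax)
  · obtain ⟨δ, hδ, hb⟩ := Metric.mem_nhds_iff.1 hmin
    rw [Real.ball_eq_Ioo] at hb
    have h2 := hb (show c + min δ ε / 2 ∈ Ioo (c - δ) (c + δ) from
      ⟨by linarith [lt_min hδ hε], by linarith [lt_min hδ hε, min_le_left δ ε]⟩)
    have h3 := hR (c + min δ ε / 2)
      ⟨by linarith [lt_min hδ hε], by linarith [lt_min hδ hε, min_le_right δ ε]⟩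
    exact h3.not_ge h2
  · obtain ⟨δ, hδ, hb⟩ := Metric.mem_nhds_iff.1 hmax
    rw [Real.ball_eq_Ioo] at hb
    have h2 := hb (show c - min δ ε / 2 ∈ Ioo (c - δ) (c + δ) from
      ⟨by linarith [lt_min hδ hε, min_le_left δ ε], by linarith [lt_min hδ hε]⟩)
    have h3 := hL (c - min δ ε / 2)
      ⟨by linarith [lt_min hδ hε, min_le_right δ ε], by linarith [lt_min hδ hε]⟩
    exact h3.not_ge h2

theorem sign_near_of_hasDerivAt {g : ℝ → ℝ} {g' c : ℝ} (hg : HasDerivAt g g' c) (h0 : g c = 0)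
    (hneg : g' < 0) :
    ∃ U ∈ nhds c, (∀ x ∈ U, x < c → 0 < g x) ∧ ∀ x ∈ U, c < x → g x < 0 := by
  have h1 := hasDerivAt_iff_tendsto_slope.1 hg
  have h2 : ∀ᶠ x in nhdsWithin c {c}ᶜ, slope g c x < 0 := h1.eventually (gt_mem_nhds hneg)
  rw [eventually_nhdsWithin_iff] at h2
  refine ⟨_, h2, fun x hx hxc => ?_, fun x hx hxc => ?_⟩
  · have := hx hxc.ne
    rw [slope_def_field, h0, sub_zero, div_neg_iff] at this
    rcases this with h | h <;> linarith [h.1, h.2]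
  · have := hx hxc.ne'
    rw [slope_def_field, h0, sub_zero, div_neg_iff] at this
    rcases this with h | h <;> linarith [h.1, h.2]

theorem IsJet.neg {N : ℕ} {F : ℕ → ℝ → ℝ} (hF : IsJet N F) : IsJet N (fun j x => -F j x) :=
  fun j hj x hx => (hF j hj x hx).neg

/-- A function with `N` zeros on `[-1, 1]` and with strictly decreasing `N`-th derivative has
no double zeros in its derivatives of order `1 ≤ k < N`. -/
theorem IsJet.no_double_zero {N k : ℕ} {F : ℕ → ℝ → ℝ} (hF : IsJet N F)
    (hanti : StrictAntiOn (F N) I) (hk : 1 ≤ k) (hkN : k + 1 ≤ N) {S : Finset ℝ} (hS : ↑S ⊆ I)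
    (h0 : ∀ x ∈ S, F 0 x = 0) (hc : N ≤ S.card) {c : ℝ} (hcI : c ∈ I) (h1 : F k c = 0)
    (h2 : F (k + 1) c = 0) : False := by
  classical
  -- At a triple zero, adjoining c before and after each use of Rolle keeps the count of zeros from
  -- dropping. Two such steps carry the N - k zeros of F^(k) to F^(k+2), one too many.
  by_cases htriple : k + 2 ≤ N ∧ F (k + 2) c = 0
  · obtain ⟨hkN2, h3⟩ := htriple
    obtain ⟨A, hA, hAc, hA0⟩ := hF.rolle_iterate (j := 0) (i := k) (by omega) hS h0 (by omega)
    simp only [zero_add] at hA0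
    have step : ∀ j, j < N → F j c = 0 → F (j + 1) c = 0 → ∀ A : Finset ℝ, ↑A ⊆ I →
        (∀ x ∈ A, F j x = 0) → ∃ B : Finset ℝ, ↑B ⊆ I ∧ A.card ≤ B.card ∧
          (∀ x ∈ B, F (j + 1) x = 0) := by
      intro j hj hcj hcj1 A hA hA0
      obtain ⟨B, hB, hBc, hB0, hBd⟩ := hF.rolle hj (S := insert c A)
        (by intro x hx
            rcases Finset.mem_insert.1 (Finset.mem_coe.1 hx) with rfl | hx
            · exact hcI
            · exact hA hx)
        (by intro x hx
            rcases Finset.mem_insert.1 hx with rfl | hx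
            · exact hcj
            · exact hA0 x hx) (Finset.insert_nonempty _ _)
      have hcB : c ∉ B := fun h => hBd c h (Finset.mem_insert_self _ _)
      refine ⟨insert c B, ?_, ?_, ?_⟩
      · intro x hx
        rcases Finset.mem_insert.1 (Finset.mem_coe.1 hx) with rfl | hx
        · exact hcI
        · exact hB hx
      · rw [Finset.card_insert_of_notMem hcB, hBc]
        exact Finset.card_le_card (Finset.subset_insert _ _)
      · intro x hx
        rcases Finset.mem_insert.1 hx with rfl | hx
        · exact hcj1
        · exact hB0 x hx
    obtain ⟨B, hB, hBc, hB0⟩ := step k (by omega) h1 h2 A hA hA0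
    obtain ⟨D, hD, hDc, hD0⟩ := step (k + 1) (by omega) h2 h3 B hB hB0
    exact hF.false_of_zeros hanti (j := k + 2) hkN2 hD hD0 (by omega)
  -- Now F^(k+1) changes sign at an interior c while F^(k) vanishes there, so F^(k-1) is strictly
  -- monotone near c. The Rolle zeros of F^(k) between zeros of F^(k-1) can therefore be chosen
  -- different from c.
  have hnext : c ∈ Ioo (-1 : ℝ) 1 → ¬ IsLocalExtr (F (k - 1)) c := by
    intro hc'
    have hk1 : k - 1 + 1 = k := by omega
    have hnhds := Ioo_mem_nhds hc'.1 hc'.2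
    by_cases hkN2 : k + 2 ≤ N
    · have hne : F (k + 2) c ≠ 0 := fun h => htriple ⟨hkN2, h⟩
      have aux : ∀ G : ℕ → ℝ → ℝ, IsJet N G → G k c = 0 → G (k + 1) c = 0 → G (k + 2) c < 0 →
          ¬ IsLocalExtr (G (k - 1)) c := by
        intro G hG g1 g2 g3
        obtain ⟨U, hU, hl, hr⟩ := sign_near_of_hasDerivAt (hG.hasDerivAt (j := k + 1)
          (by omega) hc') g2 g3
        refine not_isLocalExtr_of_sign_change (f' := G k) (f'' := G (k + 1))
          (Filter.inter_mem hU hnhds) (fun x hx => ?_)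
          (fun x hx => hG.hasDerivAt (by omega) hx.2) g1 (fun x hx => hl x hx.1)
          (fun x hx => hr x hx.1)
        have := hG.hasDerivAt (j := k - 1) (by omega) hx.2
        rwa [hk1] at this
      rcases lt_or_gt_of_ne hne with hlt | hgt
      · exact aux F hF h1 h2 hlt
      · intro he
        exact aux _ hF.neg (by simp [h1]) (by simp [h2]) (by simpa using hgt) he.neg
    · obtain rfl : N = k + 1 := by omega
      refine not_isLocalExtr_of_sign_change (f' := F k) (f'' := F (k + 1)) hnhds (fun x hx => ?_)
        (fun x hx => hF.hasDerivAt (by omega) hx) h1 (fun x hx hxc => ?_) (fun x hx hxc => ?_)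
      · have := hF.hasDerivAt (j := k - 1) (by omega) hx
        rwa [hk1] at this
      · rw [← h2]; exact hanti (Ioo_subset_Icc_self hx) hcI hxc
      · rw [← h2]; exact hanti hcI (Ioo_subset_Icc_self hx) hxc
  obtain ⟨A, hA, hAc, hA0⟩ := hF.rolle_iterate (j := 0) (i := k - 1) (by omega) hS h0 (by omega)
  simp only [zero_add] at hA0
  -- N - k zeros of F^(k) other than c; with c they give N - k zeros of F^(k+1) other than c, hence
  -- N - k + 1 in all, one too many.
  obtain ⟨B, hBc, hB⟩ := exists_finset_between (fun x => F k x = 0 ∧ x ≠ c) A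
    (Finset.card_pos.1 (by omega)) fun a ha b hb hab => by
      obtain ⟨d, hd, hd0, hde⟩ := hF.exists_extr (j := k - 1) (by omega) (hA ha) (hA hb) hab
        (hA0 a ha) (hA0 b hb)
      rw [Nat.sub_add_cancel hk] at hd0
      refine ⟨d, hd, hd0, ?_⟩
      rintro rfl
      exact hnext ⟨(hA ha).1.trans_lt hd.1, hd.2.trans_le (hA hb).2⟩ hde
  have hcB : c ∉ B := fun h => (hB c h).1.2 rfl
  obtain ⟨D, hD, hDc, hD0, hDd⟩ := hF.rolle (j := k) (by omega) (S := insert c B)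
    (by intro x hx
        rcases Finset.mem_insert.1 (Finset.mem_coe.1 hx) with rfl | hx
        · exact hcI
        · exact mem_I_of_mem_Ioo hA (hB x hx).2.2)
    (by intro x hx
        rcases Finset.mem_insert.1 hx with rfl | hx
        · exact h1
        · exact (hB x hx).1.1) (Finset.insert_nonempty _ _)
  have hcD : c ∉ D := fun h => hDd c h (Finset.mem_insert_self _ _)
  rw [Finset.card_insert_of_notMem hcB] at hDc
  refine hF.false_of_zeros hanti (j := k + 1) hkN (S := insert c D) ?_ ?_ ?_
  · intro x hx
    rcases Finset.mem_insert.1 (Finset.mem_coe.1 hx) with rfl | hx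
    · exact hcI
    · exact hD hx
  · intro x hx
    rcases Finset.mem_insert.1 hx with rfl | hx
    · exact h2
    · exact hD0 x hx
  · rw [Finset.card_insert_of_notMem hcD]
    omega

end LandauKolmogorov

namespace LandauKolmogorov

/-! ### The comparison theorem -/

theorem laguerre_strict {p : ℝ[X]} (hp : p.Splits) (hd : 0 < p.natDegree) {x : ℝ}
    (hx : p.eval x ≠ 0) :
    p.eval x * (derivative (derivative p)).eval x < (derivative p).eval x ^ 2 := by
  obtain ⟨r, hr⟩ := Multiset.exists_mem_of_ne_zero (hp.roots_ne_zero hd.ne')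
  have hp0 : p ≠ 0 := by rintro rfl; simp at hx
  obtain ⟨g, rfl⟩ := dvd_iff_isRoot.2 ((mem_roots hp0).1 hr)
  have hg := laguerre (Splits.of_dvd hp hp0 (Dvd.intro_left _ rfl)) x
  simp only [derivative_mul, derivative_sub, derivative_X, derivative_C, derivative_add, eval_add,
    eval_mul, eval_sub, eval_X, eval_C, sub_zero, one_mul] at hx ⊢
  have := sq_pos_of_ne_zero (right_ne_zero_of_mul hx)
  nlinarith [mul_le_mul_of_nonneg_left hg (sq_nonneg (x - r))]

/-- The terms with x - b cancel and leave (k+1)(g^(k))^2 - k g^(k-1) g^(k+1), to which Laguerre's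
inequality applies. -/
theorem wronskian_X_sub_C_mul_nonneg {g : ℝ[X]} (hg : g.Splits) (b x : ℝ) {k : ℕ} (hk : 1 ≤ k) :
    0 ≤ (derivative^[k + 1] ((X - C b) * g)).eval x * (derivative^[k] g).eval x -
      (derivative^[k] ((X - C b) * g)).eval x * (derivative^[k + 1] g).eval x := by
  obtain ⟨j, rfl⟩ := Nat.exists_eq_add_of_le' hk
  rw [eval_iterate_derivative_succ_X_sub_C_mul, eval_iterate_derivative_succ_X_sub_C_mul]
  have h := laguerre (splits_iterate_derivative hg j) x
  rw [← Function.iterate_succ_apply' derivative, ← Function.iterate_succ_apply' derivative] at h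
  simp only [Nat.succ_eq_add_one] at h
  push_cast
  nlinarith [mul_le_mul_of_nonneg_left h (by positivity : (0 : ℝ) ≤ j + 1),
    sq_nonneg ((derivative^[j + 1] g).eval x)]

theorem prod_erase_sign {m : ℕ} {τ : Fin (m + 1) → ℝ} (hτ : StrictMono τ) (i : Fin (m + 1)) :
    0 < (-1 : ℝ) ^ (m - i.val) * ∏ j ∈ Finset.univ.erase i, (τ i - τ j) := by
  have h1 : Finset.univ.erase i = Finset.Iio i ∪ Finset.Ioi i := by
    ext j; simp [lt_or_lt_iff_ne]
  have hdisj : Disjoint (Finset.Iio i) (Finset.Ioi i) := by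
    rw [Finset.disjoint_left]
    intro j hj hj'
    exact (lt_asymm (Finset.mem_Iio.1 hj) (Finset.mem_Ioi.1 hj'))
  have h2 : (-1 : ℝ) ^ (m - i.val) = ∏ _j ∈ Finset.Ioi i, (-1 : ℝ) := by
    rw [Finset.prod_const, Fin.card_Ioi]; congr 1
  rw [h1, Finset.prod_union hdisj, h2, mul_left_comm, ← Finset.prod_mul_distrib]
  refine mul_pos (Finset.prod_pos fun j hj => ?_) (Finset.prod_pos fun j hj => ?_)
  · exact sub_pos.2 (hτ (Finset.mem_Iio.1 hj))
  · have := hτ (Finset.mem_Ioi.1 hj); linarith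

theorem eval_iterate_derivative_sub_of_natDegree_le {P : ℝ[X]} {m : ℕ} (h : P.natDegree ≤ m + 1)
    (x y : ℝ) : (derivative^[m] P).eval y - (derivative^[m] P).eval x =
      ((m + 1)! : ℝ) * P.coeff (m + 1) * (y - x) := by
  have hd : (derivative^[m] P).natDegree ≤ 1 := by
    rw [natDegree_iterate_derivative_eq]; omega
  have hc : (derivative^[m] P).coeff 1 = ((m + 1)! : ℝ) * P.coeff (m + 1) := by
    rw [coeff_iterate_derivative, nsmul_eq_mul, add_comm 1 m, Nat.descFactorial_eq_div (by omega)]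
    simp
  rw [eq_X_add_C_of_natDegree_le_one hd, hc]
  simp
  ring

/-- Lagrange interpolation: the denominator at τ i has sign (-1)^(m-i), so data of weakly
alternating sign have nonnegative coefficients. -/
theorem linear_combination_of_sign {m : ℕ} {τ : Fin (m + 1) → ℝ} (hτ : StrictMono τ)
    {g : Fin (m + 1) → ℝ} (hg : ∀ i, 0 ≤ (-1 : ℝ) ^ (m - i.val) * g i) :
    ∃ c : Fin (m + 1) → ℝ, (∀ i, 0 ≤ c i) ∧ ∀ i,
      (∑ j, C (c j) * ∏ l ∈ Finset.univ.erase j, (X - C (τ l))).eval (τ i) = g i := by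
  refine ⟨fun i => g i / ∏ j ∈ Finset.univ.erase i, (τ i - τ j), fun i => ?_, fun i => ?_⟩
  · have h1 := prod_erase_sign hτ i
    have h2 := hg i
    have : g i / ∏ j ∈ Finset.univ.erase i, (τ i - τ j) = ((-1 : ℝ) ^ (m - i.val) * g i) /
        ((-1 : ℝ) ^ (m - i.val) * ∏ j ∈ Finset.univ.erase i, (τ i - τ j)) := by
      exact (mul_div_mul_left _ _ (pow_ne_zero _ (by norm_num))).symm
    simp only [this]
    positivity
  · have hne : ∏ j ∈ Finset.univ.erase i, (τ i - τ j) ≠ 0 := fun h0 => by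
      simpa [h0] using prod_erase_sign hτ i
    rw [eval_finsetSum, Finset.sum_eq_single i]
    · simp only [eval_mul, eval_C, eval_prod, eval_sub, eval_X]
      exact div_mul_cancel₀ _ hne
    · intro j _ hji
      rw [eval_mul, eval_prod, Finset.prod_eq_zero (Finset.mem_erase.2 ⟨hji.symm, Finset.mem_univ i⟩)
        (by simp), mul_zero]
    · simp

/-- Lagrange-type remainders with decreasing derivative have nonnegative Wronskian. -/
theorem IsJet.wronskian_nonneg {m k : ℕ} (hk : 1 ≤ k) (hkm : k + 1 ≤ m) {τ : Fin (m + 1) → ℝ}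
    (hτ : StrictMono τ) (hτI : ∀ i, τ i ∈ I) {R : ℕ → ℝ → ℝ} (hR : IsJet m R)
    (h0 : ∀ i, R 0 (τ i) = 0) (hanti : AntitoneOn (R m) I) {x : ℝ} (hx : x ∈ I) {q : ℝ[X]}
    (hq : q = ∏ i : Fin m, (X - C (τ i.succ))) :
    0 ≤ (derivative^[k + 1] q).eval x * R k x - (derivative^[k] q).eval x * R (k + 1) x := by
  have hqs : q.Splits := by rw [hq]; exact splits_prod_X_sub_C _ _
  have hqd : q.natDegree = m := by rw [hq, natDegree_prod_X_sub_C]; simp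
  have hqm : q.Monic := by rw [hq]; exact monic_prod_X_sub_C' _ _
  have hqτ : ∀ i : Fin m, q.eval (τ i.succ) = 0 := fun i => by
    rw [hq, eval_prod]; exact Finset.prod_eq_zero (Finset.mem_univ i) (by simp)
  set ψ : ℝ[X] := (X - C (τ 0)) * q with hψ
  have hψm : ψ.Monic := (monic_X_sub_C _).mul hqm
  have hψd : ψ.natDegree = m + 1 := by
    rw [hψ, (monic_X_sub_C _).natDegree_mul hqm, natDegree_X_sub_C, hqd]; ring
  have hψτ : ∀ i : Fin m, ψ.eval (τ i.succ) = 0 := fun i => by rw [hψ, eval_mul, hqτ, mul_zero]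
  obtain ⟨S, hSI, hSc, hSτ⟩ : ∃ S : Finset ℝ, ↑S ⊆ I ∧ S.card = m ∧
      ∀ y ∈ S, ∃ i : Fin m, y = τ i.succ := by
    classical
    refine ⟨Finset.univ.image fun i : Fin m => τ i.succ, ?_, ?_, ?_⟩
    · intro y hy
      obtain ⟨i, -, rfl⟩ := Finset.mem_image.1 (Finset.mem_coe.1 hy)
      exact hτI _
    · rw [Finset.card_image_of_injective _ fun i j h => Fin.succ_injective _ (hτ.injective h)]
      simp
    · intro y hy
      obtain ⟨i, -, rfl⟩ := Finset.mem_image.1 hy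
      exact ⟨i, rfl⟩
  have hψk : (derivative^[k] ψ).eval x =
      (x - τ 0) * (derivative^[k] q).eval x + k * (derivative^[k - 1] q).eval x := by
    have := eval_iterate_derivative_succ_X_sub_C_mul (τ 0) q (k - 1) x
    rw [Nat.sub_add_cancel hk] at this
    rw [hψ, this, Nat.cast_sub hk]
    simp
  have hψk1 : (derivative^[k + 1] ψ).eval x =
      (x - τ 0) * (derivative^[k + 1] q).eval x + (k + 1) * (derivative^[k] q).eval x :=
    eval_iterate_derivative_succ_X_sub_C_mul (τ 0) q k x
  have hgs := splits_iterate_derivative hqs (k - 1)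
  have e1 : derivative (derivative^[k - 1] q) = derivative^[k] q := by
    rw [← Function.iterate_succ_apply' derivative, Nat.succ_eq_add_one, Nat.sub_add_cancel hk]
  have e2 : derivative (derivative^[k] q) = derivative^[k + 1] q :=
    (Function.iterate_succ_apply' derivative k q).symm
  -- The combination b R - ε ψ - c q vanishes at the m nodes after the first. Its m-th derivative
  -- decreases strictly, because ψ has degree m + 1 and ε > 0. So it has no double zero in its k-th
  -- derivative.
  have key : ∀ (ε c : ℝ) (b : ℝ), 0 ≤ b → 0 < ε →
      b * R k x - ε * (derivative^[k] ψ).eval x - c * (derivative^[k] q).eval x = 0 →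
      b * R (k + 1) x - ε * (derivative^[k + 1] ψ).eval x -
        c * (derivative^[k + 1] q).eval x = 0 → False := by
    intro ε c b hb hε g1 g2
    have hJ : IsJet m (fun j y => b * R j y - ε * (derivative^[j] ψ).eval y -
        c * (derivative^[j] q).eval y) := fun j hj y hy =>
      (((hR j hj y hy).const_mul b).sub ((isJet_polyJet m ψ j hj y hy).const_mul ε)).sub
        ((isJet_polyJet m q j hj y hy).const_mul c)
    refine hJ.no_double_zero ?_ hk hkm hSI ?_ hSc.ge hx g1 g2
    · intro y hy z hz hyz
      have i1 := hanti hy hz hyz.le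
      have i2 := eval_iterate_derivative_sub_of_natDegree_le hψd.le y z
      have i3 := eval_iterate_derivative_sub_of_natDegree_le (hqd.le.trans (Nat.le_succ m)) y z
      rw [coeff_eq_zero_of_natDegree_lt (by omega : q.natDegree < m + 1)] at i3
      rw [← hψd, coeff_natDegree, hψm.leadingCoeff, hψd] at i2
      have i4 : 0 < ε * (((m + 1)! : ℝ) * 1 * (z - y)) := by
        have := sub_pos.2 hyz
        positivity
      rw [← i2] at i4
      have i5 := mul_le_mul_of_nonneg_left i1 hb
      have i6 : (derivative^[m] q).eval z = (derivative^[m] q).eval y := by linarith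
      simp only [i6]
      linarith
    · intro y hy
      obtain ⟨i, rfl⟩ := hSτ y hy
      simp only [Function.iterate_zero, id_eq]
      rw [h0, hqτ, hψτ]
      ring
  have hne : ¬ ((derivative^[k] q).eval x = 0 ∧ (derivative^[k + 1] q).eval x = 0) := by
    rintro ⟨g1, g2⟩
    by_cases hG : (derivative^[k - 1] q).eval x = 0
    · refine key 1 0 0 le_rfl one_pos ?_ ?_
      · rw [hψk, hG, g1]; ring
      · rw [hψk1, g1, g2]; ring
    · have := laguerre_strict hgs (by rw [natDegree_iterate_derivative_eq]; omega) hG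
      rw [e1, e2, g1, g2] at this
      simp at this
  have key' : ∀ (ε b : ℝ), 0 ≤ b → 0 < ε →
      (derivative^[k + 1] q).eval x * (b * R k x - ε * (derivative^[k] ψ).eval x) -
        (derivative^[k] q).eval x * (b * R (k + 1) x - ε * (derivative^[k + 1] ψ).eval x) ≠ 0 := by
    intro ε b hb hε hz
    by_cases h1 : (derivative^[k] q).eval x = 0
    · have h2 : (derivative^[k + 1] q).eval x ≠ 0 := fun h => hne ⟨h1, h⟩
      rw [h1, zero_mul, sub_zero] at hz
      refine key ε ((b * R (k + 1) x - ε * (derivative^[k + 1] ψ).eval x) /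
        (derivative^[k + 1] q).eval x) b hb hε ?_ ?_
      · rw [h1, mul_zero, sub_zero]
        exact (mul_eq_zero.1 hz).resolve_left h2
      · rw [div_mul_cancel₀ _ h2, sub_self]
    · refine key ε ((b * R k x - ε * (derivative^[k] ψ).eval x) /
        (derivative^[k] q).eval x) b hb hε ?_ ?_
      · rw [div_mul_cancel₀ _ h1, sub_self]
      · field_simp
        linarith
  have hlag := laguerre hgs x
  rw [e1, e2] at hlag
  set Q := (derivative^[k] q).eval x
  set Q' := (derivative^[k + 1] q).eval x
  set L := (k + 1) * Q ^ 2 - k * (derivative^[k - 1] q).eval x * Q' with hL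
  have hLψ : Q' * (derivative^[k] ψ).eval x - Q * (derivative^[k + 1] ψ).eval x = -L := by
    rw [hψk, hψk1, hL]; ring
  have hL0 : 0 ≤ L := by
    have hk0 : (0 : ℝ) ≤ k := by positivity
    nlinarith [mul_le_mul_of_nonneg_left hlag hk0, sq_nonneg Q]
  have hLpos : 0 < L := by
    refine lt_of_le_of_ne hL0 fun h => key' 1 0 le_rfl one_pos ?_
    linear_combination (-1) * hLψ - h
  -- The Wronskian with q is -L for ψ, with L > 0. If it were negative for R, a positive combination
  -- of R and -ψ would have Wronskian 0 at x, and subtracting a multiple of q would create the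
  -- forbidden double zero.
  by_contra! hneg
  refine key' (-(Q' * R k x - Q * R (k + 1) x)) L hL0 (by linarith) ?_
  linear_combination (Q' * R k x - Q * R (k + 1) x) * hLψ

/-- Split P - F into its interpolant p at the nodes and a remainder R. Since |F| ≤ 1, the values of
P - F alternate weakly in sign, so p is a nonnegative combination of Lagrange products, each with
nonnegative Wronskian. The condition on the leading coefficient makes R^(m) nonincreasing, which is
what `IsJet.wronskian_nonneg` needs. -/
theorem IsJet.comparison {m k : ℕ} (hk : 1 ≤ k) (hkm : k + 1 ≤ m) {τ : Fin (m + 1) → ℝ}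
    (hτ : StrictMono τ) (hτI : ∀ i, τ i ∈ I) {P : ℝ[X]} (hPd : P.natDegree ≤ m + 1)
    (hP : ∀ i : Fin (m + 1), 1 ≤ (-1 : ℝ) ^ (m - i.val) * P.eval (τ i)) {σ : ℝ}
    (hPc : ((m + 1)! : ℝ) * P.coeff (m + 1) ≤ -σ) {F : ℕ → ℝ → ℝ} (hF : IsJet m F)
    (hF0 : ∀ x ∈ I, |F 0 x| ≤ 1)
    (hFσ : ∀ x ∈ I, ∀ y ∈ I, x ≤ y → |F m y - F m x| ≤ σ * (y - x)) {x : ℝ} (hx : x ∈ I) {q : ℝ[X]}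
    (hq : q = ∏ i : Fin m, (X - C (τ i.succ))) :
    (derivative^[k + 1] q).eval x * F k x - (derivative^[k] q).eval x * F (k + 1) x ≤
      (derivative^[k + 1] q).eval x * (derivative^[k] P).eval x -
        (derivative^[k] q).eval x * (derivative^[k + 1] P).eval x := by
  obtain ⟨c, hc, hcτ⟩ := linear_combination_of_sign hτ (g := fun i => P.eval (τ i) - F 0 (τ i))
    (fun i => by
      have h1 := hP i
      have h2 := abs_le.1 (hF0 _ (hτI i))
      rcases neg_one_pow_eq_or ℝ (m - i.val) with h | h <;> rw [h] at h1 ⊢ <;> linarith)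
  set p := ∑ j, C (c j) * ∏ l ∈ Finset.univ.erase j, (X - C (τ l)) with hp
  have hpd : p.natDegree ≤ m := by
    refine natDegree_sum_le_of_forall_le _ _ fun i _ => ?_
    refine (natDegree_C_mul_le _ _).trans ?_
    rw [natDegree_prod_X_sub_C, Finset.card_erase_of_mem (Finset.mem_univ i)]
    simp
  have hR := ((isJet_polyJet m P).sub hF).sub (isJet_polyJet m p)
  have h1 := hR.wronskian_nonneg hk hkm hτ hτI (fun i => by
      have := hcτ i
      simp only [polyJet, Function.iterate_zero, id_eq]
      linarith) (fun y hy z hz hyz => ?_) hx hq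
  · have h2 : 0 ≤ (derivative^[k + 1] q).eval x * (derivative^[k] p).eval x -
        (derivative^[k] q).eval x * (derivative^[k + 1] p).eval x := by
      have hlin : ∀ j, (derivative^[j] p).eval x =
          ∑ i, c i * (derivative^[j] (∏ l ∈ Finset.univ.erase i, (X - C (τ l)))).eval x := by
        intro j
        rw [hp, iterate_derivative_sum, eval_finsetSum]
        refine Finset.sum_congr rfl fun i _ => ?_
        rw [iterate_derivative_C_mul, eval_mul, eval_C]
      rw [hlin, hlin, Finset.mul_sum, Finset.mul_sum, ← Finset.sum_sub_distrib]
      refine Finset.sum_nonneg fun i _ => ?_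
      rw [mul_left_comm, mul_left_comm _ (c i), ← mul_sub]
      refine mul_nonneg (hc i) ?_
      refine Fin.cases ?_ (fun i => ?_) i
      · have : ∏ l ∈ Finset.univ.erase (0 : Fin (m + 1)), (X - C (τ l)) = q := by
          refine mul_left_cancel₀ (X_sub_C_ne_zero (τ 0)) ?_
          rw [Finset.mul_prod_erase _ (fun l => X - C (τ l)) (Finset.mem_univ _),
            Fin.prod_univ_succ, hq]
        rw [this]; linarith
      · set g := ∏ l ∈ Finset.univ.erase i, (X - C (τ l.succ)) with hg
        have hqg : q = (X - C (τ i.succ)) * g := by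
          rw [hq, hg, Finset.mul_prod_erase _ (fun l : Fin m => X - C (τ l.succ))
            (Finset.mem_univ _)]
        -- Exchanging the factor of τ i.succ for that of τ 0 changes q by (τ i.succ - τ 0) g. The
        -- Wronskian of q with itself is 0, so only g contributes.
        have : ∏ l ∈ Finset.univ.erase i.succ, (X - C (τ l)) =
            q + C (τ i.succ - τ 0) * g := by
          refine mul_left_cancel₀ (X_sub_C_ne_zero (τ i.succ)) ?_
          rw [Finset.mul_prod_erase _ (fun l => X - C (τ l)) (Finset.mem_univ _),
            Fin.prod_univ_succ, ← hq, hqg, C_sub]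
          ring
        have hw := wronskian_X_sub_C_mul_nonneg (splits_prod_X_sub_C _ _ : g.Splits) (τ i.succ) x hk
        rw [← hqg] at hw
        have hpos := sub_pos.2 (hτ (Fin.succ_pos i))
        rw [this, iterate_map_add, iterate_map_add, iterate_derivative_C_mul,
          iterate_derivative_C_mul]
        simp only [eval_add, eval_mul, eval_C]
        nlinarith [mul_nonneg hpos.le hw]
    simp only [polyJet] at h1
    linarith
  · have i1 := hFσ y hy z hz hyz
    have i2 := eval_iterate_derivative_sub_of_natDegree_le hPd y z
    have i3 := eval_iterate_derivative_sub_of_natDegree_le (hpd.trans (Nat.le_succ m)) y z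
    rw [coeff_eq_zero_of_natDegree_lt (by omega : p.natDegree < m + 1)] at i3
    have i4 := mul_le_mul_of_nonneg_right hPc (sub_nonneg.2 hyz)
    have i5 := (abs_le.1 i1).1
    simp only [polyJet]
    linarith

end LandauKolmogorov

namespace LandauKolmogorov

/-! ### Jets of functions of the Sobolev class -/

/-- `F 0, …, F m` are the derivatives of a function bounded by one on `[-1, 1]` for which the
derivative of order `m` has Lipschitz constant `σ`. -/
structure IsSobolevJet (m : ℕ) (σ : ℝ) (F : ℕ → ℝ → ℝ) : Prop where
  isJet : IsJet m F
  abs_le_one : ∀ x ∈ I, |F 0 x| ≤ 1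
  lipschitz : ∀ x ∈ I, ∀ y ∈ I, x ≤ y → |F m y - F m x| ≤ σ * (y - x)

theorem isSobolevJet_of_mem_sobolevClass {m : ℕ} {σ : ℝ} {f : ℝ → ℝ}
    (hf : f ∈ sobolevClass (m + 1) σ) :
    IsSobolevJet m σ (fun j => iteratedDerivWithin j f I) := by
  obtain ⟨⟨h1, h2, -⟩, h3, h4⟩ := hf
  rw [Nat.add_sub_cancel] at h1 h2
  have hu : UniqueDiffOn ℝ I := uniqueDiffOn_Icc (by norm_num)
  refine ⟨fun j hj x hx => ?_, fun x hx => by simpa using h3 x hx, fun x hx y hy hxy => ?_⟩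
  · have := (h1.differentiableOn_iteratedDerivWithin (by exact_mod_cast hj) hu x hx)
    rw [iteratedDerivWithin_succ]
    exact this.hasDerivWithinAt
  · have hIcc : uIcc x y ⊆ uIcc (-1 : ℝ) 1 := by
      rw [uIcc_of_le hxy, uIcc_of_le (by norm_num)]
      exact Icc_subset_Icc hx.1 hy.2
    rw [← (h2.mono hIcc).integral_deriv_eq_sub, ← Real.norm_eq_abs]
    refine (intervalIntegral.norm_integral_le_of_norm_le_const_ae ?_).trans_eq
      (by rw [abs_of_nonneg (sub_nonneg.2 hxy)])
    have h5 := (ae_restrict_iff' measurableSet_Icc).1 h4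
    -- At the right end point the two-sided derivative in the integral need not agree with the
    -- one-sided derivative; this point is null.
    have h6 : ∀ᵐ z ∂(volume : Measure ℝ), z ≠ 1 := by
      simp [ae_iff, measure_singleton]
    filter_upwards [h5, h6] with z hz hz1 hzI
    rw [uIoc_of_le hxy] at hzI
    have hzI' : z ∈ I := ⟨hx.1.trans hzI.1.le, hzI.2.trans hy.2⟩
    have := hz hzI'
    have hnhds : I ∈ nhds z := Icc_mem_nhds (hx.1.trans_lt hzI.1) (lt_of_le_of_ne hzI'.2 hz1)
    rwa [iteratedDerivWithin_succ, derivWithin_of_mem_nhds hnhds] at this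

theorem IsSobolevJet.neg {m : ℕ} {σ : ℝ} {F : ℕ → ℝ → ℝ} (hF : IsSobolevJet m σ F) :
    IsSobolevJet m σ (fun j x => -F j x) :=
  ⟨hF.isJet.neg, fun x hx => by rw [abs_neg]; exact hF.abs_le_one x hx, fun x hx y hy hxy => by
    rw [neg_sub_neg, abs_sub_comm]; exact hF.lipschitz x hx y hy hxy⟩

theorem IsSobolevJet.mono {m : ℕ} {σ σ' : ℝ} {F : ℕ → ℝ → ℝ} (hF : IsSobolevJet m σ F)
    (h : σ ≤ σ') : IsSobolevJet m σ' F :=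
  ⟨hF.isJet, hF.abs_le_one, fun x hx y hy hxy => (hF.lipschitz x hx y hy hxy).trans
    (mul_le_mul_of_nonneg_right h (sub_nonneg.2 hxy))⟩

/-- Affine substitutions of [-1,1] into itself serve two purposes: carrying one prescribed point to
another, and lowering the bound on the n-th derivative. -/
theorem IsSobolevJet.contract {m : ℕ} {σ : ℝ} {F : ℕ → ℝ → ℝ} (hF : IsSobolevJet m σ F) {b c : ℝ}
    (hc : 0 ≤ c) (hbc : |b| + c ≤ 1) :
    IsSobolevJet m (c ^ (m + 1) * σ) (fun j x => c ^ j * F j (b + c * x)) := by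
  have hb := abs_le.1 (le_sub_iff_add_le.2 hbc)
  have hmaps : MapsTo (fun x => b + c * x) I I := fun x hx => by
    constructor <;> nlinarith [hx.1, hx.2, hb.1, hb.2]
  refine ⟨fun j hj x hx => ?_, fun x hx => ?_, fun x hx y hy hxy => ?_⟩
  · have h1 : HasDerivWithinAt (fun x => b + c * x) c I x := by
      simpa using (((hasDerivAt_id x).const_mul c).const_add b).hasDerivWithinAt
    have h2 := ((hF.isJet j hj _ (hmaps hx)).comp x h1 hmaps).const_mul (c ^ j)
    refine h2.congr_deriv ?_
    ring
  · simpa using hF.abs_le_one _ (hmaps hx)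
  · have h1 := hF.lipschitz _ (hmaps hx) _ (hmaps hy) (by nlinarith)
    rw [← mul_sub, abs_mul, abs_of_nonneg (pow_nonneg hc m)]
    calc c ^ m * |F m (b + c * y) - F m (b + c * x)|
        ≤ c ^ m * (σ * ((b + c * y) - (b + c * x))) :=
          mul_le_mul_of_nonneg_left h1 (pow_nonneg hc m)
      _ = _ := by ring

end LandauKolmogorov

namespace LandauKolmogorov

/-! ### Alternation -/

/-- A polynomial of degree at most `n` with `n + 2` points of weakly alternating sign vanishes. -/
theorem eq_zero_of_alternation {n : ℕ} {D : ℝ[X]} (hD : D.natDegree ≤ n) {t : ℕ → ℝ}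
    (ht : ∀ i ≤ n, t i < t (i + 1))
    (hs : ∀ i ≤ n + 1, 0 ≤ (-1 : ℝ) ^ (n + 1 - i) * D.eval (t i)) : D = 0 := by
  set τ : Fin (n + 1 + 1) → ℝ := fun i => t i with hτ
  have hmono : StrictMono τ := Fin.strictMono_iff_lt_succ.2 fun i => by
    simpa [hτ] using ht i (by omega)
  obtain ⟨c, hc, hcτ⟩ := linear_combination_of_sign hmono (g := fun i => D.eval (τ i))
    fun i => hs i (by omega)
  set p := ∑ j, C (c j) * ∏ l ∈ Finset.univ.erase j, (X - C (τ l)) with hp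
  have hcard : ∀ j : Fin (n + 1 + 1), (Finset.univ.erase j).card = n + 1 := fun j => by
    rw [Finset.card_erase_of_mem (Finset.mem_univ j)]; simp
  have hpd : p.natDegree ≤ n + 1 := by
    refine natDegree_sum_le_of_forall_le _ _ fun i _ => ?_
    refine (natDegree_C_mul_le _ _).trans ?_
    rw [natDegree_prod_X_sub_C, hcard]
  have hDp : D - p = 0 := by
    refine eq_zero_of_natDegree_lt_card_of_eval_eq_zero _ hmono.injective (fun i => ?_) ?_
    · rw [eval_sub, hcτ, sub_self]
    · rw [Fintype.card_fin]
      exact (natDegree_sub_le _ _).trans_lt (by omega)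
  -- The interpolant is D itself, so its coefficient in degree n + 1 is 0. It is also the sum of the
  -- nonnegative weights, which must therefore all vanish.
  have hcoeff : p.coeff (n + 1) = ∑ j, c j := by
    rw [hp, finsetSum_coeff]
    refine Finset.sum_congr rfl fun j _ => ?_
    have h1 := (monic_prod_X_sub_C' (Finset.univ.erase j) τ).coeff_natDegree
    rw [natDegree_prod_X_sub_C, hcard] at h1
    rw [coeff_C_mul, h1, mul_one]
  rw [← sub_eq_zero.1 hDp, coeff_eq_zero_of_natDegree_lt (by omega), eq_comm,
    Finset.sum_eq_zero_iff_of_nonneg fun i _ => hc i] at hcoeff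
  rw [sub_eq_zero.1 hDp, hp]
  exact Finset.sum_eq_zero fun j hj => by rw [hcoeff j hj]; simp

theorem not_double_zero_of_nodup {p : ℝ[X]} (hp : p.Splits) (hn : p.roots.Nodup) {k : ℕ}
    (hk : k < p.natDegree) {x : ℝ} (h1 : (derivative^[k] p).eval x = 0) :
    (derivative^[k + 1] p).eval x ≠ 0 := by
  have hp0 : p ≠ 0 := by rintro rfl; simp at hk
  induction k with
  | zero =>
    intro h2
    have h3 := one_lt_rootMultiplicity_iff_isRoot hp0 |>.2 ⟨h1, h2⟩
    have h4 := Multiset.nodup_iff_count_le_one.1 hn x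
    rw [count_roots] at h4
    omega
  | succ k ih =>
    intro h2
    by_cases h0 : (derivative^[k] p).eval x = 0
    · exact ih (by omega) h0 h1
    · have h3 := laguerre_strict (splits_iterate_derivative hp k)
        (by rw [natDegree_iterate_derivative_eq]; omega) h0
      rw [← Function.iterate_succ_apply' derivative, ← Function.iterate_succ_apply' derivative] at h3
      simp only [Nat.succ_eq_add_one, h1, h2] at h3
      simp at h3

theorem nodup_roots_prod_X_sub_C {m : ℕ} {τ : Fin m → ℝ} (hτ : Function.Injective τ) :
    (∏ i, (X - C (τ i))).roots.Nodup := by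
  rw [roots_prod]
  · simp only [roots_X_sub_C, Multiset.bind_singleton]
    exact Finset.univ.nodup.map hτ
  · exact (monic_prod_X_sub_C' _ _).ne_zero

/-- At and beyond the largest zero of a derivative, the next derivative is positive. -/
theorem eval_iterate_derivative_pos_of_rootsLE {p : ℝ[X]} (hp : p.Splits) (hn : p.roots.Nodup)
    (hl : 0 < p.leadingCoeff) {k : ℕ} (hk : k < p.natDegree) {y x : ℝ} (hy : RootsLE k p y)
    (hyx : y ≤ x) : 0 < (derivative^[k + 1] p).eval x := by
  have hs := splits_iterate_derivative hp k
  have hlc := leadingCoeff_iterate_derivative_pos hl hk.le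
  have hd : 0 < (derivative^[k] p).natDegree := by rw [natDegree_iterate_derivative_eq]; omega
  have hne : derivative^[k] p ≠ 0 := by intro h; rw [h] at hd; simp at hd
  obtain ⟨z, hz0, hz⟩ := exists_max_root hs hlc hd
  have hzy : z ≤ y := by
    by_contra! h
    exact (hy z h).ne' hz0
  rcases (hzy.trans hyx).eq_or_lt with rfl | hlt
  · refine lt_of_le_of_ne ?_ (not_double_zero_of_nodup hp hn hk hz0).symm
    by_contra! hneg
    rw [Function.iterate_succ_apply'] at hneg
    obtain ⟨U, hU, -, hr⟩ := sign_near_of_hasDerivAt ((derivative^[k] p).hasDerivAt z) hz0 hneg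
    obtain ⟨ε, hε, hball⟩ := Metric.mem_nhds_iff.1 hU
    rw [Real.ball_eq_Ioo] at hball
    exact (hr (z + ε / 2) (hball ⟨by linarith, by linarith⟩) (by linarith)).not_gt
      (hz _ (by linarith))
  · rw [Function.iterate_succ_apply']
    refine eval_derivative_pos_of_roots_lt hs hlc hd fun r hr => ?_
    by_contra! h
    exact (hz r (hlt.trans_le h)).ne' ((mem_roots hne).1 hr)

theorem rootsLE_of_roots_le {p : ℝ[X]} (hp : p.Splits) (hl : 0 < p.leadingCoeff) {b : ℝ}
    (h : ∀ r ∈ p.roots, r ≤ b) {k : ℕ} (hk : k ≤ p.natDegree) : RootsLE k p b := by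
  induction k with
  | zero => exact fun z hz => eval_pos_of_roots_lt hp hl fun r hr => (h r hr).trans_lt hz
  | succ k ih =>
    intro z hz
    have hne : derivative^[k] p ≠ 0 := by
      intro h0
      have := leadingCoeff_iterate_derivative_pos hl (by omega : k ≤ p.natDegree)
      simp [h0] at this
    rw [Function.iterate_succ_apply']
    refine eval_derivative_pos_of_roots_lt (splits_iterate_derivative hp k)
      (leadingCoeff_iterate_derivative_pos hl (by omega))
      (by rw [natDegree_iterate_derivative_eq]; omega) fun r hr => ?_
    by_contra! h0
    exact (ih (by omega) r (hz.trans_le h0)).ne' ((mem_roots hne).1 hr)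

/-! ### Zolotarev polynomials -/

theorem eval_iterate_derivative_prod_pos {m : ℕ} {τ : Fin m → ℝ} {b : ℝ} (h : ∀ i, τ i < b)
    {k : ℕ} (hk : k ≤ m) : 0 < (derivative^[k] (∏ i, (X - C (τ i)))).eval b := by
  have hs := splits_prod_X_sub_C Finset.univ τ
  have hl : 0 < (∏ i, (X - C (τ i))).leadingCoeff := by
    rw [(monic_prod_X_sub_C' _ _).leadingCoeff]; exact one_pos
  have hd : (∏ i, (X - C (τ i))).natDegree = m := by rw [natDegree_prod_X_sub_C]; simp
  rcases Nat.eq_zero_or_pos m with rfl | hm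
  · obtain rfl : k = 0 := by omega
    simp
  have hne : (Finset.univ.image τ).Nonempty := by
    have : Nonempty (Fin m) := ⟨⟨0, hm⟩⟩
    simp
  set c := (Finset.univ.image τ).max' hne with hc
  have hcb : c < b := by
    obtain ⟨i, -, hi⟩ := Finset.mem_image.1 (Finset.max'_mem _ hne)
    rw [hc, ← hi]; exact h i
  refine rootsLE_of_roots_le hs hl (b := c) (fun r hr => ?_) (by rw [hd]; exact hk) b hcb
  rw [roots_prod _ _ (monic_prod_X_sub_C' _ _).ne_zero] at hr
  simp only [roots_X_sub_C, Multiset.bind_singleton] at hr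
  obtain ⟨i, hi, rfl⟩ := Multiset.mem_map.1 hr
  exact Finset.le_max' _ _ (Finset.mem_image_of_mem _ (Finset.mem_univ i))

theorem dvd_of_roots {m : ℕ} {τ : Fin m → ℝ} (hτ : Function.Injective τ) {p : ℝ[X]}
    (h : ∀ i, p.eval (τ i) = 0) : ∏ i, (X - C (τ i)) ∣ p := by
  refine Finset.prod_dvd_of_coprime (fun i _ j _ hij => ?_) fun i _ => dvd_iff_isRoot.2 (h i)
  exact isCoprime_X_sub_C_of_isUnit_sub (sub_ne_zero.2 (hτ.ne hij)).isUnit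

theorem derivative_eq_zero_of_extremal {Z : ℝ[X]} (hZ : ∀ x ∈ I, |Z.eval x| ≤ 1) {t s : ℝ}
    (ht : t ∈ Ioo (-1 : ℝ) 1) (hs : |s| = 1) (h : s * Z.eval t = 1) :
    (derivative Z).eval t = 0 := by
  have hl : IsLocalMax (fun x => s * Z.eval x) t := by
    filter_upwards [Ioo_mem_nhds ht.1 ht.2] with x hx
    rw [h]
    refine (le_abs_self _).trans ?_
    rw [abs_mul, hs, one_mul]
    exact hZ x (Ioo_subset_Icc_self hx)
  have h0 := hl.hasDerivAt_eq_zero ((Z.hasDerivAt t).const_mul s)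
  have hs0 : s ≠ 0 := by rintro rfl; simp at hs
  exact (mul_eq_zero.1 h0).resolve_left hs0

end LandauKolmogorov

/-! ### Structure of a Zolotarev polynomial with Z^(k+1)(1) = 0 -/

namespace LandauKolmogorov

theorem eval_iterate_derivative_ne_zero_of_roots {M : ℕ} {τ : Fin M → ℝ}
    (hτ : Function.Injective τ) (h1 : ∀ i, τ i < 1) {p : ℝ[X]} (hp : p ≠ 0)
    (hd : p.natDegree ≤ M) (h : ∀ i, p.eval (τ i) = 0) {k : ℕ} (hk : k ≤ M) :
    (derivative^[k] p).eval 1 ≠ 0 := by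
  obtain ⟨c, hc⟩ := dvd_of_roots hτ h
  have hm := monic_prod_X_sub_C' Finset.univ τ
  have hc0 : c ≠ 0 := by rintro rfl; exact hp (by rw [hc, mul_zero])
  have hcd : c.natDegree = 0 := by
    rw [hc, hm.natDegree_mul' hc0, natDegree_prod_X_sub_C, Finset.card_univ, Fintype.card_fin] at hd
    omega
  rw [eq_C_of_natDegree_eq_zero hcd] at hc hc0
  rw [hc, mul_comm, iterate_derivative_C_mul, eval_mul, eval_C]
  exact mul_ne_zero (fun h0 => hc0 (by rw [h0, C_0]))
    (eval_iterate_derivative_prod_pos h1 hk).ne'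

/-- The structure of a Zolotarev polynomial one of whose derivatives vanishes at `1`. -/
structure ZolotarevData (l : ℕ) (θ : ℝ) (Z : ℝ[X]) (τ : Fin (l + 2) → ℝ) (K β : ℝ) : Prop where
  strictMono : StrictMono τ
  mem : ∀ i, τ i ∈ I
  first : τ 0 = -1
  last : τ (Fin.last (l + 1)) = 1
  eval : ∀ i : Fin (l + 2), (-1 : ℝ) ^ (l + 1 - i.val) * Z.eval (τ i) = 1
  pos : 0 < K
  one_lt : 1 < β
  theta : θ = -(K * ((l + 1)! : ℝ))
  deriv : derivative Z = C (-K) * ((X - C β) * ∏ i : Fin l, (X - C (τ i.castSucc.succ)))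

/-- If an end point were not a node, Z' would have l + 1 zeros at nodes, all below 1. As deg Z' ≤ l
+ 1, no derivative of Z' of order k ≤ l + 1 could then vanish at 1. With both ends nodes, Z' is the
product over the l interior nodes times a linear factor. The vanishing at 1 forces that factor to be
nonconstant, with its root β beyond 1. -/
theorem exists_zolotarevData {l k : ℕ} (hk : 1 ≤ k) (hkl : k ≤ l) {θ : ℝ} {Z : ℝ[X]}
    (hZ : IsZolotarev (l + 2) θ Z) (h1 : derivAt Z (k + 1) 1 = 0) :
    ∃ τ K β, ZolotarevData l θ Z τ K β := by
  obtain ⟨hd, hc, hb, τ, hτ, hτI, hs⟩ := hZ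
  have hs' : ∀ i : Fin (l + 2), (-1 : ℝ) ^ (l + 1 - i.val) * Z.eval (τ i) = 1 := fun i => by
    have := hs i
    rwa [show l + 2 - (i.val + 1) = l + 1 - i.val by omega] at this
  have hZ1 : Z.eval (τ (Fin.last (l + 1))) = 1 := by simpa using hs' (Fin.last (l + 1))
  have hZ0 : derivative Z ≠ 0 := by
    intro h
    have h2 := hs' (Fin.castSucc (Fin.last l))
    rw [eq_C_of_derivative_eq_zero h, eval_C] at h2 hZ1
    simp [hZ1] at h2
    norm_num at h2
  have hZd : (derivative Z).natDegree ≤ l + 1 := (natDegree_derivative_le Z).trans (by omega)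
  have hroot : ∀ i, τ i ∈ Ioo (-1 : ℝ) 1 → (derivative Z).eval (τ i) = 0 := fun i hi =>
    derivative_eq_zero_of_extremal hb hi (by simp) (hs' i)
  have h1' : (derivative^[k] (derivative Z)).eval 1 = 0 := by
    rw [← Function.iterate_succ_apply]; exact h1
  have hlast : τ (Fin.last (l + 1)) = 1 := by
    by_contra hne
    have hlt : τ (Fin.last (l + 1)) < 1 := lt_of_le_of_ne (hτI _).2 hne
    have hi : ∀ i : Fin (l + 1), τ i.succ < 1 := fun i =>
      (hτ.monotone (Fin.le_last _)).trans_lt hlt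
    refine eval_iterate_derivative_ne_zero_of_roots (τ := fun i : Fin (l + 1) => τ i.succ)
      (fun i j h => Fin.succ_injective _ (hτ.injective h)) hi hZ0 hZd (fun i => hroot _ ⟨?_, hi i⟩)
      (by omega : k ≤ l + 1) h1'
    exact (hτI 0).1.trans_lt (hτ (Fin.succ_pos i))
  have hcs : ∀ i : Fin (l + 1), τ i.castSucc < 1 := fun i => by
    rw [← hlast]; exact hτ (Fin.castSucc_lt_last i)
  have hfirst : τ 0 = -1 := by
    by_contra hne
    have hlt : -1 < τ 0 := lt_of_le_of_ne (hτI _).1 (Ne.symm hne)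
    exact eval_iterate_derivative_ne_zero_of_roots (τ := fun i : Fin (l + 1) => τ i.castSucc)
      (fun i j h => Fin.castSucc_injective _ (hτ.injective h)) hcs hZ0 hZd
      (fun i => hroot _ ⟨hlt.trans_le (hτ.monotone (Fin.zero_le _)), hcs i⟩)
      (by omega : k ≤ l + 1) h1'
  set σ : Fin l → ℝ := fun i => τ i.castSucc.succ with hσ
  have hσm : StrictMono σ := fun i j hij => hτ (by simpa using hij)
  have hσ1 : ∀ i, σ i < 1 := fun i => by
    rw [← hlast]; exact hτ (Fin.succ_lt_succ_iff.2 (Fin.castSucc_lt_last i))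
  have hσ0 : ∀ i, -1 < σ i := fun i => by rw [← hfirst]; exact hτ (Fin.succ_pos _)
  obtain ⟨c, hcf⟩ := dvd_of_roots (p := derivative Z) hσm.injective
    fun i => hroot _ ⟨hσ0 i, hσ1 i⟩
  have hm := monic_prod_X_sub_C' Finset.univ σ
  set f := ∏ i, (X - C (σ i)) with hf
  have hfd : f.natDegree = l := by rw [hf, natDegree_prod_X_sub_C]; simp
  have hc0 : c ≠ 0 := by rintro rfl; exact hZ0 (by rw [hcf, mul_zero])
  have hcd : c.natDegree ≤ 1 := by
    rw [hcf, hm.natDegree_mul' hc0, hfd] at hZd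
    omega
  obtain ⟨α, γ, hαγ⟩ : ∃ α γ : ℝ, c = C α * X + C γ :=
    ⟨_, _, eq_X_add_C_of_natDegree_le_one hcd⟩
  have hfk : 0 < (derivative^[k] f).eval 1 := eval_iterate_derivative_prod_pos hσ1 hkl
  have hfk1 : 0 < (derivative^[k - 1] f).eval 1 :=
    eval_iterate_derivative_prod_pos hσ1 (by omega)
  have hf1 : 0 < f.eval 1 := eval_iterate_derivative_prod_pos hσ1 (Nat.zero_le l)
  have hα : α ≠ 0 := by
    rintro rfl
    rw [C_0, zero_mul, zero_add] at hαγ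
    rw [hcf, hαγ, mul_comm, iterate_derivative_C_mul, eval_mul, eval_C] at h1'
    exact hc0 (by rw [hαγ, (mul_eq_zero.1 h1').resolve_right hfk.ne', C_0])
  obtain ⟨β, rfl⟩ : ∃ β, γ = -(α * β) := ⟨-(γ / α), by field_simp⟩
  have hZf : derivative Z = C α * ((X - C β) * f) := by
    rw [hcf, hαγ, C_neg, C_mul]; ring
  have hβ : 1 < β := by
    by_contra! hβ
    obtain ⟨j, rfl⟩ := Nat.exists_eq_add_of_le' hk
    rw [hZf, iterate_derivative_C_mul, eval_mul, eval_C,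
      eval_iterate_derivative_succ_X_sub_C_mul] at h1'
    have := (mul_eq_zero.1 h1').resolve_left hα
    rw [Nat.add_sub_cancel] at hfk1
    have h3 := mul_nonneg (sub_nonneg.2 hβ) hfk.le
    have h4 : 0 < ((j : ℝ) + 1) * (derivative^[j] f).eval 1 := by positivity
    linarith
  -- A positive α would make Z'(1) < 0, so Z would exceed Z(1) = 1 just to the left of 1.
  have hαneg : α < 0 := by
    refine lt_of_le_of_ne ?_ hα
    by_contra! hpos
    have h2 : (derivative Z).eval 1 < 0 := by
      rw [hZf]
      simp only [eval_mul, eval_C, eval_sub, eval_X]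
      exact mul_neg_of_pos_of_neg hpos (mul_neg_of_neg_of_pos (by linarith) hf1)
    rw [hlast] at hZ1
    obtain ⟨U, hU, hl, -⟩ := sign_near_of_hasDerivAt (g := fun x => Z.eval x - 1)
      ((Z.hasDerivAt 1).sub_const 1) (by simp [hZ1]) h2
    obtain ⟨ε, hε, hball⟩ := Metric.mem_nhds_iff.1 hU
    rw [Real.ball_eq_Ioo] at hball
    have hmin : 0 < min ε 1 := lt_min hε one_pos
    have h3 := hl (1 - min ε 1 / 2)
      (hball ⟨by linarith [min_le_left ε 1], by linarith⟩) (by linarith)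
    have h4 := (abs_le.1 (hb (1 - min ε 1 / 2) ⟨by linarith [min_le_right ε 1], by linarith⟩)).2
    linarith
  refine ⟨τ, -α, β, hτ, hτI, hfirst, hlast, hs', by linarith, hβ, ?_, by rw [neg_neg]; exact hZf⟩
  have h5 : (derivative Z).coeff (l + 1) = α := by
    have hm2 : ((X - C β) * f).Monic := (monic_X_sub_C β).mul hm
    have hd2 : ((X - C β) * f).natDegree = l + 1 := by
      rw [(monic_X_sub_C β).natDegree_mul hm, natDegree_X_sub_C, hfd]; ring
    rw [hZf, coeff_C_mul, ← hd2, hm2.coeff_natDegree, mul_one]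
  rw [coeff_derivative, hc] at h5
  have h6 : ((l + 2)! : ℝ) = (l + 2) * ((l + 1)! : ℝ) := by
    rw [Nat.factorial_succ]; push_cast; ring
  rw [h6] at h5
  have h7 : ((l + 1)! : ℝ) ≠ 0 := by positivity
  have h8 : (l : ℝ) + 2 ≠ 0 := by positivity
  field_simp at h5
  push_cast at h5
  have h9 : θ * ((l : ℝ) + 2) = α * ((l + 1)! : ℝ) * (l + 2) := by linear_combination h5
  have := mul_right_cancel₀ h8 h9
  linarith

end LandauKolmogorov

/-! ### Derivatives of the Zolotarev polynomial to the right of the largest zero of `tail^(k)` -/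

namespace LandauKolmogorov

theorem eval_iterate_derivative_X_sub_C_mul (b : ℝ) (g : ℝ[X]) {k : ℕ} (hk : 1 ≤ k) (x : ℝ) :
    (derivative^[k] ((X - C b) * g)).eval x =
      (x - b) * (derivative^[k] g).eval x + k * (derivative^[k - 1] g).eval x := by
  obtain ⟨j, rfl⟩ := Nat.exists_eq_add_of_le' hk
  rw [eval_iterate_derivative_succ_X_sub_C_mul]
  simp

/-- The numerator of the derivative of p/p' is p'^2 - p p'', nonnegative by Laguerre. -/
theorem monotoneOn_div_derivative {p : ℝ[X]} (hp : p.Splits) {y : ℝ}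
    (h : ∀ x, y < x → 0 < (derivative p).eval x) :
    MonotoneOn (fun x => p.eval x / (derivative p).eval x) (Ioi y) := by
  have hd : ∀ x ∈ Ioi y, HasDerivAt (fun x => p.eval x / (derivative p).eval x)
      (((derivative p).eval x * (derivative p).eval x -
        p.eval x * (derivative (derivative p)).eval x) / (derivative p).eval x ^ 2) x :=
    fun x hx => (p.hasDerivAt x).div ((derivative p).hasDerivAt x) (h x hx).ne'
  refine monotoneOn_of_deriv_nonneg (convex_Ioi y)
    (fun x hx => (hd x hx).continuousAt.continuousWithinAt)
    (fun x hx => (hd x (interior_subset hx)).differentiableAt.differentiableWithinAt)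
    fun x hx => ?_
  rw [(hd x (interior_subset hx)).deriv]
  have := laguerre hp x
  exact div_nonneg (by nlinarith) (sq_nonneg _)

namespace ZolotarevData

variable {l : ℕ} {θ : ℝ} {Z : ℝ[X]} {τ : Fin (l + 2) → ℝ} {K β : ℝ}

/-- The polynomial vanishing at the interior nodes. -/
noncomputable def inner (_ : ZolotarevData l θ Z τ K β) : ℝ[X] :=
  ∏ i : Fin l, (X - C (τ i.castSucc.succ))

/-- The polynomial vanishing at all nodes but the first one. -/
noncomputable def tail (_ : ZolotarevData l θ Z τ K β) : ℝ[X] :=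
  ∏ i : Fin (l + 1), (X - C (τ i.succ))

theorem theta_neg (d : ZolotarevData l θ Z τ K β) : θ < 0 := by
  have := d.pos
  rw [d.theta]
  have : 0 < K * ((l + 1)! : ℝ) := by positivity
  linarith

theorem inner_lt (d : ZolotarevData l θ Z τ K β) (i : Fin l) : τ i.castSucc.succ < 1 := by
  rw [← d.last]; exact d.strictMono (Fin.succ_lt_succ_iff.2 (Fin.castSucc_lt_last i))

variable (d : ZolotarevData l θ Z τ K β)

theorem inner_splits : d.inner.Splits := splits_prod_X_sub_C _ _

theorem tail_splits : d.tail.Splits := splits_prod_X_sub_C _ _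

theorem inner_monic : d.inner.Monic := monic_prod_X_sub_C' _ _

theorem tail_monic : d.tail.Monic := monic_prod_X_sub_C' _ _

theorem inner_leadingCoeff : 0 < d.inner.leadingCoeff := by
  rw [d.inner_monic.leadingCoeff]; exact one_pos

theorem tail_leadingCoeff : 0 < d.tail.leadingCoeff := by
  rw [d.tail_monic.leadingCoeff]; exact one_pos

theorem natDegree_inner : d.inner.natDegree = l := by
  rw [inner, natDegree_prod_X_sub_C]; simp

theorem natDegree_tail : d.tail.natDegree = l + 1 := by
  rw [tail, natDegree_prod_X_sub_C]; simp

theorem tail_nodup : d.tail.roots.Nodup :=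
  nodup_roots_prod_X_sub_C fun _ _ h => Fin.succ_injective _ (d.strictMono.injective h)

theorem tail_eq : d.tail = (X - C 1) * d.inner := by
  rw [tail, Fin.prod_univ_castSucc, inner, mul_comm, Fin.succ_last, d.last]

theorem derivative_eq : derivative Z = C (-K) * ((X - C β) * d.inner) := d.deriv

theorem exists_top {k : ℕ} (hkl : k ≤ l) :
    ∃ y, (derivative^[k] d.tail).eval y = 0 ∧ RootsLE k d.tail y :=
  exists_max_root (splits_iterate_derivative d.tail_splits k)
    (leadingCoeff_iterate_derivative_pos d.tail_leadingCoeff (by rw [natDegree_tail]; omega))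
    (by rw [natDegree_iterate_derivative_eq, natDegree_tail]; omega)

theorem rootsLE_inner {k : ℕ} (hkl : k ≤ l) {y : ℝ} (hy : RootsLE k d.tail y) :
    RootsLE k d.inner y := by
  rw [tail_eq] at hy
  exact hy.of_mul d.inner_splits d.inner_leadingCoeff (by rw [natDegree_inner]; exact hkl)

theorem inner_pos {k : ℕ} (hkl : k ≤ l) : 0 < (derivative^[k] d.inner).eval 1 :=
  eval_iterate_derivative_prod_pos d.inner_lt hkl

theorem rootsLE_tail_one {k : ℕ} (hk : k ≤ l + 1) : RootsLE k d.tail 1 :=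
  rootsLE_of_roots_le d.tail_splits d.tail_leadingCoeff (fun r hr => by
    rw [tail, roots_prod _ _ (monic_prod_X_sub_C' _ _).ne_zero] at hr
    simp only [roots_X_sub_C, Multiset.bind_singleton] at hr
    obtain ⟨i, -, rfl⟩ := Multiset.mem_map.1 hr
    exact (d.mem _).2) (by rwa [natDegree_tail])

theorem top_lt_one {k : ℕ} (hk : 1 ≤ k) (hkl : k ≤ l) {y : ℝ}
    (hy0 : (derivative^[k] d.tail).eval y = 0) (hy : RootsLE k d.tail y) : y < 1 := by
  have h1 : 0 < (derivative^[k] d.tail).eval 1 := by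
    rw [tail_eq, eval_iterate_derivative_X_sub_C_mul _ _ hk, sub_self, zero_mul, zero_add]
    have := d.inner_pos (k := k - 1) (by omega)
    have : (0 : ℝ) < k := by exact_mod_cast hk
    positivity
  have hle := d.rootsLE_tail_one (k := k) (by omega)
  rcases lt_trichotomy y 1 with h | rfl | h
  · exact h
  · exact absurd hy0 h1.ne'
  · exact absurd hy0 (hle y h).ne'

theorem eval_iterate_derivative {k : ℕ} (hk : 1 ≤ k) (x : ℝ) :
    (derivative^[k] Z).eval x = K * ((β - 1) * (derivative^[k - 1] d.inner).eval x -
      (derivative^[k - 1] d.tail).eval x) := by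
  obtain ⟨j, rfl⟩ := Nat.exists_eq_add_of_le' hk
  have : derivative Z = C K * (C (β - 1) * d.inner - d.tail) := by
    rw [d.derivative_eq, d.tail_eq]; simp only [C_neg, C_sub, C_1]; ring
  rw [Function.iterate_succ_apply, this, iterate_derivative_C_mul, iterate_map_sub,
    iterate_derivative_C_mul]
  simp

theorem beta_eq {k : ℕ} (hk : 1 ≤ k) (h1 : derivAt Z (k + 1) 1 = 0) :
    (β - 1) * (derivative^[k] d.inner).eval 1 = k * (derivative^[k - 1] d.inner).eval 1 := by
  have h := d.eval_iterate_derivative (k := k + 1) (by omega) 1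
  rw [derivAt] at h1
  rw [h1, Nat.add_sub_cancel, tail_eq, eval_iterate_derivative_X_sub_C_mul _ _ hk, sub_self,
    zero_mul, zero_add] at h
  have := (mul_eq_zero.1 h.symm).resolve_left d.pos.ne'
  linarith

/-- Up to the factor K, Z^(k+1) is (β - x) `inner^(k)` - k `inner^(k-1)`. The quotient
`inner^(k-1)`/`inner^(k)` increases on (y,1], and k times its value at 1 is β - 1 by `beta_eq`. -/
theorem deriv_nonneg {k : ℕ} (hk : 1 ≤ k) (hkl : k ≤ l) (h1 : derivAt Z (k + 1) 1 = 0) {y x : ℝ}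
    (hy : RootsLE k d.tail y) (hyx : y < x) (hx : x ≤ 1) :
    0 ≤ (derivative^[k + 1] Z).eval x := by
  have hin := d.rootsLE_inner hkl hy
  have e1 : derivative (derivative^[k - 1] d.inner) = derivative^[k] d.inner := by
    rw [← Function.iterate_succ_apply' derivative, Nat.succ_eq_add_one, Nat.sub_add_cancel hk]
  have hmono := monotoneOn_div_derivative (splits_iterate_derivative d.inner_splits (k - 1))
    (y := y) (fun z hz => by rw [e1]; exact hin z hz)
  rw [e1] at hmono
  have h2 := hmono (mem_Ioi.2 hyx) (mem_Ioi.2 (hyx.trans_le hx)) hx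
  have hx0 := hin x hyx
  have h10 := d.inner_pos hkl
  have hb := d.beta_eq hk h1
  have hk0 : (0 : ℝ) < k := by exact_mod_cast hk
  have h3 : (k : ℝ) * ((derivative^[k - 1] d.inner).eval 1 / (derivative^[k] d.inner).eval 1) =
      β - 1 := by
    field_simp
    linarith
  have h4 : (k : ℝ) * (derivative^[k - 1] d.inner).eval x ≤
      (β - 1) * (derivative^[k] d.inner).eval x := by
    rw [← h3, mul_assoc]
    refine mul_le_mul_of_nonneg_left ?_ hk0.le
    rwa [div_le_iff₀ hx0] at h2
  rw [d.eval_iterate_derivative (by omega), Nat.add_sub_cancel, tail_eq,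
    eval_iterate_derivative_X_sub_C_mul _ _ hk]
  refine mul_nonneg d.pos.le ?_
  nlinarith [mul_nonneg (sub_nonneg.2 hx) hx0.le]

theorem monotoneOn {k : ℕ} (hk : 1 ≤ k) (hkl : k ≤ l) (h1 : derivAt Z (k + 1) 1 = 0) {y : ℝ}
    (hy : RootsLE k d.tail y) : MonotoneOn (fun x => (derivative^[k] Z).eval x) (Icc y 1) := by
  refine monotoneOn_of_deriv_nonneg (convex_Icc y 1) (Polynomial.continuous _).continuousOn
    (Polynomial.differentiable _).differentiableOn fun x hx => ?_
  rw [interior_Icc] at hx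
  rw [Polynomial.deriv, ← Function.iterate_succ_apply' derivative]
  exact d.deriv_nonneg hk hkl h1 hy hx.1 hx.2.le

/-- The comparison principle with P = Z and q = `tail`. From y on, `tail^(k+1)` is positive, and the
term `tail^(k)` Z^(k+1) has the favourable sign; at y itself it is 0. -/
theorem jet_le (hd : Z.natDegree ≤ l + 2) (hc : Z.coeff (l + 2) = θ / ((l + 2)! : ℝ)) {k : ℕ}
    (hk : 1 ≤ k) (hkl : k ≤ l) (h1 : derivAt Z (k + 1) 1 = 0) {y x : ℝ}
    (hy0 : (derivative^[k] d.tail).eval y = 0)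
    (hy : RootsLE k d.tail y) (hyx : y ≤ x) (hx : x ∈ I) {F : ℕ → ℝ → ℝ}
    (hF : IsSobolevJet (l + 1) |θ| F) (hF1 : F (k + 1) x = 0) :
    F k x ≤ (derivative^[k] Z).eval x := by
  have h := IsJet.comparison hk (by omega) d.strictMono d.mem hd (fun i => (d.eval i).ge)
    (σ := |θ|) (by rw [hc, abs_of_neg d.theta_neg, mul_div_cancel₀ _ (by positivity), neg_neg])
    hF.isJet hF.abs_le_one hF.lipschitz hx (q := d.tail) rfl
  have hpos := eval_iterate_derivative_pos_of_rootsLE d.tail_splits d.tail_nodup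
    d.tail_leadingCoeff (by rw [natDegree_tail]; omega) hy hyx
  rw [hF1, mul_zero, sub_zero] at h
  refine le_of_mul_le_mul_left (h.trans ?_) hpos
  rcases hyx.eq_or_lt with rfl | hlt
  · rw [hy0]; simp
  · have := mul_nonneg (hy x hlt).le (d.deriv_nonneg hk hkl h1 hy hlt hx.2)
    linarith

end ZolotarevData

end LandauKolmogorov

namespace LandauKolmogorov

/-! ### Chebyshev polynomials -/

theorem eq_C_mul_prod_of_roots {M : ℕ} {τ : Fin M → ℝ} (hτ : Function.Injective τ) {p : ℝ[X]}
    (hd : p.natDegree ≤ M) (h : ∀ i, p.eval (τ i) = 0) :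
    p = C (p.coeff M) * ∏ i, (X - C (τ i)) := by
  have hm := monic_prod_X_sub_C' Finset.univ τ
  have hmd : (∏ i, (X - C (τ i))).natDegree = M := by rw [natDegree_prod_X_sub_C]; simp
  obtain ⟨c, hc⟩ := dvd_of_roots hτ h
  rcases eq_or_ne c 0 with rfl | hc0
  · simp [hc]
  have hcd : c.natDegree = 0 := by
    rw [hc, hm.natDegree_mul' hc0, hmd] at hd
    omega
  have h1 := hm.coeff_natDegree
  rw [hmd] at h1
  rw [eq_C_of_natDegree_eq_zero hcd] at hc
  rw [hc, coeff_mul_C, h1, one_mul, mul_comm]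

/-- The extremal points of the Chebyshev polynomial of degree `n`, in increasing order. -/
noncomputable def chebNode (n i : ℕ) : ℝ := -Real.cos (i * Real.pi / n)

theorem chebNode_mem (n i : ℕ) : chebNode n i ∈ I :=
  ⟨neg_le_neg (Real.cos_le_one _), by rw [chebNode]; linarith [Real.neg_one_le_cos (i * Real.pi / n)]⟩

theorem chebNode_lt {n i j : ℕ} (hij : i < j) (hj : j ≤ n) : chebNode n i < chebNode n j := by
  have hn : (0 : ℝ) < n := by exact_mod_cast (by omega : 0 < n)
  refine neg_lt_neg (Real.cos_lt_cos_of_nonneg_of_le_pi (by positivity) ?_ ?_)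
  · rw [div_le_iff₀ hn, mul_comm]
    gcongr
  · gcongr

theorem chebNode_zero (n : ℕ) : chebNode n 0 = -1 := by simp [chebNode]

theorem chebNode_self {n : ℕ} (hn : n ≠ 0) : chebNode n n = 1 := by
  have : (n : ℝ) ≠ 0 := by exact_mod_cast hn
  rw [chebNode, mul_div_cancel_left₀ _ this, Real.cos_pi, neg_neg]

theorem eval_T_chebNode {n i : ℕ} (hn : n ≠ 0) (hi : i ≤ n) :
    (Chebyshev.T ℝ (n : ℤ)).eval (chebNode n i) = (-1) ^ (n - i) := by
  have h0 : (n : ℝ) ≠ 0 := by exact_mod_cast hn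
  rw [chebNode, ← Real.cos_pi_sub, Chebyshev.T_real_cos]
  have : ((n : ℤ) : ℝ) * (Real.pi - i * Real.pi / n) = ((n - i : ℕ) : ℝ) * Real.pi := by
    rw [Nat.cast_sub hi]; push_cast; field_simp
  rw [this, Real.cos_nat_mul_pi]

theorem natDegree_T (n : ℕ) : (Chebyshev.T ℝ (n : ℤ)).natDegree = n := by
  rw [Chebyshev.natDegree_T]; simp

theorem coeff_T (n : ℕ) : (Chebyshev.T ℝ (n : ℤ)).coeff n = 2 ^ (n - 1) := by
  have := Chebyshev.leadingCoeff_T ℝ (n : ℤ)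
  rw [leadingCoeff, natDegree_T] at this
  simpa using this

theorem abs_eval_T_le_one (n : ℕ) (x : ℝ) (hx : x ∈ I) : |(Chebyshev.T ℝ (n : ℤ)).eval x| ≤ 1 :=
  Chebyshev.abs_eval_T_real_le_one _ (abs_le.2 hx)

/-- The monic polynomial vanishing at the interior extremal points. -/
noncomputable def critPoly (l : ℕ) : ℝ[X] := ∏ i : Fin (l + 1), (X - C (chebNode (l + 2) (i + 1)))

theorem chebNode_injective (l : ℕ) :
    Function.Injective fun i : Fin (l + 1) => chebNode (l + 2) (i + 1) := by
  have : StrictMono fun i : Fin (l + 1) => chebNode (l + 2) (i + 1) := fun i j hij =>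
    chebNode_lt (by simpa using hij) (by omega)
  exact this.injective

theorem derivative_T_chebNode {n i : ℕ} (hi : 0 < i) (hin : i < n) :
    (derivative (Chebyshev.T ℝ (n : ℤ))).eval (chebNode n i) = 0 := by
  refine derivative_eq_zero_of_extremal (abs_eval_T_le_one n) (s := (-1) ^ (n - i)) ⟨?_, ?_⟩
    (by simp) ?_
  · rw [← chebNode_zero n]; exact chebNode_lt hi hin.le
  · rw [← chebNode_self (by omega : n ≠ 0)]; exact chebNode_lt hin le_rfl
  · rw [eval_T_chebNode (by omega) hin.le, ← pow_add, Even.neg_one_pow ⟨_, rfl⟩]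

theorem derivative_T_eq (l : ℕ) : derivative (Chebyshev.T ℝ ((l + 2 : ℕ) : ℤ)) =
    C (((l : ℝ) + 2) * 2 ^ (l + 1)) * critPoly l := by
  have h := eq_C_mul_prod_of_roots (chebNode_injective l)
    (p := derivative (Chebyshev.T ℝ ((l + 2 : ℕ) : ℤ)))
    ((natDegree_derivative_le _).trans (by rw [natDegree_T]; omega))
    (fun i => derivative_T_chebNode (by omega) (by omega))
  rw [h, coeff_derivative, coeff_T, critPoly]
  congr 2
  push_cast
  ring_nf

theorem iterate_derivative_comp_linear (p : ℝ[X]) (a b : ℝ) (k : ℕ) :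
    derivative^[k] (p.comp (C a * X + C b)) = C (a ^ k) * (derivative^[k] p).comp (C a * X + C b) := by
  induction k with
  | zero => simp
  | succ k ih =>
    rw [Function.iterate_succ_apply', ih, derivative_C_mul, derivative_comp,
      Function.iterate_succ_apply' _ k]
    simp only [derivative_add, derivative_mul, derivative_C, derivative_X, zero_mul, zero_add,
      mul_one, add_zero, pow_succ, C_mul]
    ring

theorem eval_iterate_derivative_comp_linear (p : ℝ[X]) (a b : ℝ) (k : ℕ) (x : ℝ) :
    (derivative^[k] (p.comp (C a * X + C b))).eval x =
      a ^ k * (derivative^[k] p).eval (a * x + b) := by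
  rw [iterate_derivative_comp_linear]; simp

theorem natDegree_comp_linear_le (p : ℝ[X]) (a b : ℝ) :
    (p.comp (C a * X + C b)).natDegree ≤ p.natDegree := by
  refine natDegree_comp_le.trans ?_
  calc _ ≤ p.natDegree * 1 := Nat.mul_le_mul_left _ natDegree_linear_le
    _ = _ := mul_one _

theorem coeff_comp_linear {p : ℝ[X]} {n : ℕ} (hp : p.natDegree ≤ n) (a b : ℝ) :
    (p.comp (C a * X + C b)).coeff n = p.coeff n * a ^ n := by
  have h1 := eval_iterate_derivative_comp_linear p a b n 0
  have h2 : ∀ q : ℝ[X], q.natDegree ≤ n → ∀ x, (derivative^[n] q).eval x = (n ! : ℝ) * q.coeff n := by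
    intro q hq x
    have hd : (derivative^[n] q).natDegree = 0 := by
      rw [natDegree_iterate_derivative_eq]; omega
    rw [eq_C_of_natDegree_eq_zero hd, eval_C, coeff_iterate_derivative, zero_add,
      Nat.descFactorial_self, nsmul_eq_mul]
  rw [h2 _ ((natDegree_comp_linear_le p a b).trans hp), h2 _ hp] at h1
  have : (n ! : ℝ) ≠ 0 := by positivity
  exact mul_left_cancel₀ this (by rw [h1]; ring)

theorem prod_dilate {ι : Type*} (s : Finset ι) (e : ι → ℝ) {A : ℝ} (hA : A ≠ 0) :
    ∏ i ∈ s, (X - C (-1 + A * (1 + e i))) =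
      C (A ^ s.card) * (∏ i ∈ s, (X - C (e i))).comp (C A⁻¹ * X + C (A⁻¹ - 1)) := by
  rw [prod_comp, C_pow, ← Finset.prod_const, ← Finset.prod_mul_distrib]
  refine Finset.prod_congr rfl fun i _ => ?_
  have : (C A : ℝ[X]) * C A⁻¹ = 1 := by rw [← C_mul, mul_inv_cancel₀ hA, C_1]
  simp only [sub_comp, X_comp, C_comp, C_sub, C_add, C_mul, C_1, C_neg]
  linear_combination (-X - 1) * this

theorem RootsLE.dilate {ι : Type*} {s : Finset ι} {e : ι → ℝ} {A x : ℝ} (hA : 0 < A) {k : ℕ}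
    (h : RootsLE k (∏ i ∈ s, (X - C (e i))) x) :
    RootsLE k (∏ i ∈ s, (X - C (-1 + A * (1 + e i)))) (-1 + A * (1 + x)) := by
  intro z hz
  rw [prod_dilate s e hA.ne', iterate_derivative_C_mul, eval_mul, eval_C,
    eval_iterate_derivative_comp_linear]
  have h1 := h (A⁻¹ * z + (A⁻¹ - 1)) (by
    have : A⁻¹ * (-1 + A * (1 + x)) < A⁻¹ * z := by gcongr
    rw [mul_add, ← mul_assoc, inv_mul_cancel₀ hA.ne'] at this
    linarith)
  positivity

theorem critPoly_splits (l : ℕ) : (critPoly l).Splits := splits_prod_X_sub_C _ _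

theorem critPoly_monic (l : ℕ) : (critPoly l).Monic := monic_prod_X_sub_C' _ _

theorem critPoly_leadingCoeff (l : ℕ) : 0 < (critPoly l).leadingCoeff := by
  rw [(critPoly_monic l).leadingCoeff]; exact one_pos

theorem natDegree_critPoly (l : ℕ) : (critPoly l).natDegree = l + 1 := by
  rw [critPoly, natDegree_prod_X_sub_C]; simp

theorem critPoly_nodup (l : ℕ) : (critPoly l).roots.Nodup :=
  nodup_roots_prod_X_sub_C (chebNode_injective l)

theorem eval_iterate_derivative_T (l k : ℕ) (x : ℝ) :
    (derivative^[k + 1] (Chebyshev.T ℝ ((l + 2 : ℕ) : ℤ))).eval x =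
      (l + 2) * 2 ^ (l + 1) * (derivative^[k] (critPoly l)).eval x := by
  rw [Function.iterate_succ_apply, derivative_T_eq, iterate_derivative_C_mul, eval_mul, eval_C]

theorem rootsLE_critPoly_of_isGreatest {l k : ℕ} (hkl : k ≤ l) {ω : ℝ}
    (hω : IsGreatest {x : ℝ | derivAt (Chebyshev.T ℝ ((l + 2 : ℕ) : ℤ)) (k + 1) x = 0} ω) :
    (derivative^[k] (critPoly l)).eval ω = 0 ∧ RootsLE k (critPoly l) ω := by
  have hc : (0 : ℝ) < (l + 2) * 2 ^ (l + 1) := by positivity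
  obtain ⟨y, hy0, hy⟩ := exists_max_root (splits_iterate_derivative (critPoly_splits l) k)
    (leadingCoeff_iterate_derivative_pos (critPoly_leadingCoeff l)
      (by rw [natDegree_critPoly]; omega))
    (by rw [natDegree_iterate_derivative_eq, natDegree_critPoly]; omega)
  have h1 : derivAt (Chebyshev.T ℝ ((l + 2 : ℕ) : ℤ)) (k + 1) ω = 0 := hω.1
  rw [derivAt, eval_iterate_derivative_T] at h1
  refine ⟨(mul_eq_zero.1 h1).resolve_left hc.ne', fun z hz => hy z (lt_of_le_of_lt ?_ hz)⟩
  exact hω.2 (show derivAt _ _ _ = 0 by rw [derivAt, eval_iterate_derivative_T, hy0, mul_zero])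

end LandauKolmogorov

/-! ### Zolotarev polynomials against Chebyshev polynomials: nodes and the size of θ -/

namespace LandauKolmogorov

theorem exists_eval_pos {p : ℝ[X]} {n : ℕ} (hn : 0 < n) (hd : p.natDegree ≤ n)
    (hc : 0 < p.coeff n) (b : ℝ) : ∃ x, b < x ∧ 0 < p.eval x := by
  have hd' : p.natDegree = n := le_antisymm hd (le_natDegree_of_ne_zero hc.ne')
  have h := tendsto_atTop_of_leadingCoeff_nonneg p
    (natDegree_pos_iff_degree_pos.1 (by omega)) (by rw [leadingCoeff, hd']; exact hc.le)
  exact ((Filter.eventually_gt_atTop b).and (h.eventually_gt_atTop 0)).exists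

namespace ZolotarevData

variable {l : ℕ} {θ : ℝ} {Z : ℝ[X]} {τ : Fin (l + 2) → ℝ} {K β : ℝ}

/-- If the node τ i lay to the right of the extremal point of T_(l+1) with the same index, the
difference T_(l+1) - Z would have more alternating signs than its degree l + 2 allows. -/
theorem le_chebNode (d : ZolotarevData l θ Z τ K β) (hd : Z.natDegree ≤ l + 2)
    (hc : Z.coeff (l + 2) = θ / ((l + 2)! : ℝ)) (hb : ∀ x ∈ I, |Z.eval x| ≤ 1) (i : Fin (l + 2)) :
    τ i ≤ chebNode (l + 1) i := by
  by_contra! hlt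
  set D := Chebyshev.T ℝ ((l + 1 : ℕ) : ℤ) - Z with hD
  have hTd := natDegree_T (l + 1)
  have hDd : D.natDegree ≤ l + 2 := (natDegree_sub_le _ _).trans (max_le (by omega) hd)
  have hDc : 0 < D.coeff (l + 2) := by
    rw [hD, coeff_sub, coeff_eq_zero_of_natDegree_lt (by omega), hc, zero_sub, ← neg_div]
    exact div_pos (neg_pos.2 d.theta_neg) (by positivity)
  obtain ⟨M, hM1, hM⟩ := exists_eval_pos (by omega) hDd hDc 1
  -- The l + 4 alternation points: extremal points of T_(l+1) up to index i, nodes of Z from index i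
  -- on, and a point M far to the right where the positive leading coefficient decides the sign.
  set t : ℕ → ℝ := fun j => if j ≤ i.val then chebNode (l + 1) j else
    if h : j - 1 < l + 2 then τ ⟨j - 1, h⟩ else M with ht
  have ht1 : ∀ j ≤ i.val, t j = chebNode (l + 1) j := fun j hj => if_pos hj
  have ht2 : ∀ j, i.val ≤ j → ∀ h : j < l + 2, t (j + 1) = τ ⟨j, h⟩ := fun j hj h => by
    simp only [ht]
    rw [if_neg (by omega), dif_pos (by simpa using h)]
    simp
  have ht3 : t (l + 3) = M := by
    simp only [ht]
    rw [if_neg (by omega), dif_neg (by omega)]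
  have h0 : D = 0 := by
    refine eq_zero_of_alternation hDd (t := t) (fun j hj => ?_) fun j hj => ?_
    · rcases lt_trichotomy j i.val with h | h | h
      · rw [ht1 j h.le, ht1 (j + 1) h]
        exact chebNode_lt (Nat.lt_succ_self j) (by omega)
      · subst h
        rw [ht1 _ le_rfl, ht2 _ le_rfl i.isLt]
        exact hlt
      · obtain ⟨j, rfl⟩ := Nat.exists_eq_add_of_le' (by omega : 1 ≤ j)
        rw [ht2 j (by omega) (by omega)]
        rcases (by omega : j + 1 < l + 2 ∨ j = l + 1) with h' | rfl
        · rw [ht2 (j + 1) (by omega) h']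
          exact d.strictMono (Fin.mk_lt_mk.2 (Nat.lt_succ_self j))
        · rw [ht3]
          exact (d.mem _).2.trans_lt hM1
    · rcases le_or_gt j i.val with h | h
      · have h1 := eval_T_chebNode (n := l + 1) (i := j) (by omega) (by omega)
        have h2 := abs_le.1 (hb _ (chebNode_mem (l + 1) j))
        rw [ht1 j h, hD, eval_sub, h1, show l + 2 + 1 - j = (l + 1 - j) + 2 by omega, pow_add]
        rcases neg_one_pow_eq_or ℝ (l + 1 - j) with h3 | h3 <;> rw [h3] <;> norm_num <;> linarith
      · obtain ⟨j, rfl⟩ := Nat.exists_eq_add_of_le' (by omega : 1 ≤ j)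
        rcases (by omega : j < l + 2 ∨ j = l + 2) with h' | rfl
        · have h1 := d.eval ⟨j, h'⟩
          have h2 := abs_le.1 (abs_eval_T_le_one (l + 1) _ (d.mem ⟨j, h'⟩))
          rw [ht2 j (by omega) h', hD, eval_sub,
            show l + 2 + 1 - (j + 1) = (l + 1 - j) + 1 by omega, pow_add]
          rcases neg_one_pow_eq_or ℝ (l + 1 - j) with h3 | h3 <;>
            simp only [h3, pow_one, one_mul, neg_mul, neg_neg, mul_neg, mul_one] at h1 ⊢ <;> linarith
        · rw [ht3]
          simpa using hM.le
  rw [h0] at hDc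
  simp at hDc

/-- The right side is the n-th derivative of T_n stretched so that its last interior extremal point
lands at 1. For a larger |θ|, the difference of -Z and this polynomial would have a positive leading
coefficient and too many sign changes. -/
theorem abs_theta_le (d : ZolotarevData l θ Z τ K β) (hd : Z.natDegree ≤ l + 2)
    (hc : Z.coeff (l + 2) = θ / ((l + 2)! : ℝ)) (hb : ∀ x ∈ I, |Z.eval x| ≤ 1) {a : ℝ}
    (ha : a = (1 + chebNode (l + 2) (l + 1)) / 2) :
    |θ| ≤ a ^ (l + 2) * 2 ^ (l + 1) * ((l + 2)! : ℝ) := by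
  have ha0 : 0 < a := by
    have h1 := chebNode_lt (n := l + 2) (i := 0) (j := l + 1) (by omega) (by omega)
    rw [chebNode_zero] at h1
    rw [ha]; linarith
  by_contra! hlt
  set T := Chebyshev.T ℝ ((l + 2 : ℕ) : ℤ) with hT
  set D := -Z - T.comp (C a * X + C (a - 1)) with hD
  have hTd : T.natDegree = l + 2 := natDegree_T (l + 2)
  have hDd : D.natDegree ≤ l + 2 := (natDegree_sub_le _ _).trans
    (max_le (by rwa [natDegree_neg]) ((natDegree_comp_linear_le _ _ _).trans hTd.le))
  have hDc : 0 < D.coeff (l + 2) := by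
    rw [hD, coeff_sub, coeff_neg, coeff_comp_linear hTd.le, hT, coeff_T, hc, ← neg_div,
      ← abs_of_neg d.theta_neg, sub_pos, lt_div_iff₀ (by positivity)]
    calc _ = a ^ (l + 2) * 2 ^ (l + 1) * ((l + 2)! : ℝ) := by
          rw [show l + 2 - 1 = l + 1 by omega]; ring
      _ < _ := hlt
  set s : ℕ → ℝ := fun i => -1 + (1 + chebNode (l + 2) i) / a with hs
  have hsT : ∀ i, (T.comp (C a * X + C (a - 1))).eval (s i) = T.eval (chebNode (l + 2) i) := by
    intro i
    simp only [eval_comp, eval_add, eval_mul, eval_C, eval_X, hs]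
    congr 1
    field_simp
    ring
  have hslt : ∀ i j, i < j → j ≤ l + 2 → s i < s j := fun i j hij hj => by
    have := chebNode_lt hij hj
    simp only [hs]
    gcongr
  have hslast : s (l + 1) = 1 := by
    have : 1 + chebNode (l + 2) (l + 1) = 2 * a := by rw [ha]; ring
    simp only [hs]
    rw [this, mul_div_cancel_right₀ _ ha0.ne']
    norm_num
  have hs0 : ∀ i, -1 ≤ s i := fun i => by
    have := (chebNode_mem (l + 2) i).1
    have : 0 ≤ (1 + chebNode (l + 2) i) / a := div_nonneg (by linarith) ha0.le
    simp only [hs]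
    linarith
  have hD1 : D.eval 1 = 0 := by
    have h1 := d.eval (Fin.last (l + 1))
    rw [d.last] at h1
    have h2 := hsT (l + 1)
    rw [hslast] at h2
    rw [hD, eval_sub, h2, hT, eval_T_chebNode (by omega) (by omega), eval_neg,
      show l + 2 - (l + 1) = 1 by omega]
    simp at h1
    rw [h1]; norm_num
  have hD' : (derivative D).eval 1 < 0 := by
    have h1 : (derivative (T.comp (C a * X + C (a - 1)))).eval 1 = 0 := by
      have := eval_iterate_derivative_comp_linear T a (a - 1) 1 1
      simp only [Function.iterate_one] at this
      rw [this, show a * 1 + (a - 1) = chebNode (l + 2) (l + 1) by rw [ha]; ring, hT,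
        derivative_T_chebNode (by omega) (by omega), mul_zero]
    have h2 : 0 < (derivative Z).eval 1 := by
      have h3 : 0 < d.inner.eval 1 := d.inner_pos (k := 0) (Nat.zero_le l)
      have h4 := d.pos
      have h5 := sub_pos.2 d.one_lt
      rw [d.derivative_eq]
      simp only [eval_mul, eval_C, eval_sub, eval_X]
      have : 0 < K * ((β - 1) * d.inner.eval 1) := by positivity
      linarith
    rw [hD, derivative_sub, derivative_neg, eval_sub, eval_neg, h1]
    linarith
  obtain ⟨U, hU, hl, hr⟩ := sign_near_of_hasDerivAt (D.hasDerivAt 1) hD1 hD'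
  obtain ⟨ε, hε, hball⟩ := Metric.mem_nhds_iff.1 hU
  rw [Real.ball_eq_Ioo] at hball
  have hsl : s l < 1 := by rw [← hslast]; exact hslt _ _ (Nat.lt_succ_self l) (by omega)
  obtain ⟨δ, hδ0, hδε, hδs⟩ : ∃ δ, 0 < δ ∧ δ < ε ∧ s l < 1 - δ := by
    have hm := lt_min hε (sub_pos.2 hsl)
    exact ⟨min ε (1 - s l) / 2, by linarith, by linarith [min_le_left ε (1 - s l)],
      by linarith [min_le_right ε (1 - s l)]⟩
  have hleft := hl (1 - δ) (hball ⟨by linarith, by linarith⟩) (by linarith)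
  have hright := hr (1 + δ) (hball ⟨by linarith, by linarith⟩) (by linarith)
  obtain ⟨M, hM1, hM⟩ := exists_eval_pos (by omega) hDd hDc (1 + δ)
  -- At 1 the difference D vanishes with D'(1) < 0, since Z'(1) > 0 and the stretched T_n has a
  -- critical point there. So 1 is replaced by two points 1 - δ and 1 + δ of opposite signs, which
  -- supplies the extra alternation.
  set t : ℕ → ℝ := fun j => if j ≤ l then s j else if j = l + 1 then 1 - δ else
    if j = l + 2 then 1 + δ else M with ht
  have ht1 : ∀ j ≤ l, t j = s j := fun j hj => if_pos hj
  have ht2 : t (l + 1) = 1 - δ := by simp [ht]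
  have ht3 : t (l + 2) = 1 + δ := by simp [ht]
  have ht4 : t (l + 3) = M := by simp [ht]
  have h0 : D = 0 := by
    refine eq_zero_of_alternation hDd (t := t) (fun j hj => ?_) fun j hj => ?_
    · rcases (by omega : j < l ∨ j = l ∨ j = l + 1 ∨ j = l + 2) with h | rfl | rfl | rfl
      · rw [ht1 j h.le, ht1 (j + 1) h]
        exact hslt _ _ (Nat.lt_succ_self j) (by omega)
      · rw [ht1 _ le_rfl, ht2]; exact hδs
      · rw [ht2, ht3]; linarith
      · rw [ht3, ht4]; exact hM1
    · rcases (by omega : j ≤ l ∨ j = l + 1 ∨ j = l + 2 ∨ j = l + 3) with h | rfl | rfl | rfl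
      · have h2 := abs_le.1 (hb (s j) ⟨hs0 j, by
          rw [← hslast]; exact (hslt _ _ (by omega) (by omega)).le⟩)
        rw [ht1 j h, hD, eval_sub, eval_neg, hsT, hT, eval_T_chebNode (by omega) (by omega),
          show l + 2 + 1 - j = (l + 2 - j) + 1 by omega, pow_add]
        rcases neg_one_pow_eq_or ℝ (l + 2 - j) with h3 | h3 <;> rw [h3] <;> norm_num <;> linarith
      · rw [ht2, show l + 2 + 1 - (l + 1) = 2 by omega]
        simpa using hleft.le
      · rw [ht3, show l + 2 + 1 - (l + 2) = 1 by omega]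
        simp [hright.le]
      · rw [ht4]
        simpa using hM.le
  rw [h0] at hDc
  simp at hDc

end ZolotarevData

end LandauKolmogorov

namespace LandauKolmogorov

/-! ### Comparison with dilated Chebyshev polynomials, and localization of the roots -/

/-- Comparison with the negative of T_n dilated about -1 by A. The condition aA ≤ 1 keeps the first
n extremal points inside [-1,1] and makes the n-th derivative large enough. Since ω goes to x, a
zero of q^(k), the terms with F^(k+1) and P^(k+1) drop out; the factor A^(-k) ≤ 1 is discarded. -/
theorem jet_le_T {l k : ℕ} (hk : 1 ≤ k) (hkl : k ≤ l) {ω : ℝ}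
    (hω0 : (derivative^[k] (critPoly l)).eval ω = 0) (hω : RootsLE k (critPoly l) ω) {a : ℝ}
    (ha : a = (1 + chebNode (l + 2) (l + 1)) / 2) {A : ℝ} (hA : 1 ≤ A) (haA : a * A ≤ 1) {σ : ℝ}
    (hσ : σ ≤ a ^ (l + 2) * 2 ^ (l + 1) * ((l + 2)! : ℝ)) {x : ℝ} (hx : x ∈ I)
    (hxA : x = -1 + A * (1 + ω)) {F : ℕ → ℝ → ℝ} (hF : IsSobolevJet (l + 1) σ F) :
    F k x ≤ |(derivative^[k] (Chebyshev.T ℝ ((l + 2 : ℕ) : ℤ))).eval ω| := by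
  have hA0 : 0 < A := by linarith
  have ha0 : 0 < a := by
    have h1 := chebNode_lt (n := l + 2) (i := 0) (j := l + 1) (by omega) (by omega)
    rw [chebNode_zero] at h1
    rw [ha]; linarith
  set T := Chebyshev.T ℝ ((l + 2 : ℕ) : ℤ) with hT
  have hTd : T.natDegree = l + 2 := natDegree_T (l + 2)
  set P := -T.comp (C A⁻¹ * X + C (A⁻¹ - 1)) with hP
  set τ : Fin (l + 2) → ℝ := fun i => -1 + A * (1 + chebNode (l + 2) i) with hτ
  have hmono : StrictMono τ := fun i j hij => by
    have := chebNode_lt (n := l + 2) hij (by omega)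
    simp only [hτ]
    gcongr
  have hmem : ∀ i, τ i ∈ I := fun i => by
    have h1 := (chebNode_mem (l + 2) i).1
    have h2 := mul_nonneg hA0.le (by linarith : 0 ≤ 1 + chebNode (l + 2) i)
    have h3 := hmono.monotone (Fin.le_last i)
    simp only [hτ, Fin.val_last] at h3 ⊢
    have h4 : chebNode (l + 2) (l + 1) = 2 * a - 1 := by rw [ha]; ring
    rw [h4] at h3
    constructor <;> linarith
  have hlin : ∀ w : ℝ, A⁻¹ * (-1 + A * (1 + w)) + (A⁻¹ - 1) = w := fun w => by
    field_simp
    ring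
  have hPj : ∀ j, (derivative^[j] P).eval x = -((A⁻¹) ^ j * (derivative^[j] T).eval ω) := fun j => by
    rw [hP, iterate_map_neg, eval_neg, eval_iterate_derivative_comp_linear, hxA, hlin]
  have hPc : P.coeff (l + 2) = -(2 ^ (l + 1) * (A⁻¹) ^ (l + 2)) := by
    rw [hP, coeff_neg, coeff_comp_linear hTd.le, hT, coeff_T]
    rfl
  have haA' : a ≤ A⁻¹ := by
    rw [← one_div, le_div_iff₀ hA0]; exact haA
  set q := ∏ i : Fin (l + 1), (X - C (τ i.succ)) with hq
  have hqE : q = C (A ^ (l + 1)) * (critPoly l).comp (C A⁻¹ * X + C (A⁻¹ - 1)) := by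
    have := prod_dilate Finset.univ (fun i : Fin (l + 1) => chebNode (l + 2) (i + 1)) hA0.ne'
    rw [Finset.card_univ, Fintype.card_fin] at this
    rw [critPoly, ← this, hq]
    rfl
  have hqj : ∀ j, (derivative^[j] q).eval x =
      A ^ (l + 1) * ((A⁻¹) ^ j * (derivative^[j] (critPoly l)).eval ω) := fun j => by
    rw [hqE, iterate_derivative_C_mul, eval_mul, eval_C, eval_iterate_derivative_comp_linear, hxA,
      hlin]
  have h := IsJet.comparison hk (by omega) hmono hmem (P := P) (σ := σ)
    (by rw [hP, natDegree_neg]; exact (natDegree_comp_linear_le _ _ _).trans hTd.le)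
    (fun i => by
      have : P.eval (τ i) = -(-1) ^ (l + 2 - i.val) := by
        rw [hP, eval_neg, eval_comp, ← eval_T_chebNode (by omega) (by omega)]
        simp only [eval_add, eval_mul, eval_C, eval_X, hτ]
        rw [hlin]
      rw [this, show l + 2 - i.val = (l + 1 - i.val) + 1 by omega, pow_succ]
      rcases neg_one_pow_eq_or ℝ (l + 1 - i.val) with h3 | h3 <;> rw [h3] <;> norm_num)
    (by
      rw [hPc, mul_neg, neg_le_neg_iff]
      refine hσ.trans ?_
      have := pow_le_pow_left₀ ha0.le haA' (l + 2)
      calc _ ≤ (A⁻¹) ^ (l + 2) * 2 ^ (l + 1) * ((l + 2)! : ℝ) := by gcongr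
        _ = _ := by ring)
    hF.isJet hF.abs_le_one hF.lipschitz hx hq
  have hpos := eval_iterate_derivative_pos_of_rootsLE (critPoly_splits l) (critPoly_nodup l)
    (critPoly_leadingCoeff l) (by rw [natDegree_critPoly]; omega) hω le_rfl
  have hq1 : 0 < (derivative^[k + 1] q).eval x := by
    rw [hqj]; positivity
  have hq0 : (derivative^[k] q).eval x = 0 := by
    rw [hqj, hω0]; ring
  rw [hq0, zero_mul, sub_zero, zero_mul, sub_zero] at h
  refine (le_of_mul_le_mul_left h hq1).trans ?_
  rw [hPj]
  refine (neg_le_abs _).trans ?_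
  rw [abs_mul, abs_of_pos (by positivity : 0 < A⁻¹ ^ k)]
  exact mul_le_of_le_one_left (abs_nonneg _) (pow_le_one₀ (by positivity) (inv_le_one_of_one_le₀ hA))

/-- The quotient sin(ct)/sin t is nondecreasing on (0, π/2]: the numerator g of its derivative
vanishes at 0 and has derivative (1 - c^2) sin(ct) sin t. -/
theorem sin_mul_ratio_monotone {c x y : ℝ} (hc0 : 0 ≤ c) (hc1 : c ≤ 1) (hx : 0 < x) (hxy : x ≤ y)
    (hy : y ≤ Real.pi / 2) : Real.sin (c * x) * Real.sin y ≤ Real.sin (c * y) * Real.sin x := by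
  have hpi := Real.pi_pos
  set g : ℝ → ℝ := fun t => c * Real.cos (c * t) * Real.sin t - Real.sin (c * t) * Real.cos t
  have hc : ∀ t, HasDerivAt (fun t => c * t) c t := fun t => by
    simpa using (hasDerivAt_id t).const_mul c
  have hg : ∀ t, HasDerivAt g ((1 - c ^ 2) * (Real.sin (c * t) * Real.sin t)) t := fun t => by
    have h1 := (((hc t).cos.const_mul c).mul (Real.hasDerivAt_sin t)).sub
      ((hc t).sin.mul (Real.hasDerivAt_cos t))
    refine h1.congr_deriv ?_
    ring
  have hgm : MonotoneOn g (Icc 0 (Real.pi / 2)) := by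
    refine monotoneOn_of_deriv_nonneg (convex_Icc _ _)
      (fun t _ => (hg t).continuousAt.continuousWithinAt)
      (fun t _ => (hg t).differentiableAt.differentiableWithinAt) fun t ht => ?_
    rw [interior_Icc] at ht
    rw [(hg t).deriv]
    have h1 : 0 ≤ Real.sin (c * t) := Real.sin_nonneg_of_nonneg_of_le_pi
      (mul_nonneg hc0 ht.1.le) (by nlinarith [ht.1, ht.2])
    have h2 : 0 ≤ Real.sin t := Real.sin_nonneg_of_nonneg_of_le_pi ht.1.le (by linarith [ht.2])
    have h3 : 0 ≤ 1 - c ^ 2 := by nlinarith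
    positivity
  have hg0 : ∀ t ∈ Icc 0 (Real.pi / 2), 0 ≤ g t := fun t ht => by
    have := hgm (left_mem_Icc.2 (by linarith)) ht ht.1
    simpa [g] using this
  have hs : ∀ t ∈ Ioc 0 (Real.pi / 2), 0 < Real.sin t := fun t ht =>
    Real.sin_pos_of_pos_of_lt_pi ht.1 (by linarith [ht.2])
  have hd : ∀ t ∈ Ioc 0 (Real.pi / 2), HasDerivAt (fun t => Real.sin (c * t) / Real.sin t)
      (g t / Real.sin t ^ 2) t := fun t ht => by
    refine ((hc t).sin.div (Real.hasDerivAt_sin t) (hs t ht).ne').congr_deriv ?_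
    simp only [g]
    ring
  have hm : MonotoneOn (fun t => Real.sin (c * t) / Real.sin t) (Ioc 0 (Real.pi / 2)) := by
    refine monotoneOn_of_deriv_nonneg (convex_Ioc _ _)
      (fun t ht => (hd t ht).continuousAt.continuousWithinAt)
      (fun t ht => (hd t (interior_subset ht)).differentiableAt.differentiableWithinAt)
      fun t ht => ?_
    have ht' := interior_subset ht
    rw [(hd t ht').deriv]
    exact div_nonneg (hg0 t (Ioc_subset_Icc_self ht')) (sq_nonneg _)
  have h := hm ⟨hx, hxy.trans hy⟩ ⟨hx.trans_le hxy, hy⟩ hxy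
  simp only at h
  rwa [div_le_div_iff₀ (hs x ⟨hx, hxy.trans hy⟩) (hs y ⟨hx.trans_le hxy, hy⟩)] at h

theorem chebNode_reflect {n i : ℕ} (hn : n ≠ 0) (hi : i ≤ n) :
    chebNode n (n - i) = -chebNode n i := by
  have h0 : (n : ℝ) ≠ 0 := by exact_mod_cast hn
  have : ((n : ℝ) - i) * Real.pi / n = Real.pi - i * Real.pi / n := by field_simp
  rw [chebNode, chebNode, Nat.cast_sub hi, this, Real.cos_pi_sub]

theorem sum_chebNode (n : ℕ) : ∑ i ∈ Finset.range (n + 1), chebNode (n + 1) (i + 1) = 1 := by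
  have h1 : ∑ i ∈ Finset.range (n + 2), chebNode (n + 1) i = 0 := by
    have h2 := Finset.sum_range_reflect (chebNode (n + 1)) (n + 2)
    have h3 : ∑ j ∈ Finset.range (n + 2), chebNode (n + 1) (n + 2 - 1 - j) =
        -∑ i ∈ Finset.range (n + 2), chebNode (n + 1) i := by
      rw [← Finset.sum_neg_distrib]
      refine Finset.sum_congr rfl fun j hj => ?_
      rw [Finset.mem_range] at hj
      rw [show n + 2 - 1 - j = n + 1 - j by omega, chebNode_reflect (by omega) (by omega)]
    linarith
  rw [Finset.sum_range_succ', chebNode_zero] at h1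
  linarith

/-- By half angles, the two families of 1 + node are 2 sin^2 x and 2A sin^2(cx) at the same
arguments x. The monotone quotient of the sines lets them cross only once. -/
theorem chebNode_crossing {l i j : ℕ} (hi : i < l + 1) (hj : j < l + 1) {A : ℝ}
    (hA : A = ((l : ℝ) + 2) / (l + 1))
    (h1 : chebNode (l + 1) (i + 1) < -1 + A * (1 + chebNode (l + 2) (i + 1)))
    (h2 : -1 + A * (1 + chebNode (l + 2) (j + 1)) < chebNode (l + 1) (j + 1)) :
    chebNode (l + 1) (j + 1) ≤ chebNode (l + 1) (i + 1) := by
  rcases le_or_gt j i with hji | hij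
  · rcases hji.eq_or_lt with rfl | h
    · exact le_rfl
    · exact (chebNode_lt (by omega) (by omega)).le
  exfalso
  have hpi := Real.pi_pos
  set c : ℝ := ((l : ℝ) + 1) / (l + 2) with hc
  set x : ℕ → ℝ := fun i => ((i : ℝ) + 1) * Real.pi / (2 * (l + 1)) with hx
  have e1 : ∀ i : ℕ, 1 + chebNode (l + 1) (i + 1) = 2 * Real.sin (x i) ^ 2 := fun i => by
    have : ((i + 1 : ℕ) : ℝ) * Real.pi / ((l + 1 : ℕ) : ℝ) = 2 * x i := by
      simp only [hx]; push_cast; field_simp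
    rw [chebNode, this, Real.cos_two_mul, Real.cos_sq']
    ring
  have e2 : ∀ i : ℕ, 1 + chebNode (l + 2) (i + 1) = 2 * Real.sin (c * x i) ^ 2 := fun i => by
    have : ((i + 1 : ℕ) : ℝ) * Real.pi / ((l + 2 : ℕ) : ℝ) = 2 * (c * x i) := by
      simp only [hx, hc]; push_cast; field_simp
    rw [chebNode, this, Real.cos_two_mul, Real.cos_sq']
    ring
  have hx0 : 0 < x i := by positivity
  have hxij : x i ≤ x j := by
    simp only [hx]
    gcongr
  have hxj : x j ≤ Real.pi / 2 := by
    have : (j : ℝ) + 1 ≤ l + 1 := by exact_mod_cast hj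
    simp only [hx]
    rw [div_le_div_iff₀ (by positivity) (by norm_num)]
    nlinarith
  have hc1 : c ≤ 1 := by
    rw [hc, div_le_one (by positivity)]; linarith
  have hs := sin_mul_ratio_monotone (by positivity) hc1 hx0 hxij hxj
  have hsi : 0 < Real.sin (x i) := Real.sin_pos_of_pos_of_lt_pi hx0 (by linarith)
  have hsj : 0 < Real.sin (x j) := Real.sin_pos_of_pos_of_lt_pi (by linarith) (by linarith)
  have hsci : 0 ≤ Real.sin (c * x i) := Real.sin_nonneg_of_nonneg_of_le_pi (by positivity)
    (by nlinarith)
  have hA0 : 0 < A := by rw [hA]; positivity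
  have hsq := mul_self_le_mul_self (by positivity) hs
  have h1' : Real.sin (x i) ^ 2 < A * Real.sin (c * x i) ^ 2 := by
    have := e1 i; have := e2 i
    nlinarith
  have h2' : A * Real.sin (c * x j) ^ 2 < Real.sin (x j) ^ 2 := by
    have := e1 j; have := e2 j
    nlinarith
  have h3 := mul_lt_mul_of_pos_right h1' (by positivity : 0 < Real.sin (x j) ^ 2)
  have h4 := mul_lt_mul_of_pos_right h2' (by positivity : 0 < Real.sin (x i) ^ 2)
  have h5 := mul_le_mul_of_nonneg_left hsq hA0.le
  nlinarith

/-- Dilating the interior extremal points of T_n by n/(n-1) about -1 gives them the same sum as the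
extremal points of T_(n-1) other than -1, which they then majorize with one crossing. The nodes of Z
lie further left, and moving roots left moves the largest zeros of the derivatives left. -/
theorem ZolotarevData.rootsLE_tail {l : ℕ} {θ : ℝ} {Z : ℝ[X]} {τ : Fin (l + 2) → ℝ} {K β : ℝ}
    (d : ZolotarevData l θ Z τ K β) (hd : Z.natDegree ≤ l + 2)
    (hc : Z.coeff (l + 2) = θ / ((l + 2)! : ℝ)) (hb : ∀ x ∈ I, |Z.eval x| ≤ 1) {k : ℕ}
    (hkl : k ≤ l) {x : ℝ} (h : RootsLE k (critPoly l) x) :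
    RootsLE k d.tail (-1 + ((l : ℝ) + 2) / (l + 1) * (1 + x)) := by
  set A : ℝ := ((l : ℝ) + 2) / (l + 1) with hA
  have hA0 : 0 < A := by positivity
  have h1 := RootsLE.dilate hA0 h
  have h2 := RootsLE.of_crossing (β := fun i : Fin (l + 1) => chebNode (l + 1) (i + 1)) Finset.univ
    (by simpa using hkl) _ ?_ ?_ h1
  · refine h2.mono_of_le Finset.univ (by simpa using hkl) fun i _ => ?_
    simpa using d.le_chebNode hd hc hb i.succ
  · rw [Finset.sum_add_distrib, ← Finset.mul_sum, Finset.sum_add_distrib,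
      Fin.sum_univ_eq_sum_range (fun i => chebNode (l + 2) (i + 1)),
      Fin.sum_univ_eq_sum_range (fun i => chebNode (l + 1) (i + 1)), sum_chebNode]
    have h3 := sum_chebNode (l + 1)
    rw [Finset.sum_range_succ, chebNode_self (by omega)] at h3
    have h4 : ∑ i ∈ Finset.range (l + 1), chebNode (l + 2) (i + 1) = 0 := by linarith
    rw [h4, hA]
    simp only [Finset.sum_const, Finset.card_univ, Fintype.card_fin, nsmul_eq_mul]
    push_cast
    field_simp
    ring
  · exact fun i _ j _ g1 g2 => chebNode_crossing i.isLt j.isLt hA g1 g2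

end LandauKolmogorov

namespace LandauKolmogorov

/-! ### Growth of a real-rooted polynomial up to its largest critical point -/

/-- Replacing p and v by the single parameter p + v does not decrease the quotient of s plus the sum
of u/(1+u) by the product of the 1+u. The hypothesis on s makes the exact difference nonnegative. -/
theorem merge_step {p v s : ℝ} (hp : 0 ≤ p) (hv : 0 ≤ v) (hs : 1 ≤ s) (h : 2 ≤ s * (1 + p + v)) :
    (1 + p + v) * (s + p / (1 + p) + v / (1 + v)) ≤
      (1 + p) * (1 + v) * (s + (p + v) / (1 + (p + v))) := by
  have h1 : 0 < 1 + p := by linarith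
  have h2 : 0 < 1 + v := by linarith
  have h3 : 0 < 1 + (p + v) := by linarith
  have hw : 0 ≤ p * v := mul_nonneg hp hv
  have key : (1 + p) * (1 + v) * (s + (p + v) / (1 + (p + v))) -
      (1 + p + v) * (s + p / (1 + p) + v / (1 + v)) =
      p * v * ((1 + p + v) * (s * (1 + p + v) - 2) +
        p * v * ((1 + p + v) * (s - 1) + 2 * (p + v) + 1)) /
        ((1 + p) * (1 + v) * (1 + (p + v))) := by
    field_simp
    ring
  have : 0 ≤ p * v * ((1 + p + v) * (s * (1 + p + v) - 2) +
        p * v * ((1 + p + v) * (s - 1) + 2 * (p + v) + 1)) := by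
    refine mul_nonneg hw (add_nonneg (mul_nonneg (by linarith) (by linarith)) (mul_nonneg hw ?_))
    have := mul_nonneg (by linarith : 0 ≤ 1 + p + v) (sub_nonneg.2 hs)
    linarith
  have := div_nonneg this (by positivity : 0 ≤ (1 + p) * (1 + v) * (1 + (p + v)))
  linarith

/-- The elements are absorbed into the pivot p one at a time. Because p is at least every remaining
u, their sum of u/(1+u) is at least `M.sum`/(1+p); with total at least 1 this gives the hypothesis
of `merge_step`. -/
theorem merge_all (M : Multiset ℝ) : ∀ p : ℝ, 0 ≤ p → (∀ u ∈ M, 0 ≤ u ∧ u ≤ p) → 1 ≤ p + M.sum →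
    (1 + (p + M.sum)) * (1 + p / (1 + p) + (M.map fun u => u / (1 + u)).sum) ≤
      (1 + p) * (M.map fun u => 1 + u).prod * (1 + (p + M.sum) / (1 + (p + M.sum))) := by
  induction M using Multiset.induction_on with
  | empty => intro p hp _ _; simp
  | cons v M ih =>
    intro p hp hM hsum
    have hv := hM v (Multiset.mem_cons_self v M)
    have hM' : ∀ u ∈ M, 0 ≤ u ∧ u ≤ p := fun u hu => hM u (Multiset.mem_cons_of_mem hu)
    simp only [Multiset.sum_cons, Multiset.map_cons, Multiset.prod_cons] at hsum ⊢
    have h1 := ih (p + v) (by linarith) (fun u hu => ⟨(hM' u hu).1, by linarith [(hM' u hu).2]⟩)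
      (by linarith)
    rw [add_assoc p v] at h1
    have hS : M.sum / (1 + p) ≤ (M.map fun u => u / (1 + u)).sum := by
      rw [div_eq_mul_inv, mul_comm, ← smul_eq_mul, Multiset.smul_sum]
      refine Multiset.sum_map_le_sum_map _ _ fun u hu => ?_
      have := hM' u hu
      rw [smul_eq_mul, mul_comm, ← div_eq_mul_inv]
      exact div_le_div_of_nonneg_left this.1 (by linarith) (by linarith)
    have hM0 : 0 ≤ M.sum := Multiset.sum_nonneg fun u hu => (hM' u hu).1
    set S := (M.map fun u => u / (1 + u)).sum
    have hS0 : 0 ≤ S := le_trans (div_nonneg hM0 (by linarith)) hS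
    have hstep := merge_step (s := 1 + S) hp hv.1 (by linarith) (by
      rcases le_or_gt 1 (p + v) with h | h
      · nlinarith
      · rw [div_le_iff₀ (by linarith)] at hS
        have h5 : 1 - p - v ≤ S * (1 + p) := by linarith
        have h6 : 0 ≤ v * (1 - p - v) := mul_nonneg hv.1 (by linarith)
        have h7 : 2 * (1 + p) ≤ (1 + S) * (1 + p + v) * (1 + p) := by
          nlinarith [mul_le_mul_of_nonneg_right h5 (by linarith : 0 ≤ 1 + p + v)]
        exact le_of_mul_le_mul_right h7 (by linarith))
    have hP : 0 ≤ (M.map fun u => 1 + u).prod := Multiset.prod_nonneg fun w hw => by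
      obtain ⟨u, hu, rfl⟩ := Multiset.mem_map.1 hw
      linarith [(hM' u hu).1]
    set P := (M.map fun u => 1 + u).prod
    set U := p + (v + M.sum)
    have hU : 0 ≤ U := by simp only [U]; linarith
    have hpos : 0 < 1 + (p + v) := by linarith
    refine le_of_mul_le_mul_left ?_ hpos
    have h8 : (1 + (p + v)) * ((1 + U) * (1 + p / (1 + p) + (v / (1 + v) + S))) ≤
        (1 + U) * ((1 + p) * (1 + v) * (1 + S + (p + v) / (1 + (p + v)))) := by
      have := mul_le_mul_of_nonneg_left hstep (by linarith : 0 ≤ 1 + U)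
      calc _ = (1 + U) * ((1 + p + v) * (1 + S + p / (1 + p) + v / (1 + v))) := by ring
        _ ≤ _ := this
    refine h8.trans ?_
    have h9 := mul_le_mul_of_nonneg_left h1
      (mul_nonneg (by linarith) (by linarith [hv.1]) : 0 ≤ (1 + p) * (1 + v))
    calc _ = (1 + p) * (1 + v) * ((1 + U) * (1 + (p + v) / (1 + (p + v)) + S)) := by ring
      _ ≤ _ := h9
      _ = _ := by ring

/-- Merging everything into the largest element gives the quotient (1+2U)/(1+U)^2 with U the total.
This decreases in U, so U may be replaced by a lower bound V. -/
theorem sq_mul_le_prod (M : Multiset ℝ) (hM : ∀ u ∈ M, 0 ≤ u) {V : ℝ} (hV : 1 ≤ V)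
    (hVM : V ≤ M.sum) :
    (1 + V) ^ 2 * (1 + (M.map fun u => u / (1 + u)).sum) ≤
      (1 + 2 * V) * (M.map fun u => 1 + u).prod := by
  have hne : M.toFinset.Nonempty := by
    rw [Multiset.toFinset_nonempty]
    rintro rfl
    simp at hVM
    linarith
  obtain ⟨M', hM'⟩ := Multiset.exists_cons_of_mem (Multiset.mem_toFinset.1 (M.toFinset.max'_mem hne))
  set p := M.toFinset.max' hne
  have hp : p ∈ M := by rw [hM']; exact Multiset.mem_cons_self _ _
  have hsub : ∀ u ∈ M', u ∈ M := fun u hu => by rw [hM']; exact Multiset.mem_cons_of_mem hu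
  have h := merge_all M' p (hM p hp) (fun u hu => ⟨hM u (hsub u hu),
    M.toFinset.le_max' u (Multiset.mem_toFinset.2 (hsub u hu))⟩)
    (by rw [hM', Multiset.sum_cons] at hVM; linarith)
  have hS0 : 0 ≤ (M.map fun u => u / (1 + u)).sum := Multiset.sum_nonneg fun w hw => by
    obtain ⟨u, hu, rfl⟩ := Multiset.mem_map.1 hw
    have := hM u hu
    positivity
  have e1 : (M.map fun u => u / (1 + u)).sum =
      p / (1 + p) + (M'.map fun u => u / (1 + u)).sum := by rw [hM']; simp
  have e2 : (M.map fun u => 1 + u).prod = (1 + p) * (M'.map fun u => 1 + u).prod := by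
    rw [hM']; simp
  have e3 : M.sum = p + M'.sum := by rw [hM']; simp
  rw [add_assoc, ← e1, ← e2, ← e3] at h
  set U := M.sum
  set S := (M.map fun u => u / (1 + u)).sum
  set P := (M.map fun u => 1 + u).prod
  have hU : 0 < 1 + U := by linarith
  have h1 : (1 + U) ^ 2 * (1 + S) ≤ P * (1 + 2 * U) := by
    have := mul_le_mul_of_nonneg_left h hU.le
    calc _ = (1 + U) * ((1 + U) * (1 + S)) := by ring
      _ ≤ _ := this
      _ = _ := by field_simp; ring
  have h2 : (1 + V) ^ 2 * (1 + 2 * U) ≤ (1 + U) ^ 2 * (1 + 2 * V) := by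
    nlinarith [mul_nonneg (sub_nonneg.2 hVM) (by nlinarith : 0 ≤ U + V + 2 * U * V)]
  have hpos : 0 < (1 + U) ^ 2 := by positivity
  refine le_of_mul_le_mul_left ?_ hpos
  calc (1 + U) ^ 2 * ((1 + V) ^ 2 * (1 + S)) = (1 + V) ^ 2 * ((1 + U) ^ 2 * (1 + S)) := by ring
    _ ≤ (1 + V) ^ 2 * (P * (1 + 2 * U)) := mul_le_mul_of_nonneg_left h1 (sq_nonneg _)
    _ = P * ((1 + V) ^ 2 * (1 + 2 * U)) := by ring
    _ ≤ P * ((1 + U) ^ 2 * (1 + 2 * V)) := by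
      refine mul_le_mul_of_nonneg_left h2 (Multiset.prod_nonneg fun w hw => ?_)
      obtain ⟨u, hu, rfl⟩ := Multiset.mem_map.1 hw
      linarith [hM u hu]
    _ = _ := by ring

/-- With u = (1-y)/(y-r) for the roots r of R, the ratio of (t-y)R(y) to (t-1)R(1) is 1 plus the sum
of u/(1+u), divided by the product of 1+u. The critical point at 1 expresses t through the roots,
and V bounds the sum of the u from below. -/
theorem growth_of_roots_lt {R : ℝ[X]} (hR : R.Splits) {y : ℝ} (hy : y < 1) (hRy : 0 < R.eval y)
    (hroots : ∀ r ∈ R.roots, r < y) {t : ℝ} (ht : 1 < t)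
    (h1 : (t - 1) * (derivative R).eval 1 = R.eval 1) {V : ℝ} (hV : 1 ≤ V)
    (hVR : V * R.eval y ≤ (1 - y) * (derivative R).eval y) :
    (1 + V) ^ 2 * ((t - y) * R.eval y) ≤ (1 + 2 * V) * ((t - 1) * R.eval 1) := by
  have hδ : 0 < 1 - y := by linarith
  have hR0 : R ≠ 0 := by rintro rfl; simp at hRy
  have hR1 : R.eval 1 ≠ 0 := fun h0 =>
    absurd (hroots 1 ((mem_roots hR0).2 h0)) (by linarith)
  set M := R.roots.map fun r => (1 - y) / (y - r) with hM
  have hM0 : ∀ u ∈ M, 0 ≤ u := fun u hu => by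
    obtain ⟨r, hr, rfl⟩ := Multiset.mem_map.1 hu
    exact div_nonneg hδ.le (sub_nonneg.2 (hroots r hr).le)
  have hsum : M.sum * R.eval y = (1 - y) * (derivative R).eval y := by
    rw [hR.eval_derivative_eq_eval_mul_sum hRy.ne', hM]
    have : (R.roots.map fun r => (1 - y) / (y - r)).sum =
        (1 - y) * (R.roots.map fun r => 1 / (y - r)).sum := by
      rw [← Multiset.sum_map_mul_left]
      simp only [mul_one_div]
    rw [this]; ring
  have hS : (M.map fun u => u / (1 + u)).sum * R.eval 1 = (1 - y) * (derivative R).eval 1 := by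
    rw [hR.eval_derivative_eq_eval_mul_sum hR1, hM, Multiset.map_map]
    have : (R.roots.map ((fun u => u / (1 + u)) ∘ fun r => (1 - y) / (y - r))).sum =
        (1 - y) * (R.roots.map fun r => 1 / (1 - r)).sum := by
      rw [← Multiset.sum_map_mul_left]
      congr 1
      refine Multiset.map_congr rfl fun r hr => ?_
      have g1 : y - r ≠ 0 := (sub_pos.2 (hroots r hr)).ne'
      have g2 : 1 - r ≠ 0 := by linarith [hroots r hr]
      simp only [Function.comp_apply]
      have g3 : 1 + (1 - y) / (y - r) = (1 - r) / (y - r) := by field_simp; ring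
      rw [g3]
      field_simp
    rw [this]; ring
  have hP : (M.map fun u => 1 + u).prod * R.eval y = R.eval 1 := by
    rw [hR.eval_eq_prod_roots y, hR.eval_eq_prod_roots 1, hM, Multiset.map_map, mul_left_comm,
      ← Multiset.prod_map_mul]
    congr 2
    refine Multiset.map_congr rfl fun r hr => ?_
    have g1 : y - r ≠ 0 := (sub_pos.2 (hroots r hr)).ne'
    simp only [Function.comp_apply]
    field_simp
    ring
  have h2 := sq_mul_le_prod M hM0 hV (le_of_mul_le_mul_right (by rw [hsum]; exact hVR) hRy)
  set S := (M.map fun u => u / (1 + u)).sum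
  have hS1 : (t - 1) * S = 1 - y := by
    refine mul_right_cancel₀ hR1 ?_
    rw [mul_assoc, hS, mul_left_comm, h1]
  have h3 := mul_le_mul_of_nonneg_right h2 (mul_nonneg (by linarith : 0 ≤ t - 1) hRy.le)
  calc (1 + V) ^ 2 * ((t - y) * R.eval y)
      = (1 + V) ^ 2 * (1 + S) * ((t - 1) * R.eval y) := by
        have : t - y = (t - 1) * (1 + S) := by rw [mul_add, hS1]; ring
        rw [this]; ring
    _ ≤ _ := h3
    _ = (1 + 2 * V) * ((t - 1) * R.eval 1) := by rw [← hP]; ring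

/-- P has a zero t > 1, since it is positive at 1 and tends to -∞. The Wronskian sign makes h a
nonnegative combination of the G/(X - r), hence P = (t - X)R with R again such a combination. At y,
G' = 0 gives R(y) ≤ (ρ-y)R'(y) term by term, so the parameters of `growth_of_roots_lt` sum to at
least V. -/
theorem growth {G h P : ℝ[X]} (hG : G.Splits) (hGn : G.roots.Nodup) (hGl : 0 < G.leadingCoeff)
    (hdeg : h.natDegree < G.natDegree)
    (hsign : ∀ x, 0 ≤ (derivative G).eval x * h.eval x - G.eval x * (derivative h).eval x)
    {b : ℝ} (hb : 0 ≤ b) (hP : P = C b * h - G) (hPs : P.Splits) {y ρ : ℝ} (hy : y < 1)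
    (hGy : G.eval y < 0) (hGy' : (derivative G).eval y = 0) (hρ : ∀ r ∈ G.roots, r ≤ ρ)
    (hρ1 : ρ ≤ 1) (hmono : MonotoneOn (fun x => P.eval x) (Icc y 1))
    (hP1 : (derivative P).eval 1 = 0) (hPy : 0 < P.eval y) {V : ℝ} (hV : 1 ≤ V)
    (hVρ : V * (ρ - y) ≤ 1 - y) : (1 + V) ^ 2 * P.eval y ≤ (1 + 2 * V) * P.eval 1 := by
  classical
  have hG0 : G ≠ 0 := by rintro rfl; simp at hGl
  set S := G.roots.toFinset with hS
  have hmem : ∀ r, r ∈ S ↔ G.eval r = 0 := fun r => by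
    rw [hS, Multiset.mem_toFinset, mem_roots hG0]; rfl
  have hScard : S.card = G.natDegree := by
    rw [hS, Multiset.toFinset_card_of_nodup hGn, ← splits_iff_card_roots.1 hG]
  have hGprod : G = C G.leadingCoeff * ∏ r ∈ S, (X - C r) := by
    conv_lhs => rw [hG.eq_prod_roots]
    rw [hS, Finset.prod_multiset_map_count]
    congr 1
    refine Finset.prod_congr rfl fun r hr => ?_
    rw [Multiset.count_eq_one_of_mem hGn (Multiset.mem_toFinset.1 hr), pow_one]
  set g : ℝ → ℝ[X] := fun r => C G.leadingCoeff * ∏ s ∈ S.erase r, (X - C s) with hg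
  have hGg : ∀ r ∈ S, G = (X - C r) * g r := fun r hr => by
    rw [hg, mul_left_comm, Finset.mul_prod_erase S (fun s => X - C s) hr, ← hGprod]
  have hgs : ∀ r ∈ S, ∀ s ∈ S, s ≠ r → (g r).eval s = 0 := fun r _ s hs hsr => by
    rw [hg, eval_mul, eval_prod, Finset.prod_eq_zero (Finset.mem_erase.2 ⟨hsr, hs⟩) (by simp),
      mul_zero]
  have hG'g : ∀ r ∈ S, ∀ x, (derivative G).eval x =
      (g r).eval x + (x - r) * (derivative (g r)).eval x := fun r hr x => by
    conv_lhs => rw [hGg r hr]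
    simp
  have hgr : ∀ r ∈ S, (g r).eval r = (derivative G).eval r := fun r hr => by
    rw [hG'g r hr r]; ring
  have hG'ne : ∀ r ∈ S, (derivative G).eval r ≠ 0 := fun r hr =>
    not_double_zero_of_nodup hG hGn (k := 0) (by omega) ((hmem r).1 hr)
  set c : ℝ → ℝ := fun r => h.eval r / (derivative G).eval r with hc
  have hc0 : ∀ r ∈ S, 0 ≤ c r := fun r hr => by
    have h1 := hsign r
    rw [(hmem r).1 hr, zero_mul, sub_zero] at h1
    simp only [hc]
    rw [← mul_div_mul_left _ _ (hG'ne r hr)]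
    exact div_nonneg h1 (mul_self_nonneg _)
  have hgd : ∀ r ∈ S, (g r).natDegree < S.card := fun r hr => by
    have h1 := Finset.card_pos.2 ⟨r, hr⟩
    refine (natDegree_C_mul_le _ _).trans_lt ?_
    rw [natDegree_prod_X_sub_C, Finset.card_erase_of_mem hr]
    omega
  have hh : h = ∑ r ∈ S, C (c r) * g r := by
    rw [← sub_eq_zero]
    refine eq_zero_of_natDegree_lt_card_of_eval_eq_zero' _ S (fun s hs => ?_) ?_
    · rw [eval_sub, eval_finsetSum, Finset.sum_eq_single s]
      · rw [eval_mul, eval_C, hgr s hs]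
        simp only [hc]
        rw [div_mul_cancel₀ _ (hG'ne s hs), sub_self]
      · intro r hr hrs
        rw [eval_mul, hgs r hr s hs hrs.symm, mul_zero]
      · exact fun h0 => absurd hs h0
    · refine (natDegree_sub_le _ _).trans_lt (max_lt (by rwa [hScard]) ?_)
      refine lt_of_le_of_lt (natDegree_sum_le_of_forall_le (n := S.card - 1) _ _ fun r hr => ?_) ?_
      · have := hgd r hr
        exact (natDegree_C_mul_le _ _).trans (by omega)
      · omega
  obtain ⟨t, ht1, hPt⟩ : ∃ t, 1 < t ∧ P.eval t = 0 := by
    have hneg : ∃ x, 1 < x ∧ 0 < (-P).eval x := by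
      refine exists_eval_pos (n := G.natDegree) (by omega) ?_ ?_ 1
      · rw [hP, natDegree_neg]
        exact (natDegree_sub_le _ _).trans (max_le ((natDegree_C_mul_le _ _).trans hdeg.le) le_rfl)
      · rw [hP, coeff_neg, coeff_sub, coeff_C_mul, coeff_eq_zero_of_natDegree_lt hdeg]
        simpa using hGl
    obtain ⟨x, hx1, hx⟩ := hneg
    have hP1pos : 0 < P.eval 1 := hPy.trans_le
      (hmono (left_mem_Icc.2 hy.le) (right_mem_Icc.2 hy.le) hy.le)
    rw [eval_neg] at hx
    obtain ⟨t, ht, h0⟩ := intermediate_value_Icc' hx1.le (P.continuous.continuousOn)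
      (show (0 : ℝ) ∈ Icc (P.eval x) (P.eval 1) from ⟨by linarith, hP1pos.le⟩)
    refine ⟨t, lt_of_le_of_ne ht.1 ?_, h0⟩
    rintro rfl
    exact hP1pos.ne' h0
  have hrt : ∀ r ∈ S, 0 < t - r := fun r hr => by
    have := hρ r (Multiset.mem_toFinset.1 hr)
    linarith
  set R := ∑ r ∈ S, C (b * c r / (t - r)) * g r with hR
  have hGpos : ∀ x, ρ < x → 0 < G.eval x := fun x hx =>
    eval_pos_of_roots_lt hG hGl fun r hr => (hρ r hr).trans_lt hx
  have hPR : P = (C t - X) * R := by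
    have h1 : (C t - X) * R = C b * h - C (∑ r ∈ S, b * c r / (t - r)) * G := by
      rw [hR, hh, map_sum, Finset.mul_sum, Finset.mul_sum, Finset.sum_mul,
        ← Finset.sum_sub_distrib]
      refine Finset.sum_congr rfl fun r hr => ?_
      have h2 : (C (t - r) : ℝ[X]) * C (b * c r / (t - r)) = C b * C (c r) := by
        rw [← C_mul, ← C_mul, mul_div_cancel₀ _ (hrt r hr).ne']
      conv_rhs => rw [hGg r hr]
      rw [C_sub] at h2
      linear_combination (g r) * h2
    have h3 := congrArg (eval t) h1
    have h4 : P.eval t = b * h.eval t - G.eval t := by rw [hP]; simp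
    have hGt := hGpos t (by linarith)
    simp only [eval_mul, eval_sub, eval_C, eval_X, sub_self, zero_mul] at h3
    have h5 : (∑ r ∈ S, b * c r / (t - r)) = 1 := by
      refine mul_right_cancel₀ hGt.ne' ?_
      linarith
    rw [h1, h5, C_1, one_mul, hP]
  have hR0 : R ≠ 0 := by
    intro h0
    rw [hPR, h0, mul_zero, eval_zero] at hPy
    exact hPy.false
  have hP0 : P ≠ 0 := by rintro h0; rw [h0, eval_zero] at hPy; exact hPy.false
  have hRs : R.Splits := Splits.of_dvd hPs hP0 (Dvd.intro_left _ hPR.symm)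
  have hPRe : ∀ x, P.eval x = (t - x) * R.eval x := fun x => by rw [hPR]; simp
  have hRy : 0 < R.eval y := by
    rw [hPRe] at hPy
    exact (mul_pos_iff_of_pos_left (by linarith)).1 hPy
  have hcR : ∀ r ∈ S, 0 ≤ b * c r / (t - r) := fun r hr =>
    div_nonneg (mul_nonneg hb (hc0 r hr)) (hrt r hr).le
  have hsumc : ∃ r ∈ S, 0 < b * c r / (t - r) := by
    by_contra! hcon
    refine hR0 (Finset.sum_eq_zero fun r hr => ?_)
    rw [le_antisymm (hcon r hr) (hcR r hr), C_0, zero_mul]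
  have hRroots : ∀ r ∈ R.roots, r < y := by
    intro r hr
    have hr0 : R.eval r = 0 := (mem_roots hR0).1 hr
    by_contra! hyr
    rcases le_or_gt r 1 with h1 | h1
    · have := hmono (left_mem_Icc.2 hy.le) ⟨hyr, h1⟩ hyr
      simp only [hPRe r, hr0, mul_zero] at this
      linarith
    · have hgpos : ∀ s ∈ S, 0 < (g s).eval r := fun s hs => by
        have h2 := hGpos r (by linarith)
        rw [hGg s hs] at h2
        simp only [eval_mul, eval_sub, eval_X, eval_C] at h2
        have := hρ s (Multiset.mem_toFinset.1 hs)
        exact (mul_pos_iff_of_pos_left (by linarith)).1 h2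
      have : 0 < R.eval r := by
        rw [hR, eval_finsetSum]
        obtain ⟨s, hs, hs0⟩ := hsumc
        refine Finset.sum_pos' (fun r' hr' => ?_) ⟨s, hs, ?_⟩
        · rw [eval_mul, eval_C]
          exact mul_nonneg (hcR r' hr') (hgpos r' hr').le
        · rw [eval_mul, eval_C]
          exact mul_pos hs0 (hgpos s hs)
      exact this.ne' hr0
  have hRρ : R.eval y ≤ (ρ - y) * (derivative R).eval y := by
    rw [hR, derivative_sum, eval_finsetSum, eval_finsetSum, Finset.mul_sum]
    refine Finset.sum_le_sum fun r hr => ?_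
    rw [derivative_C_mul, eval_C_mul (p := g r), eval_C_mul (p := derivative (g r)), mul_left_comm]
    refine mul_le_mul_of_nonneg_left ?_ (hcR r hr)
    have h1 := hG'g r hr y
    rw [hGy'] at h1
    have h2 : G.eval y = (y - r) * (g r).eval y := by
      conv_lhs => rw [hGg r hr]
      simp
    have h3 : 0 < (derivative (g r)).eval y := by
      by_contra! hneg
      have h4 : G.eval y = (y - r) ^ 2 * -(derivative (g r)).eval y := by
        linear_combination h2 - (y - r) * h1
      have := mul_nonneg (sq_nonneg (y - r)) (neg_nonneg.2 hneg)
      linarith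
    have h4 := mul_nonneg (sub_nonneg.2 (hρ r (Multiset.mem_toFinset.1 hr))) h3.le
    linarith
  have hR'1 : (t - 1) * (derivative R).eval 1 = R.eval 1 := by
    rw [hPR] at hP1
    simp only [derivative_mul, derivative_sub, derivative_C, derivative_X, eval_add, eval_mul,
      eval_sub, eval_C, eval_X, eval_zero, eval_one] at hP1
    linarith
  have hR'y : 0 ≤ (derivative R).eval y := by
    rw [hRs.eval_derivative_eq_eval_mul_sum hRy.ne']
    refine mul_nonneg hRy.le (Multiset.sum_nonneg fun w hw => ?_)
    obtain ⟨r, hr, rfl⟩ := Multiset.mem_map.1 hw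
    exact one_div_nonneg.2 (sub_nonneg.2 (hRroots r hr).le)
  rw [hPRe y, hPRe 1]
  refine growth_of_roots_lt hRs hy hRy hRroots ht1 hR'1 hV ?_
  have h6 := mul_le_mul_of_nonneg_left hRρ (by linarith : 0 ≤ V)
  have h7 := mul_le_mul_of_nonneg_right hVρ hR'y
  linarith

end LandauKolmogorov

namespace LandauKolmogorov

/-! ### Reduction to a numerical inequality -/

theorem nodup_roots_iterate_derivative {p : ℝ[X]} (hp : p.Splits) (hn : p.roots.Nodup) {k : ℕ}
    (hk : k < p.natDegree) : (derivative^[k] p).roots.Nodup := by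
  have hne : derivative^[k] p ≠ 0 := by
    intro h0
    have := natDegree_iterate_derivative_eq p k
    rw [h0, natDegree_zero] at this
    omega
  refine Multiset.nodup_iff_count_le_one.2 fun x => ?_
  rw [count_roots]
  by_contra! h
  obtain ⟨h1, h2⟩ := (one_lt_rootMultiplicity_iff_isRoot hne).1 h
  refine not_double_zero_of_nodup hp hn hk h1 ?_
  rw [Function.iterate_succ_apply']
  exact h2

/-- The left side is 1 - sin^2(π/(2n)) with n = l + 2. Concavity of the sine between 0 and π/6,
where it is 1/2, gives sin(π/(2n)) ≥ 3/(2n) for n ≥ 3. -/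
theorem half_one_add_chebNode_le {l : ℕ} (hl : 1 ≤ l) :
    (1 + chebNode (l + 2) (l + 1)) / 2 ≤ 1 - 9 / (4 * ((l : ℝ) + 2) ^ 2) := by
  have hpi := Real.pi_pos
  set n : ℝ := (l : ℝ) + 2 with hn
  have hn3 : 3 ≤ n := by
    have : (1 : ℝ) ≤ l := by exact_mod_cast hl
    linarith
  have h1 : chebNode (l + 2) (l + 1) = Real.cos (2 * (Real.pi / (2 * n))) := by
    have := chebNode_reflect (n := l + 2) (i := 1) (by omega) (by omega)
    rw [show l + 2 - 1 = l + 1 by omega] at this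
    rw [this, chebNode, neg_neg]
    congr 1
    rw [hn]
    push_cast
    field_simp
  have h2 : 3 / (2 * n) ≤ Real.sin (Real.pi / (2 * n)) := by
    have hc := strictConcaveOn_sin_Icc.concaveOn.2 (show (0 : ℝ) ∈ Icc 0 Real.pi from ⟨le_rfl, hpi.le⟩)
      (show Real.pi / 6 ∈ Icc 0 Real.pi from ⟨by positivity, by linarith⟩)
      (show 0 ≤ 1 - 3 / n by rw [sub_nonneg, div_le_one (by linarith)]; exact hn3)
      (show 0 ≤ 3 / n by positivity) (by ring)
    simp only [smul_eq_mul, mul_zero, Real.sin_zero, zero_add, Real.sin_pi_div_six] at hc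
    calc 3 / (2 * n) = 3 / n * (1 / 2) := by field_simp
      _ ≤ _ := hc
      _ = _ := by congr 1; field_simp; norm_num
  rw [h1, Real.cos_two_mul, Real.cos_sq']
  have h3 : (3 / (2 * n)) ^ 2 ≤ Real.sin (Real.pi / (2 * n)) ^ 2 :=
    pow_le_pow_left₀ (by positivity) h2 2
  have h4 : (3 / (2 * n)) ^ 2 = 9 / (4 * n ^ 2) := by field_simp; norm_num
  linarith

theorem eval_iterate_derivative_T_neg (n j : ℕ) (x : ℝ)
    (h : (derivative^[j] (Chebyshev.T ℝ (n : ℤ))).eval x = 0) :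
    (derivative^[j] (Chebyshev.T ℝ (n : ℤ))).eval (-x) = 0 := by
  set T := Chebyshev.T ℝ (n : ℤ) with hT
  have h1 : T.comp (C (-1) * X + C 0) = C ((-1 : ℝ) ^ n) * T := by
    refine Polynomial.funext fun z => ?_
    rw [eval_comp, eval_C_mul]
    simp only [eval_add, eval_mul, eval_C, eval_X, neg_one_mul, add_zero]
    rw [hT, Chebyshev.T_eval_neg, Int.negOnePow_def]
    simp
  have h2 := eval_iterate_derivative_comp_linear T (-1) 0 j x
  rw [h1, iterate_derivative_C_mul, eval_C_mul, h, mul_zero, neg_one_mul, add_zero] at h2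
  exact (mul_eq_zero.1 h2.symm).resolve_left (pow_ne_zero _ (by norm_num))

theorem omega_nonneg {n j : ℕ} {ω : ℝ}
    (hω : IsGreatest {x : ℝ | derivAt (Chebyshev.T ℝ (n : ℤ)) j x = 0} ω) : 0 ≤ ω := by
  have h : -ω ≤ ω := hω.2 (eval_iterate_derivative_T_neg n j ω hω.1)
  linarith

namespace ZolotarevData

variable {l : ℕ} {θ : ℝ} {Z : ℝ[X]} {τ : Fin (l + 2) → ℝ} {K β : ℝ}
variable (d : ZolotarevData l θ Z τ K β)

theorem growth {k : ℕ} (hk : 1 ≤ k) (hkl : k ≤ l) (h1 : derivAt Z (k + 1) 1 = 0) {y : ℝ}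
    (hy0 : (derivative^[k] d.tail).eval y = 0) (hy : RootsLE k d.tail y) {ρ : ℝ}
    (hρ : RootsLE (k - 1) d.tail ρ) (hρ1 : ρ ≤ 1) (hpos : 0 < (derivative^[k] Z).eval y) {V : ℝ}
    (hV : 1 ≤ V) (hVρ : V * (ρ - y) ≤ 1 - y) :
    (1 + V) ^ 2 * (derivative^[k] Z).eval y ≤ (1 + 2 * V) * (derivative^[k] Z).eval 1 := by
  have hK := d.pos
  set G := derivative^[k - 1] d.tail with hG
  set h := derivative^[k - 1] d.inner with hh
  have hZP : derivative^[k] Z = C K * (C (β - 1) * h - G) := by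
    refine Polynomial.funext fun x => ?_
    rw [d.eval_iterate_derivative hk]
    simp [hG, hh]
  have hG' : derivative G = derivative^[k] d.tail := by
    rw [hG, ← Function.iterate_succ_apply' derivative, Nat.succ_eq_add_one, Nat.sub_add_cancel hk]
  have hh' : derivative h = derivative^[k] d.inner := by
    rw [hh, ← Function.iterate_succ_apply' derivative, Nat.succ_eq_add_one, Nat.sub_add_cancel hk]
  have htd := d.natDegree_tail
  have hGs : G.Splits := splits_iterate_derivative d.tail_splits _
  have hGl : 0 < G.leadingCoeff :=
    leadingCoeff_iterate_derivative_pos d.tail_leadingCoeff (by omega)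
  have hGd : G.natDegree = l + 1 - (k - 1) := by rw [hG, natDegree_iterate_derivative_eq, htd]
  have hhd : h.natDegree = l - (k - 1) := by
    rw [hh, natDegree_iterate_derivative_eq, natDegree_inner]
  have hGne : G ≠ 0 := by rintro h0; rw [h0] at hGl; simp at hGl
  have hGn : G.roots.Nodup := nodup_roots_iterate_derivative d.tail_splits d.tail_nodup (by omega)
  have hGy' : (derivative G).eval y = 0 := by rw [hG']; exact hy0
  have hGy : G.eval y < 0 := by
    refine lt_of_le_of_ne (eval_nonpos_of_max_critical hGs hGl hGy' fun z hz => ?_) fun h0 => ?_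
    · rw [hG']; exact hy z hz
    · exact not_double_zero_of_nodup hGs hGn (k := 0) (by omega) h0 hGy'
  have hsign : ∀ x, 0 ≤ (derivative G).eval x * h.eval x - G.eval x * (derivative h).eval x := by
    intro x
    rw [hG', hh', hG, hh, tail_eq]
    rcases hk.eq_or_lt with rfl | hk1
    · simp only [Function.iterate_one, Nat.sub_self, Function.iterate_zero, id_eq, derivative_mul,
        derivative_sub, derivative_X, derivative_C, eval_add, eval_mul, eval_sub, eval_X, eval_C,
        sub_zero, eval_one]
      nlinarith [sq_nonneg (d.inner.eval x)]
    · have := wronskian_X_sub_C_mul_nonneg d.inner_splits 1 x (k := k - 1) (by omega)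
      rwa [Nat.sub_add_cancel hk] at this
  have hPe : ∀ x, (derivative^[k] Z).eval x = K * (C (β - 1) * h - G).eval x := fun x => by
    rw [hZP, eval_C_mul]
  have hPs : (C (β - 1) * h - G).Splits := by
    have h2 : (derivative Z).Splits := by
      rw [d.derivative_eq]
      exact (Splits.C _).mul ((Splits.X_sub_C _).mul d.inner_splits)
    have h3 : (derivative^[k] Z).Splits := by
      obtain ⟨j, rfl⟩ := Nat.exists_eq_add_of_le' hk
      rw [Function.iterate_succ_apply]
      exact splits_iterate_derivative h2 j
    have h4 : derivative^[k] Z ≠ 0 := by rintro h0; rw [h0] at hpos; simp at hpos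
    exact Splits.of_dvd h3 h4 (Dvd.intro_left _ hZP.symm)
  have hmono := d.monotoneOn hk hkl h1 hy
  have := LandauKolmogorov.growth hGs hGn hGl (h := h) (by omega) hsign (b := β - 1)
    (by linarith [d.one_lt]) rfl hPs (y := y) (ρ := ρ) (d.top_lt_one hk hkl hy0 hy) hGy hGy'
    (fun r hr => by
      by_contra! hlt
      exact (hρ r hlt).ne' ((mem_roots hGne).1 hr)) hρ1
    (fun a ha b hb hab => by
      have := hmono ha hb hab
      simp only [hPe] at this
      exact le_of_mul_le_mul_left this hK)
    (by
      have h5 : derivAt Z (k + 1) 1 = K * (derivative (C (β - 1) * h - G)).eval 1 := by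
        rw [derivAt, Function.iterate_succ_apply', hZP, derivative_C_mul, eval_C_mul]
      rw [h1] at h5
      exact (mul_eq_zero.1 h5.symm).resolve_left hK.ne')
    (by
      rw [hPe] at hpos
      exact (mul_pos_iff_of_pos_left hK).1 hpos) hV hVρ
  rw [hPe, hPe]
  nlinarith [mul_le_mul_of_nonneg_left this hK.le]

/-- The three ranges of x, with the numerical inequality isolated as the hypothesis `hnum`. -/
theorem jet_bound (hd : Z.natDegree ≤ l + 2)
    (hc : Z.coeff (l + 2) = θ / ((l + 2)! : ℝ)) (hb : ∀ x ∈ I, |Z.eval x| ≤ 1) {k : ℕ}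
    (hk : 1 ≤ k) (hkl : k ≤ l) (h1 : derivAt Z (k + 1) 1 = 0) {ω : ℝ} (hω1 : -1 < ω)
    (hω0 : (derivative^[k] (critPoly l)).eval ω = 0) (hω : RootsLE k (critPoly l) ω)
    (hnum : ∀ y, 1 + ω < (1 - 9 / (4 * ((l : ℝ) + 2) ^ 2)) * (1 + y) →
      1 + y ≤ ((l : ℝ) + 2) / (l + 1) * (1 + ω) → y < 1 → ∃ V ρ, 1 ≤ V ∧ ρ ≤ 1 ∧
        RootsLE (k - 1) d.tail ρ ∧ V * (ρ - y) ≤ 1 - y ∧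
        ((1 - 9 / (4 * ((l : ℝ) + 2) ^ 2)) * (((l : ℝ) + 2) / (l + 1))) ^ k * (1 + 2 * V) ≤
          (1 + V) ^ 2) {x : ℝ} (hx : x ∈ Icc ω 1) {F : ℕ → ℝ → ℝ}
    (hF : IsSobolevJet (l + 1) |θ| F) (hF1 : F (k + 1) x = 0) :
    F k x ≤ max |derivAt (Chebyshev.T ℝ ((l + 2 : ℕ) : ℤ)) k ω| |derivAt Z k 1| := by
  set a' : ℝ := 1 - 9 / (4 * ((l : ℝ) + 2) ^ 2) with ha'
  have haa' := half_one_add_chebNode_le (hk.trans hkl)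
  rw [← ha'] at haa'
  have ha'0 : 0 < a' := by
    have h2 := chebNode_lt (n := l + 2) (i := 0) (j := l + 1) (by omega) (by omega)
    rw [chebNode_zero] at h2
    linarith
  have hxI : x ∈ I := ⟨hω1.le.trans hx.1, hx.2⟩
  have hω1' : 0 < 1 + ω := by linarith
  obtain ⟨y, hy0, hy⟩ := d.exists_top hkl
  have hy1 := d.top_lt_one hk hkl hy0 hy
  rcases le_or_gt (a' * (1 + x)) (1 + ω) with hcase | hcase
  · refine (jet_le_T hk hkl hω0 hω rfl (A := (1 + x) / (1 + ω)) ?_ ?_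
      (d.abs_theta_le hd hc hb rfl) hxI ?_ hF).trans (le_max_left _ _)
    · rw [le_div_iff₀ hω1']; linarith [hx.1]
    · rw [← mul_div_assoc, div_le_one hω1']
      exact (mul_le_mul_of_nonneg_right haa' (by linarith [hx.1])).trans hcase
    · rw [div_mul_cancel₀ _ hω1'.ne']; ring
  refine le_trans ?_ ((le_abs_self _).trans (le_max_right _ _))
  rcases le_or_gt y x with hyx | hxy
  · exact (d.jet_le hd hc hk hkl h1 hy0 hy hyx hxI hF hF1).trans
      (d.monotoneOn hk hkl h1 hy ⟨hyx, hx.2⟩ (right_mem_Icc.2 hy1.le) hx.2)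
  have hx0 : 0 < 1 + x := by linarith [hx.1]
  have hy0' : 0 < 1 + y := by linarith
  have hyI : y ∈ I := ⟨by linarith, hy1.le⟩
  -- Intermediate range: the contraction by c fixes -1 and sends y to x, so the bound at y applies
  -- to the contracted function.
  set c := (1 + x) / (1 + y) with hcdef
  have hc0 : 0 < c := by positivity
  have hc1 : c ≤ 1 := by rw [hcdef, div_le_one hy0']; linarith
  have hcy : (c - 1) + c * y = x := by
    have : c * (1 + y) = 1 + x := by rw [hcdef, div_mul_cancel₀ _ hy0'.ne']
    linarith
  have hcF := (hF.contract (b := c - 1) (c := c) hc0.le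
    (by rw [abs_of_nonpos (by linarith)]; linarith)).mono (σ' := |θ|)
    (mul_le_of_le_one_left (abs_nonneg θ) (pow_le_one₀ hc0.le hc1))
  have h2 := d.jet_le hd hc hk hkl h1 hy0 hy le_rfl hyI hcF (by
    simp only [hcy, hF1, mul_zero])
  simp only [hcy] at h2
  have hy_le : 1 + y ≤ ((l : ℝ) + 2) / (l + 1) * (1 + ω) := by
    by_contra! hlt
    exact (d.rootsLE_tail hd hc hb hkl hω y (by linarith)).ne' hy0
  -- The zero function belongs to the class, so the comparison itself gives the sign.
  have hH1 : 0 ≤ (derivative^[k] Z).eval 1 := by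
    have h3 := d.jet_le hd hc hk hkl h1 hy0 hy hy1.le ⟨by norm_num, le_rfl⟩ (F := fun _ _ => 0)
      ⟨fun j _ z _ => hasDerivWithinAt_const z I 0, fun z _ => by simp, fun z _ w _ hzw => by
        simpa using mul_nonneg (abs_nonneg θ) (sub_nonneg.2 hzw)⟩ rfl
    exact h3
  rw [derivAt]
  rcases le_or_gt ((derivative^[k] Z).eval y) 0 with hneg | hpos
  · have : c ^ k * F k x ≤ 0 := h2.trans hneg
    have hck : 0 < c ^ k := by positivity
    have : F k x ≤ 0 := by
      by_contra! hcon
      exact this.not_gt (mul_pos hck hcon)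
    linarith
  obtain ⟨V, ρ, hV, hρ1, hρ, hVρ, hVk⟩ := hnum y
    (hcase.trans_le (mul_le_mul_of_nonneg_left (by linarith) ha'0.le)) hy_le hy1
  have h3 := d.growth hk hkl h1 hy0 hy hρ hρ1 hpos hV hVρ
  -- The loss 1/c is at most t: one factor comes from the localization of y, the other from being
  -- outside the Chebyshev range.
  set t := a' * (((l : ℝ) + 2) / (l + 1)) with ht
  have hct : 1 ≤ c * t := by
    have h4 : 1 + ω ≤ a' * (1 + x) := hcase.le
    have h5 : 1 + y ≤ t * (1 + x) := by
      refine hy_le.trans ?_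
      have : (0 : ℝ) ≤ ((l : ℝ) + 2) / (l + 1) := by positivity
      calc _ ≤ ((l : ℝ) + 2) / (l + 1) * (a' * (1 + x)) := mul_le_mul_of_nonneg_left h4 this
        _ = _ := by rw [ht]; ring
    rw [hcdef, div_mul_eq_mul_div, le_div_iff₀ hy0']
    linarith
  have htk : 1 ≤ (c * t) ^ k := one_le_pow₀ hct
  have ht0 : 0 ≤ t ^ k := by positivity
  rcases le_or_gt (F k x) 0 with hF0 | hF0
  · exact hF0.trans hH1
  have h6 : F k x ≤ t ^ k * (derivative^[k] Z).eval y := by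
    calc F k x ≤ (c * t) ^ k * F k x := le_mul_of_one_le_left hF0.le htk
      _ = t ^ k * (c ^ k * F k x) := by rw [mul_pow]; ring
      _ ≤ _ := mul_le_mul_of_nonneg_left h2 ht0
  refine h6.trans ?_
  have hV2 : 0 < 1 + 2 * V := by linarith
  refine le_of_mul_le_mul_left ?_ hV2
  calc (1 + 2 * V) * (t ^ k * (derivative^[k] Z).eval y)
      = (t ^ k * (1 + 2 * V)) * (derivative^[k] Z).eval y := by ring
    _ ≤ (1 + V) ^ 2 * (derivative^[k] Z).eval y := mul_le_mul_of_nonneg_right hVk hpos.le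
    _ ≤ _ := h3

end ZolotarevData

end LandauKolmogorov

namespace LandauKolmogorov

/-! ### Zeros of derivatives of Chebyshev polynomials -/

/-- `critPoly` is T_n' up to a constant, so this is the differentiated Chebyshev equation. It is
used both analytically and as a recurrence for exact computation. -/
theorem one_sub_sq_mul_critPoly (l k : ℕ) (x : ℝ) :
    (1 - x ^ 2) * (derivative^[k + 2] (critPoly l)).eval x =
      (2 * k + 3) * x * (derivative^[k + 1] (critPoly l)).eval x -
        (((l : ℝ) + 2) ^ 2 - (k + 1) ^ 2) * (derivative^[k] (critPoly l)).eval x := by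
  have h := Chebyshev.one_sub_X_sq_mul_iterate_derivative_T_eval (R := ℝ) ((l + 2 : ℕ) : ℤ) (k + 1) x
  rw [eval_iterate_derivative_T, eval_iterate_derivative_T, eval_iterate_derivative_T] at h
  push_cast at h
  have hc : (0 : ℝ) < (l + 2) * 2 ^ (l + 1) := by positivity
  refine mul_left_cancel₀ hc.ne' ?_
  linear_combination h

theorem rootsLE_critPoly_one {l k : ℕ} (hk : k ≤ l + 1) :
    RootsLE k (critPoly l) (chebNode (l + 2) (l + 1)) := by
  refine rootsLE_of_roots_le (critPoly_splits l) (critPoly_leadingCoeff l) (fun r hr => ?_)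
    (by rwa [natDegree_critPoly])
  rw [critPoly, roots_prod _ _ (Finset.prod_ne_zero_iff.2 fun i _ => X_sub_C_ne_zero _)] at hr
  simp only [roots_X_sub_C, Multiset.mem_bind, Multiset.mem_singleton] at hr
  obtain ⟨i, -, rfl⟩ := hr
  rcases Nat.lt_or_ge i l with h | h
  · exact (chebNode_lt (by omega) (by omega)).le
  · rw [show (i : ℕ) = l by omega]

theorem chebNode_lt_one (l : ℕ) : chebNode (l + 2) (l + 1) < 1 := by
  rw [← chebNode_self (show l + 2 ≠ 0 by omega)]
  exact chebNode_lt (by omega) le_rfl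

theorem lt_one_of_critPoly_zero {l k : ℕ} (hk : k ≤ l + 1) {ω : ℝ}
    (h : (derivative^[k] (critPoly l)).eval ω = 0) : ω < 1 := by
  by_contra! h1
  exact (rootsLE_critPoly_one hk ω ((chebNode_lt_one l).trans_le h1)).ne' h

/-- Upper bound for the rightmost zero of an ultraspherical polynomial. -/
theorem sq_top_critPoly_le {l k : ℕ} (hk : k ≤ l) {ω : ℝ} (h0 : 0 ≤ ω)
    (hω0 : (derivative^[k] (critPoly l)).eval ω = 0) (hω : RootsLE k (critPoly l) ω) :
    (((l : ℝ) + 2) ^ 2 + k + 5 / 4) * ω ^ 2 ≤ ((l : ℝ) + 2) ^ 2 - (k + 1) ^ 2 := by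
  set P := derivative^[k] (critPoly l) with hP
  have hP1 : ∀ z, (derivative^[k + 1] (critPoly l)).eval z = (derivative P).eval z := fun z => by
    rw [hP, ← Function.iterate_succ_apply' derivative]
  have hP2 : ∀ z, (derivative^[k + 2] (critPoly l)).eval z = (derivative (derivative P)).eval z :=
    fun z => by
      rw [hP, ← Function.iterate_succ_apply' derivative, ← Function.iterate_succ_apply' derivative]
  have h1 := lt_one_of_critPoly_zero (by omega) hω0
  have hder := eval_iterate_derivative_pos_of_rootsLE (critPoly_splits l) (critPoly_nodup l)
    (critPoly_leadingCoeff l) (by rw [natDegree_critPoly]; omega) hω le_rfl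
  rw [hP1] at hder
  -- With v = (1-z^2)P'/P, Laguerre and the differential equation give v^2 - (2k+3)zv + (1-z^2)N ≥
  -- 0. This says most at the vertex v = (k+3/2)z; a zero of f is a point in (ω,1) where v takes
  -- that value.
  set f : ℝ[X] := 2 * (1 - X ^ 2) * derivative P - C ((2 : ℝ) * k + 3) * X * P with hf
  have hfe : ∀ z, f.eval z = 2 * (1 - z ^ 2) * (derivative P).eval z - (2 * k + 3) * z * P.eval z :=
    fun z => by simp [hf]
  obtain ⟨z, hz, hz0⟩ : (0 : ℝ) ∈ f.eval '' Ioo ω 1 := by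
    refine intermediate_value_Ioo' h1.le f.continuousOn ⟨?_, ?_⟩
    · have := hω 1 h1
      rw [hfe]
      have : 0 < (2 * (k : ℝ) + 3) * 1 * P.eval 1 := by positivity
      linarith
    · rw [hfe, hω0, mul_zero, sub_zero]
      have : 0 < 1 - ω ^ 2 := by nlinarith
      positivity
  replace hz0 := (hfe z).symm.trans hz0
  have hPz : 0 < P.eval z := hω z hz.1
  have hode := one_sub_sq_mul_critPoly l k z
  rw [hP1, hP2, ← hP] at hode
  have hlag := laguerre (splits_iterate_derivative (critPoly_splits l) k) z
  rw [← hP] at hlag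
  have hz1 : 0 < 1 - z ^ 2 := by nlinarith [hz.1, hz.2]
  set N := ((l : ℝ) + 2) ^ 2 - (k + 1) ^ 2 with hN
  set p := P.eval z
  set p' := (derivative P).eval z
  set p'' := (derivative (derivative P)).eval z
  have hkey : 0 ≤ p ^ 2 * ((1 - z ^ 2) * N - ((k + 3 / 2) * z) ^ 2) := by
    have e1 : (1 - z ^ 2) * p' = (k + 3 / 2) * z * p := by linarith
    have e2 := mul_le_mul_of_nonneg_left hlag (sq_nonneg (1 - z ^ 2))
    have e3 : (1 - z ^ 2) ^ 2 * (p * p'') =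
        p * (2 * (k + 3 / 2) * z * ((1 - z ^ 2) * p') - (1 - z ^ 2) * N * p) := by
      linear_combination (1 - z ^ 2) * p * hode
    have e4 : (1 - z ^ 2) ^ 2 * p' ^ 2 = ((1 - z ^ 2) * p') ^ 2 := by ring
    rw [e3, e4, e1] at e2
    linarith
  have hkey2 := nonneg_of_mul_nonneg_right hkey (by positivity)
  have hωz : ω ^ 2 ≤ z ^ 2 := pow_le_pow_left₀ h0 hz.1.le 2
  have hν : 0 ≤ ((l : ℝ) + 2) ^ 2 + k + 5 / 4 := by positivity
  refine (mul_le_mul_of_nonneg_left hωz hν).trans ?_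
  rw [hN] at hkey2 ⊢
  linarith

/-- The distance between the rightmost zeros of consecutive derivatives of a Chebyshev
polynomial. -/
theorem exists_top_critPoly_sub_sq_le {l j : ℕ} (hj : j + 1 ≤ l) {ω : ℝ} (h0 : 0 ≤ ω)
    (hω0 : (derivative^[j + 1] (critPoly l)).eval ω = 0) (hω : RootsLE (j + 1) (critPoly l) ω) :
    ∃ x, ω ≤ x ∧ x < 1 ∧ RootsLE j (critPoly l) x ∧
      (x - ω) ^ 2 * (((l : ℝ) + 2) ^ 2 - (j + 1) ^ 2) ≤ 2 * (1 - ω ^ 2) := by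
  set P := derivative^[j] (critPoly l) with hP
  have hPs : P.Splits := splits_iterate_derivative (critPoly_splits l) j
  have hPl : 0 < P.leadingCoeff := leadingCoeff_iterate_derivative_pos (critPoly_leadingCoeff l)
    (by rw [natDegree_critPoly]; omega)
  have hPd : P.natDegree = l + 1 - j := by
    rw [hP, natDegree_iterate_derivative_eq, natDegree_critPoly]
  have hP1 : derivative^[j + 1] (critPoly l) = derivative P := by
    rw [hP, ← Function.iterate_succ_apply' derivative]
  have hP2 : derivative^[j + 2] (critPoly l) = derivative (derivative P) := by
    rw [hP, ← Function.iterate_succ_apply' derivative, ← Function.iterate_succ_apply' derivative]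
  obtain ⟨x, hx0, hx⟩ := exists_max_root hPs hPl (by omega)
  have hode := one_sub_sq_mul_critPoly l j ω
  rw [hω0, hP2, ← hP, mul_zero, zero_sub] at hode
  have hcrit : ∀ z, ω < z → 0 < (derivative P).eval z := fun z hz => by
    rw [← hP1]; exact hω z hz
  rw [hP1] at hω0
  have hPω : P.eval ω < 0 := by
    refine lt_of_le_of_ne (eval_nonpos_of_max_critical hPs hPl hω0 hcrit) fun h => ?_
    refine not_double_zero_of_nodup (critPoly_splits l) (critPoly_nodup l) (k := j)
      (by rw [natDegree_critPoly]; omega) h ?_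
    rw [hP1]; exact hω0
  have hωx : ω < x := by
    rcases lt_trichotomy ω x with h | rfl | h
    · exact h
    · linarith
    · linarith [hx ω h]
  refine ⟨x, hωx.le, lt_one_of_critPoly_zero (by omega) hx0, hx, ?_⟩
  obtain ⟨S, hS⟩ := dvd_iff_isRoot.2 (show P.IsRoot x from hx0)
  have hP0 : P ≠ 0 := by rintro h; rw [h] at hPω; simp at hPω
  have hSs : S.Splits := Splits.of_dvd hPs hP0 (Dvd.intro_left _ hS.symm)
  have hSl : 0 < S.leadingCoeff := by
    rwa [hS, leadingCoeff_mul, leadingCoeff_X_sub_C, one_mul] at hPl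
  have hSroot : ∀ r ∈ S.roots, r ≤ ω := by
    intro r hr
    by_contra! hr'
    have hSr : S.eval r = 0 := (mem_roots'.1 hr).2
    have hmono : StrictMonoOn P.eval (Ici ω) := by
      refine strictMonoOn_of_deriv_pos (convex_Ici ω) P.continuousOn fun z hz => ?_
      rw [Polynomial.deriv]
      rw [interior_Ici] at hz
      exact hcrit z hz
    have hPr : P.eval r = 0 := by rw [hS, eval_mul, hSr, mul_zero]
    have hrx : r = x := hmono.injOn hr'.le hωx.le (by rw [hPr, hx0])
    have := hcrit x hωx
    rw [hS, derivative_mul, eval_add, eval_mul, eval_mul, ← hrx, hSr] at this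
    simp at this
  -- All roots of S are at most ω, so S'' ≥ 0 there. This gives P''(ω) ≤ 2S'(ω), while P(ω) =
  -- -(x-ω)^2 S'(ω); the differential equation at ω then bounds the gap.
  have hS2 : 0 ≤ (derivative (derivative S)).eval ω := by
    rcases Nat.lt_or_ge S.natDegree 2 with h | h
    · have : derivative^[2] S = 0 := iterate_derivative_eq_zero h
      change 0 ≤ (derivative^[2] S).eval ω
      rw [this, eval_zero]
    · have hr := rootsLE_of_roots_le hSs hSl hSroot h
      refine ge_of_tendsto (x := nhdsWithin ω (Ioi ω))
        ((derivative (derivative S)).continuous.continuousWithinAt) ?_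
      filter_upwards [self_mem_nhdsWithin] with z hz
      exact (hr z hz).le
  have e1 : S.eval ω = (x - ω) * (derivative S).eval ω := by
    have := hω0
    rw [hS] at this
    simp only [derivative_mul, derivative_sub, derivative_X, derivative_C, eval_add, eval_mul,
      eval_sub, eval_X, eval_C, sub_zero, one_mul] at this
    linarith
  have e2 : (derivative (derivative P)).eval ω =
      2 * (derivative S).eval ω - (x - ω) * (derivative (derivative S)).eval ω := by
    rw [hS]
    simp only [derivative_mul, derivative_sub, derivative_X, derivative_C, eval_add, eval_mul,
      eval_sub, eval_X, eval_C, sub_zero, one_mul, derivative_add]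
    ring
  have e3 : P.eval ω = -((x - ω) ^ 2 * (derivative S).eval ω) := by
    rw [hS, eval_mul, eval_sub, eval_X, eval_C, e1]; ring
  have hSpos : 0 < (derivative S).eval ω := by
    have : 0 < (x - ω) ^ 2 * (derivative S).eval ω := by linarith
    exact (pos_iff_pos_of_mul_pos this).1 (pow_pos (sub_pos.2 hωx) 2)
  rw [e2, e3] at hode
  have h1 : ω < 1 := lt_one_of_critPoly_zero (by omega) (hP1 ▸ hω0)
  have h2 : 0 ≤ (1 - ω ^ 2) * ((x - ω) * (derivative (derivative S)).eval ω) := by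
    have h3 : 0 ≤ 1 - ω ^ 2 := by nlinarith
    exact mul_nonneg h3 (mul_nonneg (sub_nonneg.2 hωx.le) hS2)
  refine le_of_mul_le_mul_right ?_ hSpos
  linarith

end LandauKolmogorov

namespace LandauKolmogorov

/-! ### Certified bounds for small degrees -/

theorem RootsLE.succ_critPoly {l k : ℕ} (hk : k ≤ l) {x : ℝ} (h : RootsLE k (critPoly l) x) :
    RootsLE (k + 1) (critPoly l) x := fun _ hz =>
  eval_iterate_derivative_pos_of_rootsLE (critPoly_splits l) (critPoly_nodup l)
    (critPoly_leadingCoeff l) (by rw [natDegree_critPoly]; omega) h hz.le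

theorem RootsLE.add_critPoly {l k : ℕ} {x : ℝ} (h : RootsLE k (critPoly l) x) (i : ℕ)
    (hi : k + i ≤ l + 1) : RootsLE (k + i) (critPoly l) x := by
  induction i with
  | zero => exact h
  | succ i ih => exact (ih (by omega)).succ_critPoly (by omega)

theorem eval_top_derivative_critPoly_pos (l : ℕ) (x : ℝ) :
    0 < (derivative^[l + 1] (critPoly l)).eval x := by
  have h := rootsLE_critPoly_one le_rfl 1 (chebNode_lt_one l)
  have hd : (derivative^[l + 1] (critPoly l)).natDegree = 0 := by
    rw [natDegree_iterate_derivative_eq, natDegree_critPoly, Nat.sub_self]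
  rw [eq_C_of_natDegree_eq_zero hd, eval_C] at h ⊢
  exact h

/-- The top derivative is a positive constant. Going down in order, each derivative starts
nonnegative at w and increases strictly afterwards. -/
theorem rootsLE_critPoly_of_nonneg {l : ℕ} {w : ℝ} {j r : ℕ} (hjr : j + r = l + 1)
    (h : ∀ i < r, 0 ≤ (derivative^[j + i] (critPoly l)).eval w) : RootsLE j (critPoly l) w := by
  induction r generalizing j with
  | zero =>
    intro z _
    rw [show j = l + 1 by omega]
    exact eval_top_derivative_critPoly_pos l z
  | succ r ih =>
    have h1 : RootsLE (j + 1) (critPoly l) w := ih (by omega) fun i hi => by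
      rw [show j + 1 + i = j + (i + 1) by omega]
      exact h (i + 1) (by omega)
    intro z hz
    have hm : StrictMonoOn (derivative^[j] (critPoly l)).eval (Ici w) := by
      refine strictMonoOn_of_deriv_pos (convex_Ici w) (Polynomial.continuousOn _) fun y hy => ?_
      rw [Polynomial.deriv, ← Function.iterate_succ_apply' derivative]
      rw [interior_Ici] at hy
      exact h1 y hy
    exact (h 0 (by omega)).trans_lt (hm (mem_Ici.2 le_rfl) hz.le hz)

/-- Evaluates the argument before passing it on. -/
def force (x : ℕ) (f : ℕ → Bool) : Bool := Nat.rec (f 0) (fun i _ => f (Nat.succ i)) x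

theorem force_eq (x : ℕ) (f : ℕ → Bool) : force x f = f x := by cases x <;> rfl

/-- Checks, by the three-term recurrence, that the derivatives of orders `j, …, j + r - 1` of the
Chebyshev polynomial of degree `n` are nonnegative at `p / q`, where `D = q ^ 2 - p ^ 2` and `s₁`,
`s₂` are the normalized derivatives of orders `j + r` and `j + r + 1`. -/
def derivTest (n p D j r : ℕ) : ℕ → ℕ → Bool :=
  Nat.rec (fun _ _ => true) (fun r ih s₁ s₂ =>
    force (Nat.add j r) fun i =>
      force (Nat.mul (Nat.mul (Nat.succ (Nat.mul 2 i)) p) s₁) fun a =>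
        force (Nat.mul (Nat.mul D
          (Nat.sub (Nat.mul n n) (Nat.mul (Nat.succ i) (Nat.succ i)))) s₂) fun b =>
          cond (Nat.ble b a) (force (Nat.sub a b) fun s => ih s s₁) false) r

theorem derivTest_succ (n p D j r s₁ s₂ : ℕ) : derivTest n p D j (r + 1) s₁ s₂ =
    cond (Nat.ble (D * (n * n - (j + r + 1) * (j + r + 1)) * s₂) ((2 * (j + r) + 1) * p * s₁))
      (derivTest n p D j r ((2 * (j + r) + 1) * p * s₁ -
        D * (n * n - (j + r + 1) * (j + r + 1)) * s₂) s₁) false := by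
  simp only [derivTest, force_eq]
  rfl

/-- The differential equation at p/q, cleared of denominators, expresses one derivative through the
next two. The state `s₁`, `s₂` records them up to a positive factor A, so natural-number arithmetic
decides the signs exactly. Orders refer to T_n in the test and are one less for `critPoly`. -/
theorem derivTest_iff {l p q j : ℕ} (hq : 0 < q) (hpq : p ≤ q) (r s₁ s₂ : ℕ) {A : ℝ} (hA : 0 < A)
    (hr : j + r ≤ l + 1)
    (h1 : (derivative^[j + r] (critPoly l)).eval (p / q : ℝ) = A * s₁)
    (h2 : (derivative^[j + r + 1] (critPoly l)).eval (p / q : ℝ) =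
      A * q * (((l : ℝ) + 2) ^ 2 - (j + r + 1) ^ 2) * s₂) :
    derivTest (l + 2) p (q ^ 2 - p ^ 2) (j + 1) r s₁ s₂ = true ↔
      ∀ i < r, 0 ≤ (derivative^[j + i] (critPoly l)).eval (p / q : ℝ) := by
  induction r generalizing s₁ s₂ A with
  | zero => exact ⟨fun _ i hi => by omega, fun _ => rfl⟩
  | succ r ih =>
    have hq0 : (0 : ℝ) < q := by exact_mod_cast hq
    have hN : (0 : ℝ) < ((l : ℝ) + 2) ^ 2 - (j + r + 1) ^ 2 := by
      have : (j : ℝ) + r + 1 ≤ l + 1 := by exact_mod_cast hr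
      nlinarith [(by positivity : (0 : ℝ) ≤ (j : ℝ) + r), (by positivity : (0 : ℝ) ≤ (l : ℝ))]
    set a := (2 * (j + 1 + r) + 1) * p * s₁ with ha
    set b := (q ^ 2 - p ^ 2) * ((l + 2) * (l + 2) - (j + 1 + r + 1) * (j + 1 + r + 1)) * s₂ with hb
    have hbR : (b : ℝ) =
        ((q : ℝ) ^ 2 - p ^ 2) * (((l : ℝ) + 2) ^ 2 - (j + r + 2) ^ 2) * s₂ := by
      rw [hb, Nat.cast_mul, Nat.cast_mul, Nat.cast_sub (Nat.pow_le_pow_left hpq 2),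
        Nat.cast_sub (Nat.mul_self_le_mul_self (by omega))]
      push_cast
      ring
    set A' := A / (q * (((l : ℝ) + 2) ^ 2 - (j + r + 1) ^ 2)) with hA'
    have hA'0 : 0 < A' := by positivity
    have hAA' : A = A' * q * (((l : ℝ) + 2) ^ 2 - (j + r + 1) ^ 2) := by
      rw [hA', mul_assoc, div_mul_cancel₀ _ (by positivity)]
    have hE : (derivative^[j + r] (critPoly l)).eval (p / q : ℝ) = A' * ((a : ℝ) - b) := by
      have hode := one_sub_sq_mul_critPoly l (j + r) (p / q : ℝ)
      rw [show j + r + 2 = j + (r + 1) + 1 by omega, h2, show j + r + 1 = j + (r + 1) by omega,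
        h1] at hode
      push_cast at hode
      refine mul_left_cancel₀ hN.ne' ?_
      rw [hbR, ha]
      push_cast
      have h3 : ((q : ℝ) ^ 2 - p ^ 2) = q ^ 2 * (1 - ((p : ℝ) / q) ^ 2) := by
        field_simp
      have h5 : ((2 : ℝ) * (j + 1 + r) + 1) * p * s₁ = q * ((2 * (j + r) + 3) * (p / q) * s₁) := by
        field_simp; ring
      rw [h3, h5]
      refine mul_left_cancel₀ hq0.ne' ?_
      have h6 : (q : ℝ) * ((((l : ℝ) + 2) ^ 2 - (j + r + 1) ^ 2) * A') = A := by
        rw [hAA']; ring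
      linear_combination (q : ℝ) * hode + ((2 * ((j : ℝ) + r) + 3) * (p / q) * s₁ * q -
        q ^ 2 * (1 - ((p : ℝ) / q) ^ 2) * (((l : ℝ) + 2) ^ 2 - (j + r + 2) ^ 2) * s₂) * (-h6)
    rw [derivTest_succ]
    have hsplit : (∀ i < r + 1, 0 ≤ (derivative^[j + i] (critPoly l)).eval (p / q : ℝ)) ↔
        0 ≤ (derivative^[j + r] (critPoly l)).eval (p / q : ℝ) ∧
          ∀ i < r, 0 ≤ (derivative^[j + i] (critPoly l)).eval (p / q : ℝ) := by
      rw [Nat.forall_lt_succ_right, and_comm]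
    rw [hsplit, hE, mul_nonneg_iff_of_pos_left hA'0, sub_nonneg, Nat.cast_le]
    rcases le_or_gt b a with hab | hab
    · rw [Nat.ble_eq_true_of_le hab, cond_true]
      rw [ih (a - b) s₁ hA'0 (by omega) (by rw [hE, Nat.cast_sub hab])
        (by rw [show j + r + 1 = j + (r + 1) by omega, h1]; nth_rewrite 1 [hAA']; rfl)]
      exact ⟨fun h => ⟨hab, h⟩, fun h => h.2⟩
    · have : Nat.ble b a = false := by
        rw [Bool.eq_false_iff]; exact fun h => hab.not_ge (Nat.le_of_ble_eq_true h)
      rw [this, cond_false]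
      exact ⟨fun h => by simp at h, fun h => absurd h.1 hab.not_ge⟩

theorem derivTest_start_iff {l p q j : ℕ} (hq : 0 < q) (hpq : p ≤ q) (hj : j ≤ l) :
    derivTest (l + 2) p (q ^ 2 - p ^ 2) (j + 1) (l + 2 - (j + 1)) 1 0 = true ↔
      ∀ i < l + 1 - j, 0 ≤ (derivative^[j + i] (critPoly l)).eval (p / q : ℝ) := by
  rw [show l + 2 - (j + 1) = l + 1 - j by omega]
  refine derivTest_iff hq hpq _ 1 0 (A := (derivative^[l + 1] (critPoly l)).eval (p / q : ℝ))
    (eval_top_derivative_critPoly_pos l _) (by omega) ?_ ?_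
  · rw [show j + (l + 1 - j) = l + 1 by omega]; simp
  · rw [show j + (l + 1 - j) + 1 = l + 2 by omega]
    rw [iterate_derivative_eq_zero (by rw [natDegree_critPoly]; omega)]
    simp

/-- The bound for the growth of a Zolotarev polynomial that follows from the localizations
`(b - 1) / q` and `c / q` of the rightmost zeros of the derivatives of orders `k + 1` and `k`. -/
def growthTest (n q k b c : ℕ) : Bool :=
  force (4 * n ^ 2 - 9) fun u => force (4 * n ^ 2 * (q + b - 1)) fun v =>
    force ((2 * q * u - v) * (n - 1)) fun A =>
      force (n * (q + c) * u - v * (n - 1)) fun B =>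
        Nat.blt 0 B && (Nat.ble B A &&
          Nat.ble (u ^ k * (B ^ 2 + 2 * A * B)) ((4 * n * (n - 1)) ^ k * (A + B) ^ 2))

/-- Runs through the orders `j, j - 1, …`, moving `p / q` to the right until it bounds the zeros of
the derivative of order `j`. -/
def scan (n q f : ℕ) : ℕ → ℕ → ℕ → Bool :=
  Nat.rec (fun _ _ _ => false) (fun _ ih j p b =>
    cond (Nat.ble (3 * (4 * n ^ 2 - 9) ^ j) (4 * (4 * n * (n - 1)) ^ j)) true
      (cond (force (q ^ 2 - p ^ 2) fun D => derivTest n p D j (n - j) 1 0)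
        (cond (growthTest n q j b p) (force (j - 1) fun i => ih i p p) false)
        (cond (Nat.blt p q) (force (p + 1) fun p' => ih j p' b) false))) f

theorem scan_succ (n q f j p b : ℕ) : scan n q (f + 1) j p b =
    cond (Nat.ble (3 * (4 * n ^ 2 - 9) ^ j) (4 * (4 * n * (n - 1)) ^ j)) true
      (cond (derivTest n p (q ^ 2 - p ^ 2) j (n - j) 1 0)
        (cond (growthTest n q j b p) (scan n q f (j - 1) p p) false)
        (cond (Nat.blt p q) (scan n q f j (p + 1) b) false)) := by
  simp only [scan, force_eq]

/-- The search is evaluated in the kernel. Each step advances p on the grid or lowers the order, so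
600 exceeds the number of steps for either grid. -/
theorem scan_eq_true {n : ℕ} (h3 : 3 ≤ n) (hn : n < 100) :
    scan n (cond (Nat.ble n 11) 512 64) 600 (n - 2) 0 0 = true := by
  interval_cases n <;> decide +kernel

/-- `(p - 1) / q` is a lower bound for the nonnegative upper bounds of the zeros. -/
def IsLowerCert (l q j p : ℕ) : Prop :=
  ∀ ω : ℝ, 0 ≤ ω → RootsLE j (critPoly l) ω → (p : ℝ) ≤ q * ω + 1

/-- The certificates produced by `scan`. -/
def HasGrowthCert (l k : ℕ) : Prop :=
  3 * (4 * (l + 2) ^ 2 - 9) ^ k ≤ 4 * (4 * (l + 2) * (l + 1)) ^ k ∨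
    ∃ q b c : ℕ, 0 < q ∧ IsLowerCert l q k b ∧ RootsLE (k - 1) (critPoly l) (c / q : ℝ) ∧
      growthTest (l + 2) q k b c = true

theorem IsLowerCert.of_succ {l q j p : ℕ} (hj : j ≤ l) (h : IsLowerCert l q (j + 1) p) :
    IsLowerCert l q j p := fun ω h0 hω => h ω h0 (hω.succ_critPoly hj)

/-- Since 4n(n-1) ≤ 4n^2 - 9, the inequality for the power j implies it for every smaller power. -/
theorem hasGrowthCert_of_le {l j k : ℕ} (hl : 1 ≤ l)
    (h : 3 * (4 * (l + 2) ^ 2 - 9) ^ j ≤ 4 * (4 * (l + 2) * (l + 1)) ^ j) (hkj : k ≤ j) :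
    HasGrowthCert l k := by
  refine Or.inl ?_
  obtain ⟨i, rfl⟩ := Nat.exists_eq_add_of_le hkj
  have hle : 4 * (l + 2) * (l + 1) ≤ 4 * (l + 2) ^ 2 - 9 := by
    have : 4 * (l + 2) ^ 2 = 4 * (l + 2) * (l + 1) + 4 * l + 8 := by ring
    omega
  set u := 4 * (l + 2) ^ 2 - 9
  set v := 4 * (l + 2) * (l + 1)
  have hv : 0 < v := by positivity
  by_contra! hlt
  have h1 : 4 * v ^ k * v ^ i ≤ 4 * v ^ k * u ^ i :=
    Nat.mul_le_mul_left _ (Nat.pow_le_pow_left hle i)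
  have h2 : 4 * v ^ k * u ^ i < 3 * u ^ k * u ^ i :=
    Nat.mul_lt_mul_of_pos_right hlt (pow_pos (hv.trans_le hle) i)
  rw [pow_add, pow_add] at h
  refine h.not_gt ?_
  rw [← mul_assoc, ← mul_assoc]
  exact h1.trans_lt h2

/-- Invariant: p is a lower certificate for order j - 1 and b for order j. Lowering the order moves
the largest zero right, so p stays a valid start for the next search. -/
theorem scan_sound {l q : ℕ} (hq : 0 < q) (f : ℕ) : ∀ j p b : ℕ, j ≤ l → p ≤ q →
    IsLowerCert l q (j - 1) p → IsLowerCert l q j b → scan (l + 2) q f j p b = true →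
    ∀ k, 1 ≤ k → k ≤ j → HasGrowthCert l k := by
  induction f with
  | zero => intro j p b _ _ _ _ h; simp [scan] at h
  | succ f ih =>
    intro j p b hj hp hlp hlb h k hk hkj
    obtain ⟨j, rfl⟩ : ∃ i, j = i + 1 := ⟨j - 1, by omega⟩
    rw [scan_succ] at h
    rcases le_or_gt (3 * (4 * (l + 2) ^ 2 - 9) ^ (j + 1)) (4 * (4 * (l + 2) * (l + 1)) ^ (j + 1))
      with h1 | h1
    · exact hasGrowthCert_of_le (by omega) h1 hkj
    have h1' : Nat.ble (3 * (4 * (l + 2) ^ 2 - 9) ^ (j + 1))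
        (4 * (4 * (l + 2) * (l + 2 - 1)) ^ (j + 1)) = false := by
      rw [Bool.eq_false_iff]; exact fun h => h1.not_ge (Nat.le_of_ble_eq_true h)
    rw [h1', cond_false] at h
    have hiff := derivTest_start_iff hq hp (j := j) (l := l) (by omega)
    rcases ht : derivTest (l + 2) p (q ^ 2 - p ^ 2) (j + 1) (l + 2 - (j + 1)) 1 0 with _ | _
    · rw [ht, cond_false] at h
      rcases hpq : Nat.blt p q with _ | _
      · rw [hpq, cond_false] at h; simp at h
      rw [hpq, cond_true] at h
      -- A failed test at p/q shows that every admissible ω is at least p/q; hence p + 1 is again a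
      -- lower certificate.
      refine ih (j + 1) (p + 1) b hj (Nat.le_of_ble_eq_true hpq) (fun ω h0 hω => ?_) hlb h k hk hkj
      rw [ht] at hiff
      by_contra! hlt
      refine Bool.false_ne_true (hiff.2 fun i hi => (hω.add_critPoly i (by omega) _ ?_).le)
      rw [lt_div_iff₀ (by exact_mod_cast hq)]
      push_cast at hlt
      linarith
    · rw [ht, cond_true] at h
      have hR := rootsLE_critPoly_of_nonneg (show j + (l + 1 - j) = l + 1 by omega) (hiff.1 ht)
      rcases hg : growthTest (l + 2) q (j + 1) b p with _ | _
      · rw [hg, cond_false] at h; simp at h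
      rw [hg, cond_true] at h
      rcases hkj.eq_or_lt with rfl | hlt
      · exact Or.inr ⟨q, b, p, hq, hlb, hR, hg⟩
      · refine ih j p p (by omega) hp ?_ hlp h k hk (by omega)
        have := hlp
        rw [show j + 1 - 1 = (j - 1) + 1 by omega] at this
        exact this.of_succ (by omega)

theorem hasGrowthCert_of_lt {l k : ℕ} (hk : 1 ≤ k) (hkl : k ≤ l) (hl : l < 98) :
    HasGrowthCert l k := by
  have h := scan_eq_true (n := l + 2) (by omega) (by omega)
  refine scan_sound ?_ 600 (l + 2 - 2) 0 0 (by omega) (Nat.zero_le _) ?_ ?_ h k hk (by omega)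
  · cases Nat.ble (l + 2) 11 <;> simp
  all_goals
    intro ω h0 _
    have : (0 : ℝ) ≤ ((cond (Nat.ble (l + 2) 11) 512 64 : ℕ) : ℝ) * ω := by positivity
    push_cast
    linarith

end LandauKolmogorov

namespace LandauKolmogorov

/-! ### From certificates to the growth inequality -/

namespace ZolotarevData

variable {l : ℕ} {θ : ℝ} {Z : ℝ[X]} {τ : Fin (l + 2) → ℝ} {K β : ℝ}
variable (d : ZolotarevData l θ Z τ K β)

/-- The lower certificate b bounds y from below by y₀, and c/q gives ρ through `rootsLE_tail`. Then
V = A/B is (1-y₀)/(ρ-y₀), and replacing y₀ by y is harmless because V ≥ 1. -/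
theorem growth_bound_of_cert (hd : Z.natDegree ≤ l + 2)
    (hc : Z.coeff (l + 2) = θ / ((l + 2)! : ℝ)) (hb : ∀ x ∈ I, |Z.eval x| ≤ 1) {k : ℕ}
    (hk : 1 ≤ k) (hkl : k ≤ l) {ω y : ℝ} (h0 : 0 ≤ ω) (hω : RootsLE k (critPoly l) ω)
    (hcert : HasGrowthCert l k)
    (hy : 1 + ω < (1 - 9 / (4 * ((l : ℝ) + 2) ^ 2)) * (1 + y)) :
    ∃ V ρ, 1 ≤ V ∧ ρ ≤ 1 ∧ RootsLE (k - 1) d.tail ρ ∧ V * (ρ - y) ≤ 1 - y ∧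
      ((1 - 9 / (4 * ((l : ℝ) + 2) ^ 2)) * (((l : ℝ) + 2) / (l + 1))) ^ k * (1 + 2 * V) ≤
        (1 + V) ^ 2 := by
  have hl : 1 ≤ l := hk.trans hkl
  set u := 4 * (l + 2) ^ 2 - 9 with hu
  set v := 4 * (l + 2) * (l + 1) with hv
  have hu9 : 9 < 4 * (l + 2) ^ 2 := by nlinarith
  have hu0 : 0 < u := by omega
  have hv0 : 0 < v := by positivity
  have huR : (u : ℝ) = 4 * ((l : ℝ) + 2) ^ 2 - 9 := by
    rw [hu, Nat.cast_sub hu9.le]; push_cast; ring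
  have hvR : (v : ℝ) = 4 * ((l : ℝ) + 2) * (l + 1) := by rw [hv]; push_cast; ring
  have ha : (1 - 9 / (4 * ((l : ℝ) + 2) ^ 2)) = u / (4 * ((l : ℝ) + 2) ^ 2) := by
    rw [huR]; field_simp
  have ht : (1 - 9 / (4 * ((l : ℝ) + 2) ^ 2)) * (((l : ℝ) + 2) / (l + 1)) = u / v := by
    rw [ha, hvR]; field_simp
  have huR0 : (0 : ℝ) < u := by exact_mod_cast hu0
  have hvR0 : (0 : ℝ) < v := by exact_mod_cast hv0
  rw [ht, div_pow]
  rcases hcert with h | ⟨q, b, c, hq, hlow, hR, hg⟩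
  · refine ⟨1, 1, le_rfl, le_rfl, d.rootsLE_tail_one (by omega), by linarith, ?_⟩
    rw [div_mul_eq_mul_div, div_le_iff₀ (by positivity)]
    have h' : (3 * (u : ℝ) ^ k) ≤ 4 * (v : ℝ) ^ k := by exact_mod_cast h
    linarith
  have hq0 : (0 : ℝ) < q := by exact_mod_cast hq
  have hbω := hlow ω h0 hω
  simp only [growthTest, force_eq, Bool.and_eq_true] at hg
  obtain ⟨w, hw⟩ : ∃ w, w = q + b - 1 := ⟨_, rfl⟩
  have hwR : (w : ℝ) = q + b - 1 := by rw [hw, Nat.cast_sub (by omega)]; push_cast; ring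
  rw [← hw] at hg
  obtain ⟨hB0, hBA, hk2⟩ := hg
  -- Up to the factor (l+1)qu, A and B are 1 - y₀ and ρ - y₀. Their positivity shows that the
  -- truncated subtractions defining them are genuine.
  set A := (2 * q * u - 4 * (l + 2) ^ 2 * w) * (l + 2 - 1) with hA
  set B := (l + 2) * (q + c) * u - 4 * (l + 2) ^ 2 * w * (l + 2 - 1) with hB
  replace hB0 : 0 < B := Nat.le_of_ble_eq_true hB0
  replace hBA : B ≤ A := Nat.le_of_ble_eq_true hBA
  replace hk2 := Nat.le_of_ble_eq_true hk2
  rw [show l + 2 - 1 = l + 1 by omega] at hA hB hk2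
  have hA0 : 0 < A := hB0.trans_le hBA
  have hAR : (A : ℝ) = (2 * q * u - 4 * ((l : ℝ) + 2) ^ 2 * (q + b - 1)) * (l + 1) := by
    rw [← hwR, hA, Nat.cast_mul, Nat.cast_sub]
    · push_cast; ring
    · by_contra! hlt
      rw [Nat.sub_eq_zero_of_le hlt.le, zero_mul] at hA
      omega
  have hBR : (B : ℝ) = (l + 2) * (q + c) * u - 4 * ((l : ℝ) + 2) ^ 2 * (q + b - 1) * (l + 1) := by
    rw [← hwR, hB, Nat.cast_sub]
    · push_cast; ring
    · by_contra! hlt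
      rw [Nat.sub_eq_zero_of_le hlt.le] at hB
      omega
  have hBR0 : (0 : ℝ) < B := by exact_mod_cast hB0
  have hAR0 : (0 : ℝ) < A := by exact_mod_cast hA0
  have hBAR : (B : ℝ) ≤ A := by exact_mod_cast hBA
  set M : ℝ := (l + 1) * q * u with hM
  have hM0 : 0 < M := by positivity
  set y₀ : ℝ := 4 * ((l : ℝ) + 2) ^ 2 * (q + b - 1) / (q * u) - 1 with hy₀
  set ρ : ℝ := -1 + ((l : ℝ) + 2) / (l + 1) * (1 + c / q) with hρ
  have eA : 1 - y₀ = A / M := by rw [hAR, hM, hy₀]; field_simp; ring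
  have eB : ρ - y₀ = B / M := by rw [hBR, hM, hy₀, hρ]; field_simp; ring
  have hyy : y₀ ≤ y := by
    rw [hy₀, sub_le_iff_le_add, div_le_iff₀ (by positivity)]
    rw [ha, div_mul_eq_mul_div, lt_div_iff₀ (by positivity)] at hy
    have h1 : (q : ℝ) + b - 1 ≤ q * (1 + ω) := by linarith
    have h2 := mul_le_mul_of_nonneg_left h1 (by positivity : 0 ≤ 4 * ((l : ℝ) + 2) ^ 2)
    have h3 := mul_le_mul_of_nonneg_left hy.le hq0.le
    linarith
  have hV1 : (1 : ℝ) ≤ A / B := (one_le_div hBR0).2 hBAR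
  refine ⟨A / B, ρ, hV1, ?_, d.rootsLE_tail hd hc hb (by omega) hR, ?_, ?_⟩
  · have : (B : ℝ) / M ≤ A / M := by gcongr
    linarith
  · have h1 : A / B * (ρ - y₀) = 1 - y₀ := by rw [eA, eB]; field_simp
    have h2 := mul_nonneg (sub_nonneg.2 hV1) (sub_nonneg.2 hyy)
    linarith
  · have hk3 : (u : ℝ) ^ k * ((B : ℝ) ^ 2 + 2 * A * B) ≤ (v : ℝ) ^ k * ((A : ℝ) + B) ^ 2 := by
      exact_mod_cast hk2
    rw [show (1 : ℝ) + 2 * (A / B) = (B ^ 2 + 2 * A * B) / B ^ 2 by field_simp,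
      show (1 : ℝ) + A / B = (A + B) / B by field_simp; ring, div_pow, div_mul_div_comm,
      div_le_div_iff₀ (by positivity) (by positivity)]
    calc _ = ((u : ℝ) ^ k * ((B : ℝ) ^ 2 + 2 * A * B)) * B ^ 2 := by ring
      _ ≤ ((v : ℝ) ^ k * ((A : ℝ) + B) ^ 2) * B ^ 2 := by gcongr
      _ = _ := by ring

end ZolotarevData

end LandauKolmogorov

namespace LandauKolmogorov

/-! ### The bound for large degrees -/

/-- The constant 18/25 slightly exceeds e - 2, the least value possible at c = 1. -/
theorem exp_le_of_le_one {c : ℝ} (h0 : 0 ≤ c) (h1 : c ≤ 1) :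
    Real.exp c ≤ 1 + c + 18 / 25 * c ^ 2 := by
  have h := Real.exp_bound' h0 h1 (n := 4) (by norm_num)
  simp only [Finset.sum_range_succ, Finset.sum_range_zero, Nat.factorial] at h
  norm_num at h
  nlinarith [mul_nonneg h0 h0, mul_nonneg (mul_nonneg h0 h0) (sub_nonneg.2 h1),
    mul_nonneg (mul_nonneg (mul_nonneg h0 h0) h0) (sub_nonneg.2 h1)]

theorem contraction_pow_le_exp {l k : ℕ} :
    ((1 - 9 / (4 * ((l : ℝ) + 2) ^ 2)) * (((l : ℝ) + 2) / (l + 1))) ^ k ≤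
      Real.exp (k / ((l : ℝ) + 2)) := by
  have h : (1 - 9 / (4 * ((l : ℝ) + 2) ^ 2)) * (((l : ℝ) + 2) / (l + 1)) ≤
      Real.exp (1 / ((l : ℝ) + 2)) := by
    refine le_trans ?_ (Real.add_one_le_exp _)
    have h1 : (1 - 9 / (4 * ((l : ℝ) + 2) ^ 2)) * (((l : ℝ) + 2) / (l + 1)) =
        (4 * ((l : ℝ) + 2) ^ 2 - 9) / (4 * ((l : ℝ) + 2) * (l + 1)) := by field_simp
    have h2 : 1 / ((l : ℝ) + 2) + 1 = (4 * (l + 3) * (l + 1)) / (4 * ((l : ℝ) + 2) * (l + 1)) := by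
      field_simp; ring
    rw [h1, h2]
    gcongr
    nlinarith
  have h0 : 0 ≤ (1 - 9 / (4 * ((l : ℝ) + 2) ^ 2)) * (((l : ℝ) + 2) / (l + 1)) := by
    have : 9 / (4 * ((l : ℝ) + 2) ^ 2) ≤ 9 / (4 * (0 + 2) ^ 2) := by gcongr; positivity
    have : 0 ≤ 1 - 9 / (4 * ((l : ℝ) + 2) ^ 2) := by linarith
    positivity
  calc _ ≤ Real.exp (1 / ((l : ℝ) + 2)) ^ k := pow_le_pow_left₀ h0 h k
    _ = _ := by rw [← Real.exp_nat_mul]; congr 1; ring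

/-- The numerical core: with `c = k / n`, `g = 1 - ω` and `e` the distance of two zeros. -/
theorem growth_bound_large {n c g e : ℝ} (hn : 100 ≤ n) (hc : 27 / 100 ≤ c) (hc2 : n * (1 - c) ≥ 2)
    (hg : c ^ 2 / 2 ≤ g) (he : e ^ 2 * (n ^ 2 * (1 - c ^ 2)) ≤ 4 * g) :
    (2 * c + 36 / 25 * c ^ 2 + 1 / 2) * (e + 2 / (n - 1)) ≤ g := by
  set V := 2 * c + 36 / 25 * c ^ 2 + 1 / 2 with hV
  have hc1 : c ≤ 1 := by nlinarith
  have hV0 : 0 ≤ V := by positivity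
  have hg0 : 0 < g := lt_of_lt_of_le (by positivity) hg
  have h1 : V * (2 / (n - 1)) ≤ (1 - 7 / 10 * c) * g := by
    have h2 : 2 / (n - 1) ≤ 2 / 99 := by
      gcongr; linarith
    have h3 : V * (2 / 99) ≤ (1 - 7 / 10 * c) * (c ^ 2 / 2) := by
      rw [hV]
      nlinarith [mul_nonneg (sub_nonneg.2 hc) (sub_nonneg.2 hc1),
        mul_nonneg (mul_nonneg (sub_nonneg.2 hc) (sub_nonneg.2 hc)) (sub_nonneg.2 hc1)]
    calc V * (2 / (n - 1)) ≤ V * (2 / 99) := by gcongr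
      _ ≤ _ := h3
      _ ≤ _ := by gcongr; linarith
  have hN : ∀ {N c₀ c₁ : ℝ}, c₀ ≤ c → c ≤ c₁ → 0 ≤ c₀ → N ≤ n ^ 2 * (1 - c ^ 2) →
      4 * (2 * c₁ + 36 / 25 * c₁ ^ 2 + 1 / 2) ^ 2 ≤ 49 / 200 * c₀ ^ 4 * N → 0 ≤ N →
      4 * V ^ 2 ≤ 49 / 200 * c ^ 4 * (n ^ 2 * (1 - c ^ 2)) := by
    intro N c₀ c₁ h0 h1 h00 hNle h hN0
    have hc0 : 0 ≤ c := h00.trans h0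
    calc 4 * V ^ 2 ≤ 4 * (2 * c₁ + 36 / 25 * c₁ ^ 2 + 1 / 2) ^ 2 := by rw [hV]; gcongr
      _ ≤ _ := h
      _ ≤ _ := by gcongr
  have hn2 : ∀ {c₁ : ℝ}, c ≤ c₁ → c₁ ≤ 1 → 10000 * (1 - c₁ ^ 2) ≤ n ^ 2 * (1 - c ^ 2) := by
    intro c₁ h1 h2
    have h3 : 0 ≤ 1 - c₁ ^ 2 := by nlinarith
    have h4 : 1 - c₁ ^ 2 ≤ 1 - c ^ 2 := by nlinarith
    have h5 : (10000 : ℝ) ≤ n ^ 2 := by nlinarith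
    gcongr
  have hmain : 4 * V ^ 2 ≤ 49 / 200 * c ^ 4 * (n ^ 2 * (1 - c ^ 2)) := by
    -- On each subinterval the left side is taken at the right end and c^4 at the left end. Near c =
    -- 1 the bound n^2(1-c^2) = n(1-c) n(1+c) ≥ 2 · 195 replaces the one from n ≥ 100 alone.
    rcases le_or_gt c (2 / 5) with h | h
    · exact hN hc h (by norm_num) (hn2 h (by norm_num)) (by norm_num) (by norm_num)
    rcases le_or_gt c (7 / 10) with h' | h'
    · exact hN h.le h' (by norm_num) (hn2 h' (by norm_num)) (by norm_num) (by norm_num)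
    rcases le_or_gt c (19 / 20) with h'' | h''
    · exact hN h'.le h'' (by norm_num) (hn2 h'' (by norm_num)) (by norm_num) (by norm_num)
    · refine hN (N := 390) h''.le hc1 (by norm_num) ?_ (by norm_num) (by norm_num)
      have : 195 ≤ n * (1 + c) := by nlinarith
      nlinarith
  have h2 : V * e ≤ 7 / 10 * c * g := by
    refine abs_le_of_sq_le_sq' ?_ (by positivity) |>.2
    have hD : 0 < n ^ 2 * (1 - c ^ 2) := by
      have : 0 < 1 - c := by by_contra! h; nlinarith
      have : 0 < 1 - c ^ 2 := by nlinarith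
      positivity
    refine le_of_mul_le_mul_right ?_ hD
    calc (V * e) ^ 2 * (n ^ 2 * (1 - c ^ 2)) = V ^ 2 * (e ^ 2 * (n ^ 2 * (1 - c ^ 2))) := by ring
      _ ≤ V ^ 2 * (4 * g) := by gcongr
      _ = 4 * V ^ 2 * g := by ring
      _ ≤ 49 / 200 * c ^ 4 * (n ^ 2 * (1 - c ^ 2)) * g := by gcongr
      _ = 49 / 100 * c ^ 2 * (n ^ 2 * (1 - c ^ 2)) * g * (c ^ 2 / 2) := by ring
      _ ≤ 49 / 100 * c ^ 2 * (n ^ 2 * (1 - c ^ 2)) * g * g := by gcongr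
      _ = _ := by ring
  calc _ = V * e + V * (2 / (n - 1)) := by ring
    _ ≤ 7 / 10 * c * g + (1 - 7 / 10 * c) * g := add_le_add h2 h1
    _ = g := by ring

theorem sq_le_of_mul_le {n c ω : ℝ} (hn : 100 ≤ n) (hc : c ≤ 1) (hc0 : 0 ≤ c)
    (h : (n ^ 2 + c * n + 5 / 4) * ω ^ 2 ≤ n ^ 2 - (c * n + 1) ^ 2) : ω ^ 2 ≤ 1 - c ^ 2 := by
  have h3 : 0 < n ^ 2 + c * n + 5 / 4 := by positivity
  refine le_of_mul_le_mul_left (h.trans ?_) h3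
  have h4 : c ^ 2 * (c * n + 5 / 4) ≤ 1 * (c * n + 5 / 4) := by
    gcongr
    exact pow_le_one₀ hc0 hc
  have h5 : 0 ≤ c * n := by positivity
  linarith

namespace ZolotarevData

variable {l : ℕ} {θ : ℝ} {Z : ℝ[X]} {τ : Fin (l + 2) → ℝ} {K β : ℝ}
variable (d : ZolotarevData l θ Z τ K β)

/-- With c = k/n, the loss is at most e^c. The differential equation gives ω^2 ≤ 1 - c^2 and a bound
for the gap between the largest zeros of orders k - 1 and k. The dilation of the roots adds at most
2/(n-1) to that gap. -/
theorem growth_bound_of_large (hd : Z.natDegree ≤ l + 2)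
    (hc : Z.coeff (l + 2) = θ / ((l + 2)! : ℝ)) (hb : ∀ x ∈ I, |Z.eval x| ≤ 1) {k : ℕ}
    (hk : 1 ≤ k) (hkl : k ≤ l) (hl : 98 ≤ l) {ω y : ℝ} (h0 : 0 ≤ ω)
    (hω0 : (derivative^[k] (critPoly l)).eval ω = 0) (hω : RootsLE k (critPoly l) ω)
    (hy : 1 + ω < (1 - 9 / (4 * ((l : ℝ) + 2) ^ 2)) * (1 + y)) :
    ∃ V ρ, 1 ≤ V ∧ ρ ≤ 1 ∧ RootsLE (k - 1) d.tail ρ ∧ V * (ρ - y) ≤ 1 - y ∧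
      ((1 - 9 / (4 * ((l : ℝ) + 2) ^ 2)) * (((l : ℝ) + 2) / (l + 1))) ^ k * (1 + 2 * V) ≤
        (1 + V) ^ 2 := by
  have hT := contraction_pow_le_exp (l := l) (k := k)
  set T := ((1 - 9 / (4 * ((l : ℝ) + 2) ^ 2)) * (((l : ℝ) + 2) / (l + 1))) ^ k
  rcases le_or_gt T (4 / 3) with hT1 | hT1
  · exact ⟨1, 1, le_rfl, le_rfl, d.rootsLE_tail_one (by omega), by linarith, by linarith⟩
  set n : ℝ := (l : ℝ) + 2 with hn
  have hn100 : 100 ≤ n := by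
    have : (98 : ℝ) ≤ l := by exact_mod_cast hl
    linarith
  set c : ℝ := k / n with hcdef
  have hkc : (k : ℝ) = c * n := by rw [hcdef, div_mul_cancel₀ _ (by linarith)]
  have hc0 : 0 ≤ c := by positivity
  have hkn : (k : ℝ) + 2 ≤ n := by
    have : (k : ℝ) ≤ l := by exact_mod_cast hkl
    linarith
  have hcn : n * (1 - c) ≥ 2 := by linarith
  have hc1 : c ≤ 1 := by
    have := pos_of_mul_pos_right (show 0 < n * (1 - c) by linarith) (by linarith)
    linarith
  have hexp := exp_le_of_le_one hc0 hc1
  -- For smaller c the quadratic bound for e^c is below 4/3, contrary to the case assumption.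
  have hcl : 27 / 100 ≤ c := by
    by_contra! hlt
    have : c ^ 2 ≤ (27 / 100) ^ 2 := pow_le_pow_left₀ hc0 hlt.le 2
    linarith
  have h1 : ω < 1 := lt_one_of_critPoly_zero (by omega) hω0
  have hω2 : ω ^ 2 ≤ 1 - c ^ 2 :=
    sq_le_of_mul_le hn100 hc1 hc0 (hkc ▸ sq_top_critPoly_le hkl h0 hω0 hω)
  obtain ⟨x, hωx, hx1, hx, hgap⟩ := exists_top_critPoly_sub_sq_le (j := k - 1) (l := l) (by omega)
    h0 (by rwa [Nat.sub_add_cancel hk]) (by rwa [Nat.sub_add_cancel hk])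
  rw [Nat.cast_sub hk, ← hn, Nat.cast_one, sub_add_cancel] at hgap
  -- Chosen so that V/2 + 3/4 is the quadratic bound for e^c; and (V/2 + 3/4)(1+2V) = (1+V)^2 - 1/4.
  set V := 2 * c + 36 / 25 * c ^ 2 + 1 / 2 with hV
  have hV1 : 1 ≤ V := by
    have : (27 / 100) ^ 2 ≤ c ^ 2 := pow_le_pow_left₀ (by norm_num) hcl 2
    linarith
  have hkey : V * ((x - ω) + 2 / (n - 1)) ≤ 1 - ω :=
    growth_bound_large hn100 hcl hcn (by nlinarith) (by
      have : n ^ 2 * (1 - c ^ 2) = n ^ 2 - k ^ 2 := by rw [hkc]; ring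
      rw [this]
      refine hgap.trans ?_
      nlinarith)
  have hy' : ω ≤ y := by
    have h3 : 0 ≤ 9 / (4 * n ^ 2) := by positivity
    have h6 : 9 / (4 * n ^ 2) ≤ 9 / (4 * 100 ^ 2) := by gcongr
    have h4 : 0 < 1 + y :=
      pos_of_mul_pos_right (show 0 < (1 - 9 / (4 * n ^ 2)) * (1 + y) by linarith) (by linarith)
    have h5 := mul_nonneg h3 h4.le
    linarith
  set ρ : ℝ := -1 + n / (l + 1) * (1 + x) with hρ
  have hρ2 : ρ - ω ≤ (x - ω) + 2 / (n - 1) := by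
    have h3 : ρ - x = (1 + x) / (n - 1) := by
      have hl1 : (l : ℝ) + 1 ≠ 0 := by positivity
      rw [hρ, show n - 1 = (l : ℝ) + 1 by rw [hn]; ring, sub_eq_iff_eq_add, hn]
      field_simp
      ring
    have h4 : (1 + x) / (n - 1) ≤ 2 / (n - 1) := by
      gcongr
      · linarith
      · linarith
    linarith
  have hρV : V * (ρ - ω) ≤ 1 - ω := (mul_le_mul_of_nonneg_left hρ2 (by linarith)).trans hkey
  refine ⟨V, ρ, hV1, ?_, d.rootsLE_tail hd hc hb (by omega) hx, ?_, ?_⟩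
  · by_contra! h3
    have h4 : 1 * (ρ - ω) ≤ V * (ρ - ω) := mul_le_mul_of_nonneg_right hV1 (by linarith)
    linarith
  · have := mul_nonneg (sub_nonneg.2 hV1) (sub_nonneg.2 hy')
    linarith
  · have h3 : T ≤ V / 2 + 3 / 4 := by rw [hV]; linarith
    calc T * (1 + 2 * V) ≤ (V / 2 + 3 / 4) * (1 + 2 * V) := by gcongr
      _ ≤ _ := by linarith [sq_nonneg V]

theorem growth_bound (hd : Z.natDegree ≤ l + 2)
    (hc : Z.coeff (l + 2) = θ / ((l + 2)! : ℝ)) (hb : ∀ x ∈ I, |Z.eval x| ≤ 1) {k : ℕ}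
    (hk : 1 ≤ k) (hkl : k ≤ l) {ω y : ℝ} (h0 : 0 ≤ ω)
    (hω0 : (derivative^[k] (critPoly l)).eval ω = 0) (hω : RootsLE k (critPoly l) ω)
    (hy : 1 + ω < (1 - 9 / (4 * ((l : ℝ) + 2) ^ 2)) * (1 + y)) :
    ∃ V ρ, 1 ≤ V ∧ ρ ≤ 1 ∧ RootsLE (k - 1) d.tail ρ ∧ V * (ρ - y) ≤ 1 - y ∧
      ((1 - 9 / (4 * ((l : ℝ) + 2) ^ 2)) * (((l : ℝ) + 2) / (l + 1))) ^ k * (1 + 2 * V) ≤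
        (1 + V) ^ 2 := by
  rcases Nat.lt_or_ge l 98 with h | h
  · exact d.growth_bound_of_cert hd hc hb hk hkl h0 hω (hasGrowthCert_of_lt hk hkl h) hy
  · exact d.growth_bound_of_large hd hc hb hk hkl h h0 hω0 hω hy

end ZolotarevData

end LandauKolmogorov

/-! ### Reduction of general σ to |θ|, and the conclusion -/

namespace LandauKolmogorov

/-- For σ > s, the contraction with fixed point x and ratio c, where c^(m+1) = s/σ, carries F into
the class for s and multiplies the k-th derivative at x by c^k. -/
theorem IsSobolevJet.abs_le_rpow_mul {m k : ℕ} {s σ M x : ℝ} (hs : 0 < s)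
    (hx : x ∈ I)
    (h : ∀ F, IsSobolevJet m s F → F (k + 1) x = 0 → F k x ≤ M) {F : ℕ → ℝ → ℝ}
    (hF : IsSobolevJet m σ F) (hF1 : F (k + 1) x = 0) :
    |F k x| ≤ max 1 (σ / s) ^ ((k : ℝ) / ((m + 1 : ℕ) : ℝ)) * M := by
  have h2 : ∀ F, IsSobolevJet m s F → F (k + 1) x = 0 → |F k x| ≤ M := fun F hF hF1 =>
    abs_le'.2 ⟨h F hF hF1, h _ hF.neg (by simp [hF1])⟩
  rcases le_or_gt σ s with hle | hlt
  · rw [max_eq_left ((div_le_one hs).2 hle), Real.one_rpow, one_mul]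
    exact h2 F (hF.mono hle) hF1
  have hσ0 : 0 < σ := hs.trans hlt
  set c : ℝ := (s / σ) ^ ((1 : ℝ) / ((m + 1 : ℕ) : ℝ)) with hc
  have hc0 : 0 < c := Real.rpow_pos_of_pos (div_pos hs hσ0) _
  have hc1 : c ≤ 1 := Real.rpow_le_one (by positivity) ((div_le_one hσ0).2 hlt.le) (by positivity)
  have hcm : c ^ (m + 1) * σ = s := by
    rw [hc, one_div, Real.rpow_inv_natCast_pow (by positivity) (by omega),
      div_mul_cancel₀ _ hσ0.ne']
  have hG := hF.contract (b := (1 - c) * x) hc0.le (by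
    rw [abs_mul, abs_of_nonneg (sub_nonneg.2 hc1)]
    have := mul_le_mul_of_nonneg_left (abs_le.2 hx) (sub_nonneg.2 hc1)
    linarith)
  rw [hcm] at hG
  have hxx : (1 - c) * x + c * x = x := by ring
  have h3 := h2 _ hG (by simp only [hxx, hF1, mul_zero])
  simp only [hxx, abs_mul, abs_of_nonneg (pow_nonneg hc0.le k)] at h3
  have h4 : max 1 (σ / s) ^ ((k : ℝ) / ((m + 1 : ℕ) : ℝ)) = (c ^ k)⁻¹ := by
    rw [max_eq_right ((one_le_div hs).2 hlt.le), hc, ← Real.rpow_natCast, ← Real.rpow_mul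
      (by positivity), ← Real.rpow_neg (by positivity), ← inv_div s σ, Real.inv_rpow
      (by positivity), ← Real.rpow_neg (by positivity)]
    congr 1
    ring
  rw [h4, inv_mul_eq_div, le_div_iff₀ (pow_pos hc0 k)]
  linarith

end LandauKolmogorov

theorem mainTheorem5 (n k : ℕ) (hk : 1 ≤ k) (hkn : k + 2 ≤ n) (σ : ℝ) (hσ : 0 ≤ σ)
    (ω : ℝ)
    (hω : IsGreatest {x : ℝ | LandauKolmogorov.derivAt (Polynomial.Chebyshev.T ℝ (n : ℤ)) (k + 1) x = 0} ω)
    (θ : ℝ) (Z : Polynomial ℝ) (hZ : LandauKolmogorov.IsZolotarev n θ Z)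
    (hZ1 : LandauKolmogorov.derivAt Z (k + 1) 1 = 0) :
    ∀ x₀ ∈ Set.Icc ω 1,
      LandauKolmogorov.mStar n k x₀ σ ≤
        (((max 1 (σ / |θ|)) ^ ((k : ℝ) / (n : ℝ)) *
          max |LandauKolmogorov.derivAt (Polynomial.Chebyshev.T ℝ (n : ℤ)) k ω|
            |LandauKolmogorov.derivAt Z k 1| : ℝ) : EReal) := by
  obtain ⟨l, rfl⟩ : ∃ l, n = l + 2 := ⟨n - 2, by omega⟩
  have hkl : k ≤ l := by omega
  intro x₀ hx₀
  obtain ⟨τ, K, β, d⟩ := LandauKolmogorov.exists_zolotarevData hk hkl hZ hZ1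
  obtain ⟨hω0, hωR⟩ := LandauKolmogorov.rootsLE_critPoly_of_isGreatest hkl hω
  have h0 := LandauKolmogorov.omega_nonneg hω
  refine sSup_le ?_
  rintro y ⟨f, hf, hf1, rfl⟩
  rw [EReal.coe_le_coe_iff]
  refine LandauKolmogorov.IsSobolevJet.abs_le_rpow_mul (m := l + 1) (abs_pos.2 d.theta_neg.ne)
    ⟨by linarith [hx₀.1], hx₀.2⟩ (fun F hF hF1 => ?_)
    (LandauKolmogorov.isSobolevJet_of_mem_sobolevClass hf) hf1
  exact d.jet_bound hZ.1 hZ.2.1 hZ.2.2.1 hk hkl hZ1 (by linarith) hω0 hωR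
    (fun y hy _ _ => d.growth_bound hZ.1 hZ.2.1 hZ.2.2.1 hk hkl h0 hω0 hωR hy) hx₀ hF hF1
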